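/- **Setting.** Let $\mathbb K\in\{\mathbb R,\mathbb C\}$, $\mathbb N=\{1,2,\dots\}$, $\log=\log_2$, $a_+=\max(a,0)$, $1/\infty=0$; let $\delta_{p,\infty}=1$ if $p=\infty$ and $0$ otherwise. For a finite set $M$ and $1\le p\le\infty$, $L_p^M$ is the space of all functions $f:M\to\mathbb K$ with norm $\big(\frac1{|M|}\sum_{i\in M}|f(i)|^p\big)^{1/p}$ if $p<\infty$ and $\max_{i\in M}|f(i)|$ if $p=\infty$. For $N_1,N_2\in\mathbb N$ put $L_q^{N_1}=L_q^{\{1,\dots,N_1\}}$, $L_p^{N_1,N_2}=L_p^{\{1,\dots,N_1\}\times\{1,\dots,N_2\}}$, let $F$ be the closed unit ball of $L_p^{N_1,N_2}$, $G=L_q^{N_1}$, and let $S=S^{N_1,N_2}:F\to G$, $(Sf)(i)=\frac1{N_2}\sum_{j=1}^{N_2}f(i,j)$. Let $\Lambda$ be the set of the functionals $\delta_{ij}:F\to\mathbb K$, $\delta_{ij}(f)=f(i,j)$. A *deterministic algorithm* $A$ consists of arbitrary maps $L_{i+1}:\mathbb K^{i}\to\Lambda$, $\tau_i:\mathbb K^i\to\{0,1\}$,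 $\varphi_i:\mathbb K^i\to G$ $(i\ge 0$; for $i=0$ these are just elements of $\Lambda,\{0,1\},G)$. For $f\in F$ put $z_{i}=\big(L_{i}(z_1,\dots,z_{i-1})\big)(f)$ $(i\ge1)$. The cardinality $\mathrm{card}(A,f)$ is the least $i\ge0$ with $\tau_i(z_1,\dots,z_i)=1$, and $\infty$ if there is none; the output $A(f)$ is $\varphi_i(z_1,\dots,z_i)$ if $\mathrm{card}(A,f)=i<\infty$, and $\varphi_0$ if $\mathrm{card}(A,f)=\infty$. $A$ is *non-adaptive* if all $L_i$ and $\tau_i$ are constant. A *randomized algorithm* is a family $(A_\omega)_{\omega\in\Omega}$ of deterministic algorithms indexed by a probability space $\Omega$ such that for each $f\in F$ the map $\omega\mapsto\mathrm{card}(A_\omega,f)$ is measurable and $\omega\mapsto A_\omega(f)$ is Borel measurable and almost surely separably valued; it is non-adaptive if every $A_\omega$ is. For $n\in\mathbb N$ let $e_n^{\rm det}$ be the infimum of $\sup_{f\in F}\|Sf-A(f)\|_G$ over all deterministic algorithms $A$ with $\sup_{f\in F}\mathrm{card}(A,f)\le n$, and let $e_n^{\rm ran}$ be the infimum of $\sup_{f\in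 F}\mathbb E\|Sf-A_\omega(f)\|_G$ over all randomized algorithms with $\sup_{f\in F}\mathbb E\,\mathrm{card}(A_\omega,f)\le n$. The quantities $e_n^{\rm det\text{-}non}$ and $e_n^{\rm ran\text{-}non}$ are the same infima over the non-adaptive algorithms only. **Theorem.** Let $1\le p,q\le\infty$ and $\bar p=\min(p,2)$. Then there are constants $0<c_0<1$ and $c_1,\dots,c_7>0$ such that for all $n,N_1,N_2\in\mathbb N$ with $n<c_0N_1N_2$ the following hold. If $p\le2$ or $p\ge q$, then $$c_1N_1^{(1/p-1/q)_+}\Big\lceil\frac n{N_1}\Big\rceil^{-(1-1/\bar p)}\min\Big(\log(N_1+1),\Big\lceil\frac n{N_1}\Big\rceil\Big)^{\delta_{p,\infty}\delta_{q,\infty}/2}\le e_n^{\rm ran}\le e_n^{\rm ran\text{-}non}$$ $$\le c_2N_1^{(1/p-1/q)_+}\Big\lceil\frac n{N_1}\Big\rceil^{-(1-1/\bar p)}\min\Big(\log(N_1+1),\Big\lceil\frac n{N_1}\Big\rceil\Big)^{\delta_{p,\infty}\delta_{q,\infty}/2}.$$ If $2<p<q$, then $$c_3N_1^{1/p-1/q}\Big\lceil\frac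 n{N_1}\Big\rceil^{-(1-1/p)}+c_3\Big\lceil\frac n{N_1}\Big\rceil^{-1/2}\big(\log(N_1+1)\big)^{\delta_{q,\infty}/2}\le e_n^{\rm ran}$$ $$\le c_4N_1^{1/p-1/q}\Big\lceil\frac n{N_1\log(N_1+N_2)}\Big\rceil^{-(1-1/p)}+c_4\Big\lceil\frac n{N_1\log(N_1+N_2)}\Big\rceil^{-1/2}$$ and $$c_5N_1^{1/p-1/q}\Big\lceil\frac n{N_1}\Big\rceil^{-1/2}\le e_n^{\rm ran\text{-}non}\le c_6N_1^{1/p-1/q}\Big\lceil\frac n{N_1}\Big\rceil^{-1/2}.$$ In the deterministic setting, for all $1\le p,q\le\infty$, $$c_7N_1^{(1/p-1/q)_+}\le e_n^{\rm det}\le e_n^{\rm det\text{-}non}\le N_1^{(1/p-1/q)_+}.$$ -/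

import Mathlib

open scoped ENNReal

universe u

noncomputable section

/-! ### Algorithms and minimal errors in information-based complexity

An abstract numerical problem consists of a set `F` of inputs, a normed space `G`, a solution
operator `S : F → G`, a set `K` of information values and a set `Λ` of maps `F → K`, the admissible
information functionals. -/

namespace IBC

/-- A deterministic algorithm. Having seen the values `y ∈ K ^ i` of its first `i` information
functionals, it either stops (`halt i y = true`) with output `out i y`, or evaluates the functional
`query i y ∈ Λ` next. For `i = 0` the tuple `y` is the empty one, so `query 0`, `halt 0`, `out 0` are
just an element of `Λ`, a truth value and an element of `G`. -/
structure DetAlg {F K : Type*} (Λ : Set (F → K)) (G : Type*) where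
  query : (i : ℕ) → (Fin i → K) → Λ
  halt : (i : ℕ) → (Fin i → K) → Bool
  out : (i : ℕ) → (Fin i → K) → G

namespace DetAlg

variable {F K G : Type*} {Λ : Set (F → K)}

/-- The values of the first `i` information functionals chosen at input `f` (no regard to
stopping). -/
def values (A : DetAlg Λ G) (f : F) : (i : ℕ) → (Fin i → K)
  | 0 => Fin.elim0
  | i + 1 => Fin.snoc (A.values f i) ((A.query i (A.values f i)).1 f)

/-- The algorithm stops after `i` information values at input `f`. -/
def StopsAt (A : DetAlg Λ G) (f : F) (i : ℕ) : Prop := A.halt i (A.values f i) = true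

open scoped Classical in
/-- The cardinality of `A` at input `f`: the first `i` at which it stops, `∞` if it never does. -/
def card (A : DetAlg Λ G) (f : F) : ℕ∞ :=
  if h : ∃ i, A.StopsAt f i then ((Nat.find h : ℕ) : ℕ∞) else ⊤

open scoped Classical in
/-- The output of `A` at input `f`; by convention it is `out 0` if `A` does not stop at `f`. -/
def output (A : DetAlg Λ G) (f : F) : G :=
  if h : ∃ i, A.StopsAt f i then A.out (Nat.find h) (A.values f (Nat.find h))
  else A.out 0 Fin.elim0

/-- Non-adaptive: the choice of the functionals and the stopping do not depend on the information
values. -/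
def IsNonadaptive (A : DetAlg Λ G) : Prop :=
  ∀ (i : ℕ) (y z : Fin i → K), A.query i y = A.query i z ∧ A.halt i y = A.halt i z

end DetAlg

/-- A randomized algorithm: a family of deterministic algorithms indexed by a probability space, such
that for each input the cardinality is measurable and the output is Borel measurable and almost surely
separably valued. -/
structure RanAlg {F K : Type*} (Λ : Set (F → K)) (G : Type*) [TopologicalSpace G]
    [MeasurableSpace G] where
  Ω : Type u
  [mΩ : MeasurableSpace Ω]
  P : MeasureTheory.Measure Ω
  [isProb : MeasureTheory.IsProbabilityMeasure P]
  alg : Ω → DetAlg Λ G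
  measurable_card : ∀ f : F, Measurable fun ω => (alg ω).card f
  measurable_output : ∀ f : F, Measurable fun ω => (alg ω).output f
  separable_output : ∀ f : F, ∃ V : Set G, TopologicalSpace.IsSeparable V ∧
    ∀ᵐ ω ∂P, (alg ω).output f ∈ V

namespace RanAlg

variable {F K G : Type*} {Λ : Set (F → K)}

/-- The cardinality of a randomized algorithm: the supremum over all inputs of the expected
cardinality. -/
def card [TopologicalSpace G] [MeasurableSpace G] (A : RanAlg.{u} Λ G) : ℝ≥0∞ :=
  letI := A.mΩ
  ⨆ f : F, ∫⁻ ω, (((A.alg ω).card f : ℕ∞) : ℝ≥0∞) ∂A.P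

/-- The error of a randomized algorithm: the supremum over all inputs of the expected distance
between the output and the exact solution. -/
def error [NormedAddCommGroup G] [MeasurableSpace G] (A : RanAlg.{u} Λ G) (S : F → G) : ℝ≥0∞ :=
  letI := A.mΩ
  ⨆ f : F, ∫⁻ ω, ‖S f - (A.alg ω).output f‖ₑ ∂A.P

/-- A randomized algorithm is non-adaptive if each of its deterministic realizations is. -/
def IsNonadaptive [TopologicalSpace G] [MeasurableSpace G] (A : RanAlg.{u} Λ G) : Prop :=
  ∀ ω, (A.alg ω).IsNonadaptive

end RanAlg

section MinimalErrors

variable {F K G : Type*} [NormedAddCommGroup G]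

/-- The deterministic `n`-th minimal error. -/
def errDet (S : F → G) (Λ : Set (F → K)) (n : ℕ) : ℝ≥0∞ :=
  ⨅ (A : DetAlg Λ G) (_ : (⨆ f, A.card f) ≤ (n : ℕ∞)), ⨆ f, ‖S f - A.output f‖ₑ

/-- The non-adaptive deterministic `n`-th minimal error. -/
def errDetNon (S : F → G) (Λ : Set (F → K)) (n : ℕ) : ℝ≥0∞ :=
  ⨅ (A : DetAlg Λ G) (_ : A.IsNonadaptive) (_ : (⨆ f, A.card f) ≤ (n : ℕ∞)),
    ⨆ f, ‖S f - A.output f‖ₑ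

/-- The (adaptive) randomized `n`-th minimal error. -/
def errRan [MeasurableSpace G] (S : F → G) (Λ : Set (F → K)) (n : ℕ) : ℝ≥0∞ :=
  ⨅ (A : RanAlg.{u} Λ G) (_ : A.card ≤ (n : ℝ≥0∞)), A.error S

/-- The non-adaptive randomized `n`-th minimal error. -/
def errRanNon [MeasurableSpace G] (S : F → G) (Λ : Set (F → K)) (n : ℕ) : ℝ≥0∞ :=
  ⨅ (A : RanAlg.{u} Λ G) (_ : A.IsNonadaptive) (_ : A.card ≤ (n : ℝ≥0∞)), A.error S

end MinimalErrors

end IBC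

/-! ### The normalized spaces `L_p^M` -/

/-- The space `L_p^M` of all functions `M → 𝕜` on a finite set `M`. -/
def MeanLp (_p : ℝ≥0∞) (𝕜 M : Type*) : Type _ := M → 𝕜

namespace MeanLp

variable {p : ℝ≥0∞} {𝕜 M : Type*}

instance [AddCommGroup 𝕜] : AddCommGroup (MeanLp p 𝕜 M) := inferInstanceAs (AddCommGroup (M → 𝕜))

instance [Ring 𝕜] : Module 𝕜 (MeanLp p 𝕜 M) := inferInstanceAs (Module 𝕜 (M → 𝕜))

open scoped Classical in
/-- The norm is `(|M|⁻¹ ∑ |f i| ^ p) ^ (1 / p)` for `p < ∞`, and the maximum of the `|f i|` for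
`p = ∞`. -/
instance [Fintype M] [Norm 𝕜] : Norm (MeanLp p 𝕜 M) where
  norm f := if p = ∞ then ⨆ i : M, ‖f i‖
    else ((Fintype.card M : ℝ)⁻¹ * ∑ i : M, ‖f i‖ ^ p.toReal) ^ (1 / p.toReal)

theorem norm_def [Fintype M] [Norm 𝕜] (f : MeanLp p 𝕜 M) :
    ‖f‖ = if p = ∞ then ⨆ i : M, ‖f i‖
      else ((Fintype.card M : ℝ)⁻¹ * ∑ i : M, ‖f i‖ ^ p.toReal) ^ (1 / p.toReal) := by
  classical
  simp only [Norm.norm]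

variable [Fintype M] [RCLike 𝕜] [hp : Fact (1 ≤ p)]

theorem norm_eq_mul (f : MeanLp p 𝕜 M) :
    ‖f‖ = ((Fintype.card M : ℝ)⁻¹) ^ (1 / p.toReal) *
      ‖(WithLp.toLp p (show M → 𝕜 from f) : PiLp p fun _ : M => 𝕜)‖ := by
  rw [norm_def]
  by_cases h : p = ∞
  · subst h
    simp [PiLp.norm_eq_ciSup]
  · have h0 : 0 < p.toReal :=
      ENNReal.toReal_pos (lt_of_lt_of_le zero_lt_one hp.out).ne' h
    rw [if_neg h, PiLp.norm_eq_sum h0, Real.mul_rpow (by positivity) (by positivity)]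

theorem normCore : NormedSpace.Core 𝕜 (MeanLp p 𝕜 M) where
  norm_nonneg f := by rw [norm_eq_mul]; positivity
  norm_smul c f := by
    rw [norm_eq_mul, norm_eq_mul]
    have : (WithLp.toLp p (show M → 𝕜 from c • f) : PiLp p fun _ : M => 𝕜)
        = c • WithLp.toLp p (show M → 𝕜 from f) := rfl
    rw [this, norm_smul]; ring
  norm_triangle f g := by
    rw [norm_eq_mul, norm_eq_mul, norm_eq_mul, ← mul_add]
    have : (WithLp.toLp p (show M → 𝕜 from f + g) : PiLp p fun _ : M => 𝕜)
        = WithLp.toLp p (show M → 𝕜 from f) + WithLp.toLp p (show M → 𝕜 from g) := rfl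
    rw [this]
    exact mul_le_mul_of_nonneg_left (norm_add_le _ _) (by positivity)
  norm_eq_zero_iff f := by
    rw [norm_eq_mul, mul_eq_zero, norm_eq_zero]
    constructor
    · rintro (h | h)
      · rcases isEmpty_or_nonempty M with hM | hM
        · exact funext fun i => (hM.false i).elim
        · have : (0 : ℝ) < ((Fintype.card M : ℝ)⁻¹) ^ (1 / p.toReal) := by
            have : 0 < Fintype.card M := Fintype.card_pos
            positivity
          exact absurd h this.ne'
      · funext i
        exact congrArg (fun x : PiLp p fun _ : M => 𝕜 => x i) h
    · rintro rfl
      right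
      rfl

instance : NormedAddCommGroup (MeanLp p 𝕜 M) := NormedAddCommGroup.ofCore (normCore (𝕜 := 𝕜))

instance : NormedSpace 𝕜 (MeanLp p 𝕜 M) := NormedSpace.ofCore normCore

instance : MeasurableSpace (MeanLp p 𝕜 M) := borel _

instance : BorelSpace (MeanLp p 𝕜 M) := ⟨rfl⟩

end MeanLp

/-! ### Vector-valued mean computation -/

section Mean

variable (𝕜 : Type*) [RCLike 𝕜] (p q : ℝ≥0∞) [Fact (1 ≤ p)] [Fact (1 ≤ q)] (N₁ N₂ : ℕ)

/-- The input set: the closed unit ball of `L_p^{N₁,N₂}`. -/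
abbrev MeanInput : Type _ := ↥(Metric.closedBall (0 : MeanLp p 𝕜 (Fin N₁ × Fin N₂)) 1)

/-- The operator `S^{N₁,N₂}` that sends `f` to its vector of row means, as a map from the unit ball
of `L_p^{N₁,N₂}` to `L_q^{N₁}`. -/
def meanOp (f : MeanInput 𝕜 p N₁ N₂) : MeanLp q 𝕜 (Fin N₁) :=
  fun i => (N₂ : 𝕜)⁻¹ * ∑ j : Fin N₂, f.1 (i, j)

/-- Standard information: the values `f (i, j)`. -/
def pointEvals : Set (MeanInput 𝕜 p N₁ N₂ → 𝕜) :=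
  Set.range fun (x : Fin N₁ × Fin N₂) (f : MeanInput 𝕜 p N₁ N₂) => f.1 x

/-- `e_n^ran (S^{N₁,N₂}, B_{L_p^{N₁,N₂}}, L_q^{N₁})` -/
def eRan (n : ℕ) : ℝ≥0∞ :=
  IBC.errRan.{u} (meanOp 𝕜 p q N₁ N₂) (pointEvals 𝕜 p N₁ N₂) n

/-- `e_n^ran-non (S^{N₁,N₂}, B_{L_p^{N₁,N₂}}, L_q^{N₁})` -/
def eRanNon (n : ℕ) : ℝ≥0∞ :=
  IBC.errRanNon.{u} (meanOp 𝕜 p q N₁ N₂) (pointEvals 𝕜 p N₁ N₂) n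

/-- `e_n^det (S^{N₁,N₂}, B_{L_p^{N₁,N₂}}, L_q^{N₁})` -/
def eDet (n : ℕ) : ℝ≥0∞ :=
  IBC.errDet (meanOp 𝕜 p q N₁ N₂) (pointEvals 𝕜 p N₁ N₂) n

/-- `e_n^det-non (S^{N₁,N₂}, B_{L_p^{N₁,N₂}}, L_q^{N₁})` -/
def eDetNon (n : ℕ) : ℝ≥0∞ :=
  IBC.errDetNon (meanOp 𝕜 p q N₁ N₂) (pointEvals 𝕜 p N₁ N₂) n

end Mean

/-! ### Abbreviations for the rates -/

/-- The real number `1 / p` for `1 ≤ p ≤ ∞`, with `1 / ∞ = 0`. -/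
def recip (p : ℝ≥0∞) : ℝ := (p⁻¹).toReal

open scoped Classical in
/-- The Kronecker symbol `δ_{p,∞}`. -/
def deltaTop (p : ℝ≥0∞) : ℝ := if p = ∞ then 1 else 0

/-- `⌈n / N₁⌉` -/
def ceilDiv (n N₁ : ℕ) : ℝ := (⌈(n : ℝ) / (N₁ : ℝ)⌉₊ : ℝ)

/-- `⌈n / (N₁ log₂ (N₁ + N₂))⌉` -/
def ceilDivLog (n N₁ N₂ : ℕ) : ℝ :=
  (⌈(n : ℝ) / ((N₁ : ℝ) * Real.logb 2 ((N₁ : ℝ) + (N₂ : ℝ)))⌉₊ : ℝ)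

end

/-!
Every lower bound is an average over a finite family of inputs, and every algorithm behind an upper
bound has finitely many realizations with uniform distribution; so apart from the passage to and from
`RanAlg` only finite averages `𝔼` occur. Below, `N` is the number of rows, `M` the number of columns,
and `k = ⌈n / N⌉`.

*Lower bounds.* An algorithm cannot distinguish two inputs that agree at the points which it queries
at one of them (`DetAlg.output_queried_congr`). Hence a lower bound, valid for each deterministic
algorithm, in which the average error is traded linearly against the number of queries passes to
randomized algorithms (`RanAlg_error_ge`). Repeating every entry of a short array turns inputs with
rows of length `B ≈ 8 k` into inputs with rows of length `M` (`eRan_ge_of_spread`), so that at most a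
fixed fraction of the entries is known. The hard inputs are a single entry of maximal size
(`eRan_ge_of_single`), one such entry in every row (`eRan_ge_of_row_needles`), and independent random
signs (`eRan_ge_of_signs`). For random signs the unseen part is again an array of independent signs,
whatever the algorithm has seen (`expect_unseen_le`). In the maximum norm over the rows the signs are
collected in `s ≈ log N` groups per row; since `N` is exponentially large in `s`, there is typically
a row all of whose group sums are large, which is the origin of the logarithm
(`eRan_top_ge_of_signs`). A non-adaptive algorithm cannot concentrate its queries on the one row
where random signs of size `N ^ (1 / p)` are hidden (`eRanNon_ge_of_row_signs`); this separates it
from the adaptive ones if `2 < p < q`.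

*Upper bounds.* The zero algorithm serves for `n < N`. Otherwise the same `⌊n / N⌋` random columns are
sampled in every row; symmetrization and Khintchine's inequality bound the `p`-th moments of the
errors of the row means, and a union bound with exponential moments treats `p = q = ∞`. If
`2 < p < q`, the adaptive algorithm spends a pilot sample on estimating the second moment of each
row, then samples the row in proportion to this estimate, and returns medians of group means, whose
failure probability is exponentially small in the number `ℓ ≈ log (N + M)` of groups
(`prob_rowEst_le`). The second moments of the rows of an input average to at most one, so this costs
`O (N ℓ m)` evaluations, where `m` is the size of a pilot group. If the second moment of a row is so
small compared with its `p`-th moment that the pilot sample may miss it, then the basic sample size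
suffices.

*Deterministic setting.* The zero algorithm is optimal up to a factor, since an input may vanish at
all queried points.
-/

open scoped BigOperators

noncomputable section

/-! ### The normalized norms -/

/-- The norm of `L_p^M`, as a functional of plain functions `M → 𝕜`. This avoids the type synonym
`MeanLp` where several exponents occur. -/
def meanNorm {𝕜 M : Type*} [RCLike 𝕜] [Fintype M] (p : ℝ≥0∞) (x : M → 𝕜) : ℝ :=
  ‖(show MeanLp p 𝕜 M from x)‖

section MeanNorm

variable {𝕜 M : Type*} [RCLike 𝕜] [Fintype M] {p q : ℝ≥0∞}

theorem recip_eq (p : ℝ≥0∞) : recip p = 1 / p.toReal := by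
  simp [recip, ENNReal.toReal_inv]

theorem recip_top : recip ∞ = 0 := by simp [recip]

theorem recip_two : recip 2 = 1 / 2 := by rw [recip_eq, ENNReal.toReal_ofNat]

theorem recip_nonneg (p : ℝ≥0∞) : 0 ≤ recip p := ENNReal.toReal_nonneg

theorem recip_le_one [hp : Fact (1 ≤ p)] : recip p ≤ 1 := by
  have : p⁻¹ ≤ 1 := ENNReal.inv_le_one.2 hp.out
  simpa [recip] using ENNReal.toReal_mono ENNReal.one_ne_top this

theorem recip_anti [hp : Fact (1 ≤ p)] (h : p ≤ q) : recip q ≤ recip p := by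
  refine ENNReal.toReal_mono ?_ (ENNReal.inv_le_inv.2 h)
  exact ENNReal.inv_ne_top.2 (lt_of_lt_of_le zero_lt_one hp.out).ne'

theorem one_le_toReal [hp : Fact (1 ≤ p)] (h : p ≠ ∞) : 1 ≤ p.toReal := by
  simpa using ENNReal.toReal_mono h hp.out

theorem meanNorm_top (x : M → 𝕜) : meanNorm ∞ x = ⨆ i, ‖x i‖ := by
  rw [meanNorm, MeanLp.norm_def, if_pos rfl]

theorem meanNorm_of_ne_top (h : p ≠ ∞) (x : M → 𝕜) :
    meanNorm p x = (𝔼 i, ‖x i‖ ^ p.toReal) ^ (1 / p.toReal) := by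
  rw [meanNorm, MeanLp.norm_def, if_neg h, Fintype.expect_eq_sum_div_card,
    div_eq_inv_mul (∑ i, ‖x i‖ ^ p.toReal)]

theorem meanNorm_rpow [hp : Fact (1 ≤ p)] (h : p ≠ ∞) (x : M → 𝕜) :
    meanNorm p x ^ p.toReal = 𝔼 i, ‖x i‖ ^ p.toReal := by
  have := one_le_toReal (p := p) h
  rw [meanNorm_of_ne_top h, ← Real.rpow_mul (Finset.expect_nonneg fun i _ => by positivity),
    one_div_mul_cancel (by linarith), Real.rpow_one]

theorem meanNorm_nonneg [Fact (1 ≤ p)] (x : M → 𝕜) : 0 ≤ meanNorm p x :=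
  norm_nonneg (show MeanLp p 𝕜 M from x)

theorem meanNorm_le_of_rpow_le [hp : Fact (1 ≤ p)] (h : p ≠ ∞) {x : M → 𝕜} {C : ℝ} (hC : 0 ≤ C)
    (hx : 𝔼 i, ‖x i‖ ^ p.toReal ≤ C ^ p.toReal) : meanNorm p x ≤ C := by
  have := one_le_toReal (p := p) h
  rw [← meanNorm_rpow h] at hx
  exact (Real.rpow_le_rpow_iff (meanNorm_nonneg x) hC (by linarith)).1 hx

theorem meanNorm_add_le [Fact (1 ≤ p)] (x y : M → 𝕜) :
    meanNorm p (x + y) ≤ meanNorm p x + meanNorm p y :=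
  norm_add_le (show MeanLp p 𝕜 M from x) (show MeanLp p 𝕜 M from y)

theorem meanNorm_smul [Fact (1 ≤ p)] (c : 𝕜) (x : M → 𝕜) :
    meanNorm p (c • x) = ‖c‖ * meanNorm p x :=
  norm_smul c (show MeanLp p 𝕜 M from x)

theorem meanNorm_neg [Fact (1 ≤ p)] (x : M → 𝕜) : meanNorm p (-x) = meanNorm p x :=
  norm_neg (show MeanLp p 𝕜 M from x)

theorem two_meanNorm_le [Fact (1 ≤ p)] (x y a : M → 𝕜) :
    2 * meanNorm p x ≤ meanNorm p (y + x - a) + meanNorm p (y - x - a) := by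
  have h := meanNorm_add_le (p := p) (y + x - a) (-(y - x - a))
  have e : y + x - a + -(y - x - a) = (2 : 𝕜) • x := by
    ext i; simp [two_mul]
  rw [e, meanNorm_smul, meanNorm_neg] at h
  simpa using h

theorem norm_apply_le_meanNorm_top (x : M → 𝕜) (i : M) : ‖x i‖ ≤ meanNorm ∞ x := by
  rw [meanNorm_top]
  exact le_ciSup (Set.finite_range fun i => ‖x i‖).bddAbove i

theorem norm_apply_le [hp : Fact (1 ≤ p)] (x : M → 𝕜) (i : M) :
    ‖x i‖ ≤ (Fintype.card M : ℝ) ^ recip p * meanNorm p x := by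
  rcases eq_or_ne p ∞ with rfl | h
  · simpa [recip_top] using norm_apply_le_meanNorm_top x i
  · have h1 := one_le_toReal (p := p) h
    have hM : (0 : ℝ) < Fintype.card M := by
      have : 0 < Fintype.card M := Fintype.card_pos_iff.2 ⟨i⟩
      exact_mod_cast this
    refine (Real.rpow_le_rpow_iff (norm_nonneg _) (mul_nonneg (by positivity)
      (meanNorm_nonneg x)) (show 0 < p.toReal by linarith)).1 ?_
    rw [Real.mul_rpow (by positivity) (meanNorm_nonneg x), meanNorm_rpow h, ← Real.rpow_mul hM.le,
      recip_eq, one_div_mul_cancel (by linarith), Real.rpow_one, Fintype.card_mul_expect]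
    exact Finset.single_le_sum (f := fun i => ‖x i‖ ^ p.toReal) (fun i _ => by positivity)
      (Finset.mem_univ i)

theorem meanNorm_le_of_forall_le [hp : Fact (1 ≤ p)] {x : M → 𝕜} {C : ℝ} (hC : 0 ≤ C)
    (hx : ∀ i, ‖x i‖ ≤ C) : meanNorm p x ≤ C := by
  rcases eq_or_ne p ∞ with rfl | h
  · rw [meanNorm_top]
    exact Real.iSup_le hx hC
  · have h1 := one_le_toReal (p := p) h
    refine meanNorm_le_of_rpow_le h hC ?_
    rcases isEmpty_or_nonempty M with hM | hM
    · simp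
      positivity
    · refine Finset.expect_le Finset.univ_nonempty fun i _ => ?_
      exact Real.rpow_le_rpow (norm_nonneg _) (hx i) (by linarith)

theorem meanNorm_mono {𝕜' : Type*} [RCLike 𝕜'] [hp : Fact (1 ≤ p)] {x : M → 𝕜} {y : M → 𝕜'}
    (h : ∀ i, ‖x i‖ ≤ ‖y i‖) : meanNorm p x ≤ meanNorm p y := by
  rcases eq_or_ne p ∞ with rfl | hp'
  · exact meanNorm_le_of_forall_le (meanNorm_nonneg y)
      fun i => (h i).trans (norm_apply_le_meanNorm_top y i)
  · have h1 := one_le_toReal (p := p) hp'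
    refine meanNorm_le_of_rpow_le hp' (meanNorm_nonneg y) ?_
    rw [meanNorm_rpow hp']
    exact Finset.expect_le_expect fun i _ => Real.rpow_le_rpow (norm_nonneg _) (h i) (by linarith)

/-- The normalized norms increase with the exponent. -/
theorem meanNorm_le_meanNorm [hp : Fact (1 ≤ p)] [hq : Fact (1 ≤ q)] (h : q ≤ p) (x : M → 𝕜) :
    meanNorm q x ≤ meanNorm p x := by
  rcases eq_or_ne p ∞ with rfl | hp'
  · exact meanNorm_le_of_forall_le (meanNorm_nonneg x) (norm_apply_le_meanNorm_top x)
  have hq' : q ≠ ∞ := ne_top_of_le_ne_top hp' h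
  have h1 := one_le_toReal (p := p) hp'
  have h2 := one_le_toReal (p := q) hq'
  have h3 : q.toReal ≤ p.toReal := ENNReal.toReal_mono hp' h
  rcases isEmpty_or_nonempty M with hM | hM
  · exact meanNorm_le_of_forall_le (meanNorm_nonneg x) (fun i => (hM.false i).elim)
  have h0 : 0 ≤ 𝔼 i, ‖x i‖ ^ q.toReal := Finset.expect_nonneg fun i _ => by positivity
  have key : (𝔼 i, ‖x i‖ ^ q.toReal) ^ (p.toReal / q.toReal) ≤ 𝔼 i, ‖x i‖ ^ p.toReal := by
    have := Real.rpow_arith_mean_le_arith_mean_rpow (Finset.univ : Finset M)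
      (fun _ => (Fintype.card M : ℝ)⁻¹) (fun i => ‖x i‖ ^ q.toReal) (fun i _ => by positivity)
      (by simp) (fun i _ => by positivity) (p := p.toReal / q.toReal)
      ((one_le_div (by linarith)).2 h3)
    rw [← Finset.mul_sum, ← Finset.mul_sum] at this
    rw [Fintype.expect_eq_sum_div_card, Fintype.expect_eq_sum_div_card,
      div_eq_inv_mul (∑ i, ‖x i‖ ^ q.toReal), div_eq_inv_mul (∑ i, ‖x i‖ ^ p.toReal)]
    convert this using 3 with i
    rw [← Real.rpow_mul (norm_nonneg _), mul_div_cancel₀ _ (by linarith)]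
  refine meanNorm_le_of_rpow_le hq' (meanNorm_nonneg x) ?_
  refine (Real.rpow_le_rpow_iff h0 (Real.rpow_nonneg (meanNorm_nonneg x) _)
    (show 0 < p.toReal / q.toReal by apply div_pos <;> linarith)).1 ?_
  rwa [← Real.rpow_mul (meanNorm_nonneg x), mul_div_cancel₀ _ (by linarith), meanNorm_rpow hp']

/-- The inverse inequality between normalized norms: `|x i| ^ q` is split into `|x i| ^ p` and a power
that is bounded by means of `norm_apply_le`. -/
theorem meanNorm_le_card_rpow_mul [hp : Fact (1 ≤ p)] [hq : Fact (1 ≤ q)] (h : p ≤ q)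
    (x : M → 𝕜) :
    meanNorm q x ≤ (Fintype.card M : ℝ) ^ (recip p - recip q) * meanNorm p x := by
  rcases isEmpty_or_nonempty M with hM | hM
  · exact meanNorm_le_of_forall_le (mul_nonneg (by positivity) (meanNorm_nonneg x))
      (fun i => (hM.false i).elim)
  rcases eq_or_ne q ∞ with rfl | hq'
  · refine meanNorm_le_of_forall_le (mul_nonneg (by positivity) (meanNorm_nonneg x)) fun i => ?_
    simpa [recip_top] using norm_apply_le (p := p) x i
  have hp' : p ≠ ∞ := ne_top_of_le_ne_top hq' h
  have h1 := one_le_toReal (p := p) hp'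
  have h2 := one_le_toReal (p := q) hq'
  have h3 : p.toReal ≤ q.toReal := ENNReal.toReal_mono hq' h
  have hM0 : (0 : ℝ) < Fintype.card M := by exact_mod_cast Fintype.card_pos
  set A : ℝ := (Fintype.card M : ℝ) ^ recip p * meanNorm p x with hA
  have hA0 : 0 ≤ A := mul_nonneg (by positivity) (meanNorm_nonneg x)
  refine meanNorm_le_of_rpow_le hq' (mul_nonneg (by positivity) (meanNorm_nonneg x)) ?_
  calc 𝔼 i, ‖x i‖ ^ q.toReal ≤ 𝔼 i, ‖x i‖ ^ p.toReal * A ^ (q.toReal - p.toReal) := by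
        refine Finset.expect_le_expect fun i _ => ?_
        have : ‖x i‖ ^ q.toReal = ‖x i‖ ^ p.toReal * ‖x i‖ ^ (q.toReal - p.toReal) := by
          rw [← Real.rpow_add_of_nonneg (norm_nonneg _) (by linarith) (by linarith)]
          congr 1; ring
        rw [this]
        exact mul_le_mul_of_nonneg_left (Real.rpow_le_rpow (norm_nonneg _) (norm_apply_le x i)
          (by linarith)) (by positivity)
    _ = meanNorm p x ^ p.toReal * A ^ (q.toReal - p.toReal) := by
        rw [← Finset.expect_mul, meanNorm_rpow hp']
    _ = _ := by
        rw [hA, Real.mul_rpow (by positivity) (meanNorm_nonneg x),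
          Real.mul_rpow (by positivity) (meanNorm_nonneg x), mul_left_comm,
          ← Real.rpow_add_of_nonneg (meanNorm_nonneg x) (by linarith) (by linarith),
          ← Real.rpow_mul hM0.le, ← Real.rpow_mul hM0.le, recip_eq, recip_eq]
        congr 2
        · field_simp
        · ring

theorem meanNorm_le_card_rpow_max_mul [hp : Fact (1 ≤ p)] [hq : Fact (1 ≤ q)] [Nonempty M]
    (x : M → 𝕜) :
    meanNorm q x ≤ (Fintype.card M : ℝ) ^ max (recip p - recip q) 0 * meanNorm p x := by
  have hM : (1 : ℝ) ≤ Fintype.card M := by exact_mod_cast Fintype.card_pos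
  rcases le_total p q with h | h
  · refine (meanNorm_le_card_rpow_mul h x).trans ?_
    exact mul_le_mul_of_nonneg_right (Real.rpow_le_rpow_of_exponent_le hM (le_max_left _ _))
      (meanNorm_nonneg x)
  · refine (meanNorm_le_meanNorm h x).trans ?_
    refine le_mul_of_one_le_left (meanNorm_nonneg x) (Real.one_le_rpow hM (le_max_right _ _))

theorem expect_norm_le_meanNorm [hp : Fact (1 ≤ p)] (x : M → 𝕜) :
    𝔼 i, ‖x i‖ ≤ meanNorm p x := by
  have := meanNorm_le_meanNorm (q := 1) (p := p) hp.out x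
  rw [meanNorm_of_ne_top (by simp)] at this
  simpa using this

/-- The norm of a function that vanishes off a single point. -/
theorem meanNorm_single [hp : Fact (1 ≤ p)] [DecidableEq M] (i : M) (c : 𝕜) :
    meanNorm p (Pi.single i c) = ‖c‖ / (Fintype.card M : ℝ) ^ recip p := by
  have hM0 : (0 : ℝ) < Fintype.card M := by
    have : 0 < Fintype.card M := Fintype.card_pos_iff.2 ⟨i⟩
    exact_mod_cast this
  apply le_antisymm
  · rcases eq_or_ne p ∞ with rfl | h
    · refine meanNorm_le_of_forall_le (by positivity) fun j => ?_
      rcases eq_or_ne j i with rfl | hj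
      · simp [recip_top]
      · simp [recip_top, hj]
    · have h1 := one_le_toReal (p := p) h
      refine meanNorm_le_of_rpow_le h (by positivity) ?_
      rw [Fintype.expect_eq_sum_div_card, Finset.sum_eq_single i]
      · rw [Real.div_rpow (norm_nonneg _) (by positivity), ← Real.rpow_mul hM0.le, recip_eq,
          one_div_mul_cancel (by linarith)]
        simp
      · intro j _ hj
        simp [hj, Real.zero_rpow (show p.toReal ≠ 0 by linarith)]
      · simp
  · rw [div_le_iff₀ (by positivity), mul_comm]
    simpa using norm_apply_le (p := p) (Pi.single i c : M → 𝕜) i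

end MeanNorm

/-! ### Row means -/

section RowMean

variable {𝕜 : Type*} [RCLike 𝕜] {p q : ℝ≥0∞}

/-- The vector of row means of an array. -/
def rowMean {I J : Type*} [Fintype J] (x : I × J → 𝕜) (i : I) : 𝕜 :=
  (Fintype.card J : 𝕜)⁻¹ * ∑ j, x (i, j)

theorem norm_rowMean_le {I J : Type*} [Fintype J] (x : I × J → 𝕜) (i : I) :
    ‖rowMean x i‖ ≤ 𝔼 j, ‖x (i, j)‖ := by
  rw [rowMean, norm_mul, Fintype.expect_eq_sum_div_card, div_eq_inv_mul]
  simp only [norm_inv, RCLike.norm_natCast]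
  gcongr
  exact norm_sum_le _ _

theorem meanNorm_rowMean_le {I J : Type*} [Fintype I] [Fintype J] [hp : Fact (1 ≤ p)]
    (x : I × J → 𝕜) : meanNorm p (rowMean x) ≤ meanNorm p x := by
  rcases eq_or_ne p ∞ with rfl | h
  · refine meanNorm_le_of_forall_le (meanNorm_nonneg x) fun i => (norm_rowMean_le x i).trans ?_
    rcases isEmpty_or_nonempty J with hJ | hJ
    · simpa using meanNorm_nonneg (p := ∞) x
    · exact Finset.expect_le Finset.univ_nonempty fun j _ => norm_apply_le_meanNorm_top x _
  · have h1 := one_le_toReal (p := p) h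
    refine meanNorm_le_of_rpow_le h (meanNorm_nonneg x) ?_
    rw [meanNorm_rpow h, ← Finset.univ_product_univ, Finset.expect_product]
    refine Finset.expect_le_expect fun i _ => ?_
    have h2 := expect_norm_le_meanNorm (p := p) (fun j => x (i, j))
    rw [← meanNorm_rpow (p := p) h (fun j => x (i, j))]
    refine Real.rpow_le_rpow (norm_nonneg _) ((norm_rowMean_le x i).trans h2) (by linarith)

theorem meanNorm_input_le [Fact (1 ≤ p)] {N M : ℕ} (f : MeanInput 𝕜 p N M) :
    meanNorm p (f.1 : Fin N × Fin M → 𝕜) ≤ 1 :=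
  mem_closedBall_zero_iff.1 f.2

/-- An array in the unit ball, as an input. -/
def mkInput [Fact (1 ≤ p)] {N M : ℕ} (x : Fin N × Fin M → 𝕜) (hx : meanNorm p x ≤ 1) :
    MeanInput 𝕜 p N M :=
  ⟨x, mem_closedBall_zero_iff.2 hx⟩

theorem meanOp_eq_rowMean [Fact (1 ≤ p)] [Fact (1 ≤ q)] {N M : ℕ} (f : MeanInput 𝕜 p N M) :
    meanOp 𝕜 p q N M f = rowMean (f.1 : Fin N × Fin M → 𝕜) := by
  funext i; simp [meanOp, rowMean]

theorem norm_meanOp_sub [Fact (1 ≤ p)] [Fact (1 ≤ q)] {N M : ℕ} (f : MeanInput 𝕜 p N M)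
    (g : Fin N → 𝕜) :
    ‖meanOp 𝕜 p q N M f - (show MeanLp q 𝕜 (Fin N) from g)‖
      = meanNorm q (rowMean (f.1 : Fin N × Fin M → 𝕜) - g) := by
  rw [meanNorm, meanOp_eq_rowMean]; rfl

end RowMean

/-! ### The points queried by an algorithm -/

namespace IBC.DetAlg

section General

variable {F K G : Type*} {Λ : Set (F → K)}

theorem card_eq_of_stopsAt (A : DetAlg Λ G) {f : F} {i : ℕ} (hi : A.StopsAt f i)
    (hlt : ∀ j < i, ¬ A.StopsAt f j) : A.card f = i := by
  classical
  have h : ∃ i, A.StopsAt f i := ⟨i, hi⟩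
  rw [card, dif_pos h, (Nat.find_eq_iff h).2 ⟨hi, hlt⟩]

theorem output_eq_of_stopsAt (A : DetAlg Λ G) {f : F} {i : ℕ} (hi : A.StopsAt f i)
    (hlt : ∀ j < i, ¬ A.StopsAt f j) : A.output f = A.out i (A.values f i) := by
  classical
  have h : ∃ i, A.StopsAt f i := ⟨i, hi⟩
  rw [output, dif_pos h, (Nat.find_eq_iff h).2 ⟨hi, hlt⟩]

theorem exists_stopsAt_or (A : DetAlg Λ G) (f : F) :
    (∃ i, A.StopsAt f i ∧ ∀ j < i, ¬ A.StopsAt f j) ∨ ∀ i, ¬ A.StopsAt f i := by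
  classical
  by_cases h : ∃ i, A.StopsAt f i
  · exact Or.inl ⟨Nat.find h, Nat.find_spec h, fun j hj => Nat.find_min h hj⟩
  · exact Or.inr (not_exists.1 h)

/-- The information values at `f` and `g` agree as long as the functionals chosen at `f` do not
distinguish `f` from `g`. -/
theorem values_congr (A : DetAlg Λ G) {f g : F} {n : ℕ}
    (h : ∀ i < n, (A.query i (A.values f i)).1 g = (A.query i (A.values f i)).1 f) :
    ∀ i ≤ n, A.values g i = A.values f i := by
  intro i
  induction i with
  | zero => intro _; rfl
  | succ i ih =>
    intro hi
    rw [values, values, ih (by omega), h i (by omega)]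

end General

section Points

variable {𝕜 G : Type*} [RCLike 𝕜] {p : ℝ≥0∞} [Fact (1 ≤ p)] {N M : ℕ}

/-- A point at which an element of `pointEvals` evaluates its argument. -/
def evalPoint (l : pointEvals 𝕜 p N M) : Fin N × Fin M := l.2.choose

theorem evalPoint_spec (l : pointEvals 𝕜 p N M) (f : MeanInput 𝕜 p N M) :
    l.1 f = f.1 (evalPoint l) :=
  (congrFun l.2.choose_spec f).symm

open scoped Classical in
/-- The points at which `A` evaluates `f` before it stops. -/
def queried (A : DetAlg (pointEvals 𝕜 p N M) G) (f : MeanInput 𝕜 p N M) :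
    Finset (Fin N × Fin M) :=
  Finset.univ.filter fun x => ∃ i, (∀ j ≤ i, ¬ A.StopsAt f j) ∧
    evalPoint (A.query i (A.values f i)) = x

theorem mem_queried {A : DetAlg (pointEvals 𝕜 p N M) G} {f : MeanInput 𝕜 p N M}
    {x : Fin N × Fin M} : x ∈ A.queried f ↔ ∃ i, (∀ j ≤ i, ¬ A.StopsAt f j) ∧
      evalPoint (A.query i (A.values f i)) = x := by
  simp [queried]

theorem card_queried_le (A : DetAlg (pointEvals 𝕜 p N M) G) (f : MeanInput 𝕜 p N M) :
    ((A.queried f).card : ℕ∞) ≤ A.card f := by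
  classical
  rcases A.exists_stopsAt_or f with ⟨n, hn, hlt⟩ | h
  · rw [A.card_eq_of_stopsAt hn hlt]
    have hsub : A.queried f ⊆ (Finset.range n).image
        fun i => evalPoint (A.query i (A.values f i)) := by
      intro x hx
      obtain ⟨i, hi, rfl⟩ := mem_queried.1 hx
      refine Finset.mem_image_of_mem _ (Finset.mem_range.2 ?_)
      by_contra hni
      exact hi n (by omega) hn
    exact_mod_cast (Finset.card_le_card hsub).trans (Finset.card_image_le.trans (by simp))
  · have : A.card f = ⊤ := by
      rw [card, dif_neg]
      exact not_exists.2 h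
    rw [this]
    exact le_top

/-- An algorithm cannot tell two inputs apart that agree at the points queried at one of them. -/
theorem output_queried_congr (A : DetAlg (pointEvals 𝕜 p N M) G) {f g : MeanInput 𝕜 p N M}
    (h : ∀ x ∈ A.queried f, g.1 x = f.1 x) :
    A.output g = A.output f ∧ A.queried g = A.queried f := by
  classical
  have hval : ∀ n, (∀ j < n, ¬ A.StopsAt f j) → ∀ i ≤ n, A.values g i = A.values f i := by
    intro n hn
    refine A.values_congr fun i hi => ?_
    rw [evalPoint_spec, evalPoint_spec]
    exact h _ (mem_queried.2 ⟨i, fun j hj => hn j (by omega), rfl⟩)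
  rcases A.exists_stopsAt_or f with ⟨n, hn, hlt⟩ | hns
  · have hv := hval n hlt
    have hst : ∀ i ≤ n, (A.StopsAt g i ↔ A.StopsAt f i) := fun i hi => by
      simp only [StopsAt, hv i hi]
    have hgn := (hst n le_rfl).2 hn
    have hglt : ∀ j < n, ¬ A.StopsAt g j := fun j hj => by
      rw [hst j hj.le]; exact hlt j hj
    refine ⟨by rw [A.output_eq_of_stopsAt hn hlt, A.output_eq_of_stopsAt hgn hglt, hv n le_rfl], ?_⟩
    ext x
    simp only [mem_queried]
    refine exists_congr fun i => ?_
    rcases lt_or_ge i n with hi | hi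
    · rw [hv i hi.le]
      refine and_congr_left fun _ => forall₂_congr fun j hj => ?_
      rw [hst j (by omega)]
    · exact iff_of_false (fun hc => hc.1 n hi hgn) (fun hc => hc.1 n hi hn)
  · have hv : ∀ i, A.values g i = A.values f i := fun i => hval i (fun j _ => hns j) i le_rfl
    have hst : ∀ i, (A.StopsAt g i ↔ A.StopsAt f i) := fun i => by simp only [StopsAt, hv i]
    have hgs : ∀ i, ¬ A.StopsAt g i := fun i => by rw [hst]; exact hns i
    refine ⟨?_, ?_⟩
    · rw [output, output, dif_neg (not_exists.2 hns), dif_neg (not_exists.2 hgs)]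
    · ext x
      simp only [mem_queried, hv, hst]

theorem IsNonadaptive.queried_eq {A : DetAlg (pointEvals 𝕜 p N M) G} (hA : A.IsNonadaptive)
    (f g : MeanInput 𝕜 p N M) : A.queried f = A.queried g := by
  ext x
  simp only [mem_queried]
  refine exists_congr fun i => ?_
  rw [(hA i (A.values f i) (A.values g i)).1]
  refine and_congr_left fun _ => forall₂_congr fun j _ => ?_
  rw [StopsAt, StopsAt, (hA j (A.values f j) (A.values g j)).2]

end Points

end IBC.DetAlg

/-! ### Lower bounds by averaging over finitely many inputs -/

section Averaging

open MeasureTheory IBC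

variable {𝕜 : Type*} [RCLike 𝕜] {p q : ℝ≥0∞} [Fact (1 ≤ p)] [Fact (1 ≤ q)] {N M : ℕ}

/-- The average over a finite family of inputs is a lower bound for the worst case error of a
randomized algorithm, once each of its deterministic realizations satisfies a lower bound in which
the error is traded linearly against the number of queries. Linearity is what allows for taking
expectations of a random cardinality. -/
theorem RanAlg_error_ge {U : Type*} [Fintype U] [Nonempty U] (f : U → MeanInput 𝕜 p N M)
    {κ c : ℝ} (hc : 0 ≤ c)
    (A : RanAlg.{u} (pointEvals 𝕜 p N M) (MeanLp q 𝕜 (Fin N)))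
    (H : ∀ ω, κ * Fintype.card U
      ≤ ∑ u, (‖meanOp 𝕜 p q N M (f u) - (A.alg ω).output (f u)‖
        + c * ((A.alg ω).queried (f u)).card)) {n : ℕ} (hA : A.card ≤ n) :
    ENNReal.ofReal (κ - c * n) ≤ A.error (meanOp 𝕜 p q N M) := by
  let := A.mΩ
  have := A.isProb
  set S := meanOp 𝕜 p q N M
  have hm1 : ∀ u, Measurable fun ω => ‖S (f u) - (A.alg ω).output (f u)‖ₑ := fun u =>
    ((continuous_const.sub continuous_id).enorm.measurable).comp (A.measurable_output (f u))
  have hm2 : ∀ u, Measurable fun ω => ENNReal.ofReal c * (((A.alg ω).card (f u) : ℕ∞) : ℝ≥0∞) :=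
    fun u => ((measurable_of_countable (fun k : ℕ∞ => (k : ℝ≥0∞))).comp
      (A.measurable_card (f u))).const_mul _
  have hm3 : ∀ u, Measurable fun ω => ‖S (f u) - (A.alg ω).output (f u)‖ₑ
      + ENNReal.ofReal c * (((A.alg ω).card (f u) : ℕ∞) : ℝ≥0∞) := fun u => (hm1 u).add (hm2 u)
  have hU : (Fintype.card U : ℝ≥0∞) ≠ 0 := by simp
  have h1 : ENNReal.ofReal κ * Fintype.card U
      ≤ Fintype.card U * (A.error S + ENNReal.ofReal c * n) := by
    calc ENNReal.ofReal κ * Fintype.card U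
        = ∫⁻ _ω, ENNReal.ofReal κ * Fintype.card U ∂A.P := by simp
      _ ≤ ∫⁻ ω, ∑ u, (‖S (f u) - (A.alg ω).output (f u)‖ₑ
            + ENNReal.ofReal c * (((A.alg ω).card (f u) : ℕ∞) : ℝ≥0∞)) ∂A.P := by
          refine lintegral_mono fun ω => ?_
          have h2 := ENNReal.ofReal_le_ofReal (H ω)
          rw [ENNReal.ofReal_mul' (by positivity), ENNReal.ofReal_natCast] at h2
          refine h2.trans ?_
          rw [ENNReal.ofReal_sum_of_nonneg fun u _ => by positivity]
          refine Finset.sum_le_sum fun u _ => ?_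
          rw [ENNReal.ofReal_add (by positivity) (by positivity), ENNReal.ofReal_mul hc,
            ENNReal.ofReal_natCast, ofReal_norm]
          gcongr
          have := (A.alg ω).card_queried_le (f u)
          calc (((A.alg ω).queried (f u)).card : ℝ≥0∞)
              = ((((A.alg ω).queried (f u)).card : ℕ∞) : ℝ≥0∞) := by simp
            _ ≤ _ := by exact_mod_cast this
      _ = ∑ u, (∫⁻ ω, ‖S (f u) - (A.alg ω).output (f u)‖ₑ ∂A.P
            + ENNReal.ofReal c * ∫⁻ ω, (((A.alg ω).card (f u) : ℕ∞) : ℝ≥0∞) ∂A.P) := by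
          rw [lintegral_finsetSum _ fun u _ => hm3 u]
          refine Finset.sum_congr rfl fun u _ => ?_
          rw [lintegral_add_left (hm1 u), lintegral_const_mul']
          exact ENNReal.ofReal_ne_top
      _ ≤ ∑ _u : U, (A.error S + ENNReal.ofReal c * n) := by
          refine Finset.sum_le_sum fun u _ => ?_
          gcongr
          · exact le_iSup (fun f => ∫⁻ ω, ‖S f - (A.alg ω).output f‖ₑ ∂A.P) (f u)
          · exact (le_iSup (fun f => ∫⁻ ω, (((A.alg ω).card f : ℕ∞) : ℝ≥0∞) ∂A.P) (f u)).trans hA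
      _ = _ := by simp [mul_add]
  rw [mul_comm] at h1
  have h3 := (ENNReal.mul_le_mul_iff_right hU (by simp)).1 h1
  rw [ENNReal.ofReal_sub _ (by positivity), tsub_le_iff_right, ENNReal.ofReal_mul hc,
    ENNReal.ofReal_natCast]
  exact h3

end Averaging

/-! ### Spreading a short array over longer rows -/

section Spread

open IBC

variable {𝕜 : Type*} [RCLike 𝕜] {p q : ℝ≥0∞} {N M B b : ℕ}

/-- The array with rows of length `M` in which every entry of an array with rows of length `B` is
repeated `b` times, at the places given by `e`, and whose other entries vanish. -/
def spread (e : Fin B × Fin b ↪ Fin M) (x : Fin N × Fin B → 𝕜) (y : Fin N × Fin M) : 𝕜 :=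
  Function.extend e (fun t => x (y.1, t.1)) 0 y.2

theorem spread_apply (e : Fin B × Fin b ↪ Fin M) (x : Fin N × Fin B → 𝕜) (i : Fin N)
    (t : Fin B × Fin b) : spread e x (i, e t) = x (i, t.1) :=
  e.injective.extend_apply _ _ _

theorem spread_of_notMem (e : Fin B × Fin b ↪ Fin M) (x : Fin N × Fin B → 𝕜) (i : Fin N)
    {j : Fin M} (hj : j ∉ Set.range e) : spread e x (i, j) = 0 :=
  Function.extend_apply' _ _ _ hj

theorem sum_spread {R : Type*} [AddCommMonoid R] (e : Fin B × Fin b ↪ Fin M)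
    (x : Fin N × Fin B → 𝕜) (i : Fin N) (φ : 𝕜 → R) (h0 : φ 0 = 0) :
    ∑ j, φ (spread e x (i, j)) = b • ∑ t, φ (x (i, t)) := by
  rw [← Fintype.sum_of_injective e e.injective (fun t => φ (x (i, t.1)))
    (fun j => φ (spread e x (i, j)))]
  · rw [Fintype.sum_prod_type]
    simp [Finset.smul_sum]
  · intro j hj
    rw [spread_of_notMem e x i hj, h0]
  · intro t
    rw [spread_apply]

theorem rowMean_spread (hB : 1 ≤ B) (e : Fin B × Fin b ↪ Fin M) (x : Fin N × Fin B → 𝕜) :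
    rowMean (spread e x) = (((b * B / M : ℝ) : ℝ) : 𝕜) • rowMean x := by
  funext i
  have h := sum_spread e x i (id : 𝕜 → 𝕜) rfl
  simp only [id] at h
  have hB' : (B : 𝕜) ≠ 0 := by exact_mod_cast (by omega : B ≠ 0)
  simp only [rowMean, h, Pi.smul_apply, smul_eq_mul, Fintype.card_fin, nsmul_eq_mul]
  push_cast
  field_simp

theorem meanNorm_spread_le [hp : Fact (1 ≤ p)] (hB : 1 ≤ B) (hM : b * B ≤ M)
    (e : Fin B × Fin b ↪ Fin M) (x : Fin N × Fin B → 𝕜) :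
    meanNorm p (spread e x) ≤ meanNorm p x := by
  rcases eq_or_ne p ∞ with rfl | h
  · refine meanNorm_le_of_forall_le (meanNorm_nonneg x) ?_
    rintro ⟨i, j⟩
    by_cases hj : j ∈ Set.range e
    · obtain ⟨t, rfl⟩ := hj
      rw [spread_apply]
      exact norm_apply_le_meanNorm_top x _
    · rw [spread_of_notMem e x i hj, norm_zero]
      exact meanNorm_nonneg x
  · have h1 := one_le_toReal (p := p) h
    refine meanNorm_le_of_rpow_le h (meanNorm_nonneg x) ?_
    rw [meanNorm_rpow h, ← Finset.univ_product_univ, Finset.expect_product,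
      ← Finset.univ_product_univ, Finset.expect_product]
    refine Finset.expect_le_expect fun i _ => ?_
    rw [Fintype.expect_eq_sum_div_card, Fintype.expect_eq_sum_div_card,
      sum_spread e x i (fun z => ‖z‖ ^ p.toReal)
        (by simp [Real.zero_rpow (show p.toReal ≠ 0 by linarith)])]
    have hS : 0 ≤ ∑ t, ‖x (i, t)‖ ^ p.toReal := Finset.sum_nonneg fun t _ => by positivity
    simp only [Fintype.card_fin, nsmul_eq_mul]
    have hB' : (0 : ℝ) < B := by exact_mod_cast hB
    rcases Nat.eq_zero_or_pos b with rfl | hb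
    · simp only [Nat.cast_zero, zero_mul, zero_div]; positivity
    have hM' : (0 : ℝ) < M := by
      have : 0 < M := lt_of_lt_of_le (Nat.mul_pos hb hB) hM
      exact_mod_cast this
    rw [div_le_div_iff₀ hM' hB']
    have : (b : ℝ) * B ≤ M := by exact_mod_cast hM
    nlinarith

open scoped Classical in
/-- The entries of the short array that an algorithm learns about from the spread array. -/
def spreadQueried (e : Fin B × Fin b ↪ Fin M) (Q : Finset (Fin N × Fin M)) :
    Finset (Fin N × Fin B) :=
  Finset.univ.filter fun y => ∃ l, (y.1, e (y.2, l)) ∈ Q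

theorem card_spreadQueried_le (e : Fin B × Fin b ↪ Fin M) (Q : Finset (Fin N × Fin M)) :
    (spreadQueried e Q).card ≤ Q.card := by
  classical
  rw [← Finset.card_image_of_injective (spreadQueried e Q)
    (f := fun y => (y.1, some y.2)) (fun y z h => by
      simp only [Prod.mk.injEq, Option.some.injEq] at h
      exact Prod.ext h.1 h.2)]
  refine le_trans (Finset.card_le_card ?_) (Finset.card_image_le (s := Q)
    (f := fun x => (x.1, Function.extend e (fun t => some t.1) (fun _ => none) x.2)))
  intro z hz
  obtain ⟨y, hy, rfl⟩ := Finset.mem_image.1 hz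
  obtain ⟨l, hl⟩ := (Finset.mem_filter.1 hy).2
  refine Finset.mem_image.2 ⟨_, hl, ?_⟩
  simp only [e.injective.extend_apply]

/-- Lower bounds for one deterministic algorithm may be proved for rows of length `B ≤ M`. There the
algorithm appears only through its outputs `out u` and the sets `Q u` of the entries it knows. -/
theorem sum_error_ge_of_spread [Fact (1 ≤ p)] [Fact (1 ≤ q)] (hB : 1 ≤ B) (hb : 1 ≤ b)
    (hM : b * B ≤ M) (e : Fin B × Fin b ↪ Fin M) {U : Type*} [Fintype U]
    (x : U → Fin N × Fin B → 𝕜) (hx : ∀ u, meanNorm p (x u) ≤ 1) {κ c : ℝ} (hc : 0 ≤ c)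
    (D : DetAlg (pointEvals 𝕜 p N M) (MeanLp q 𝕜 (Fin N)))
    (H : ∀ (out : U → Fin N → 𝕜) (Q : U → Finset (Fin N × Fin B)),
      (∀ u v, (∀ y ∈ Q u, x v y = x u y) → out v = out u ∧ Q v = Q u) →
      (D.IsNonadaptive → ∀ u v, Q u = Q v) →
      κ * Fintype.card U ≤ ∑ u, (meanNorm q (rowMean (x u) - out u) + c * (Q u).card)) :
    (b * B / M : ℝ) * κ * Fintype.card U ≤ ∑ u,
      (‖meanOp 𝕜 p q N M (mkInput (spread e (x u))
          ((meanNorm_spread_le hB hM e (x u)).trans (hx u)))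
        - D.output (mkInput (spread e (x u)) ((meanNorm_spread_le hB hM e (x u)).trans (hx u)))‖
      + (b * B / M : ℝ) * c * (D.queried (mkInput (spread e (x u))
          ((meanNorm_spread_le hB hM e (x u)).trans (hx u)))).card) := by
  set f : U → MeanInput 𝕜 p N M := fun u => mkInput (spread e (x u))
    ((meanNorm_spread_le hB hM e (x u)).trans (hx u)) with hf
  set θ : ℝ := b * B / M with hθ
  have hM0 : 0 < M := lt_of_lt_of_le (Nat.mul_pos hb hB) hM
  have hθ0 : 0 < θ := by positivity
  have hloc : ∀ u v, (∀ y ∈ spreadQueried e (D.queried (f u)), x v y = x u y) →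
      D.output (f v) = D.output (f u) ∧ D.queried (f v) = D.queried (f u) := by
    intro u v h
    refine D.output_queried_congr ?_
    rintro ⟨i, j⟩ hij
    change spread e (x v) (i, j) = spread e (x u) (i, j)
    by_cases hj : j ∈ Set.range e
    · obtain ⟨⟨t, l⟩, rfl⟩ := hj
      rw [spread_apply, spread_apply]
      exact h (i, t) (Finset.mem_filter.2 ⟨Finset.mem_univ _, l, hij⟩)
    · rw [spread_of_notMem e _ i hj, spread_of_notMem e _ i hj]
  -- the row means of the spread array are scaled by `θ`, so the output is scaled back
  let o : U → Fin N → 𝕜 := fun u => D.output (f u)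
  have h := H (fun u => (θ : 𝕜)⁻¹ • o u)
    (fun u => spreadQueried e (D.queried (f u))) (fun u v huv => by
      obtain ⟨h1, h2⟩ := hloc u v huv
      have h1' : o v = o u := h1
      exact ⟨by simp only [h1'], by simp only [h2]⟩)
    (fun hD u v => by simp only [hD.queried_eq (f u) (f v)])
  rw [mul_assoc]
  refine (mul_le_mul_of_nonneg_left h hθ0.le).trans ?_
  rw [Finset.mul_sum]
  refine Finset.sum_le_sum fun u _ => ?_
  rw [mul_add]
  refine add_le_add ?_ ?_
  · have h1 := norm_meanOp_sub (q := q) (f u) (o u)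
    have h2 : rowMean ((f u).1 : Fin N × Fin M → 𝕜) = (θ : 𝕜) • rowMean (x u) :=
      rowMean_spread hB e (x u)
    have h3 : (θ : 𝕜) • rowMean (x u) - o u
        = (θ : 𝕜) • (rowMean (x u) - (θ : 𝕜)⁻¹ • o u) := by
      rw [smul_sub, smul_smul, mul_inv_cancel₀ (by exact_mod_cast hθ0.ne'), one_smul]
    rw [h2, h3, meanNorm_smul, RCLike.norm_ofReal, abs_of_pos hθ0] at h1
    exact h1.ge
  · rw [← mul_assoc]
    gcongr
    exact card_spreadQueried_le e _

/-- The repetition number `b = ⌊M / B⌋` leaves at most half of each row unused. -/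
theorem exists_spread (hB : 1 ≤ B) (hBM : B ≤ M) : ∃ b, 1 ≤ b ∧ b * B ≤ M ∧
    (1 / 2 : ℝ) ≤ b * B / M ∧ Nonempty (Fin B × Fin b ↪ Fin M) := by
  have h1 : M / B * B ≤ M := Nat.div_mul_le_self M B
  have hb : 1 ≤ M / B := (Nat.one_le_div_iff (by omega)).2 hBM
  refine ⟨M / B, hb, h1, ?_, ?_⟩
  · have h2 : M < M / B * B + B := by
      have := Nat.lt_div_mul_add (a := M) (b := B) (by omega)
      omega
    have h3 : M ≤ 2 * (M / B * B) := by nlinarith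
    have h4 : (M : ℝ) ≤ 2 * ((M / B : ℕ) * B) := by exact_mod_cast h3
    have hM : (0 : ℝ) < M := by exact_mod_cast (by omega : 0 < M)
    rw [le_div_iff₀ hM]
    linarith
  · refine Function.Embedding.nonempty_of_card_le ?_
    simpa [mul_comm] using h1

/-- Lower bound for adaptive algorithms, reduced to rows of length `B ≤ M`. One factor `2` is lost in
the spreading of the array, the other one to the cost `c * n ≤ κ / 2` of the queries. -/
theorem eRan_ge_of_spread [Fact (1 ≤ p)] [Fact (1 ≤ q)] (hB : 1 ≤ B) (hBM : B ≤ M)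
    {U : Type*} [Fintype U] [Nonempty U] (x : U → Fin N × Fin B → 𝕜)
    (hx : ∀ u, meanNorm p (x u) ≤ 1) {κ c : ℝ} (hc : 0 ≤ c) {n : ℕ} (hn : 2 * (c * n) ≤ κ)
    (H : ∀ (out : U → Fin N → 𝕜) (Q : U → Finset (Fin N × Fin B)),
      (∀ u v, (∀ y ∈ Q u, x v y = x u y) → out v = out u ∧ Q v = Q u) →
      κ * Fintype.card U ≤ ∑ u, (meanNorm q (rowMean (x u) - out u) + c * (Q u).card)) :
    ENNReal.ofReal (κ / 4) ≤ eRan.{u} 𝕜 p q N M n := by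
  obtain ⟨b, hb, hM, hθ, ⟨e⟩⟩ := exists_spread hB hBM
  refine le_iInf₂ fun A hA => ?_
  refine le_trans (ENNReal.ofReal_le_ofReal ?_) (RanAlg_error_ge _ (by positivity) A
    (fun ω => sum_error_ge_of_spread hB hb hM e x hx hc (A.alg ω)
      fun out Q h _ => H out Q h) hA)
  have : 0 ≤ c * n := by positivity
  nlinarith

/-- Lower bound for non-adaptive algorithms, reduced to rows of length `B ≤ M`. -/
theorem eRanNon_ge_of_spread [Fact (1 ≤ p)] [Fact (1 ≤ q)] (hB : 1 ≤ B) (hBM : B ≤ M)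
    {U : Type*} [Fintype U] [Nonempty U] (x : U → Fin N × Fin B → 𝕜)
    (hx : ∀ u, meanNorm p (x u) ≤ 1) {κ c : ℝ} (hc : 0 ≤ c) {n : ℕ} (hn : 2 * (c * n) ≤ κ)
    (H : ∀ (out : U → Fin N → 𝕜) (Q : U → Finset (Fin N × Fin B)),
      (∀ u v, (∀ y ∈ Q u, x v y = x u y) → out v = out u ∧ Q v = Q u) →
      (∀ u v, Q u = Q v) →
      κ * Fintype.card U ≤ ∑ u, (meanNorm q (rowMean (x u) - out u) + c * (Q u).card)) :
    ENNReal.ofReal (κ / 4) ≤ eRanNon.{u} 𝕜 p q N M n := by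
  obtain ⟨b, hb, hM, hθ, ⟨e⟩⟩ := exists_spread hB hBM
  refine le_iInf₂ fun A hnon => le_iInf fun hA => ?_
  refine le_trans (ENNReal.ofReal_le_ofReal ?_) (RanAlg_error_ge _ (by positivity) A
    (fun ω => sum_error_ge_of_spread hB hb hM e x hx hc (A.alg ω)
      fun out Q h h' => H out Q h (h' (hnon ω))) hA)
  have : 0 ≤ c * n := by positivity
  nlinarith

end Spread

/-! ### Averages over product spaces -/

section Product

/-- Resampling one coordinate does not change an average. -/
theorem expect_update {ι R : Type*} [Fintype ι] [DecidableEq ι] [Fintype R] [Nonempty R]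
    (F : (ι → R) → ℝ) (i : ι) : 𝔼 u, 𝔼 r, F (Function.update u i r) = 𝔼 u, F u := by
  let T : (ι → R) × R → (ι → R) × R := fun w => (Function.update w.1 i w.2, w.1 i)
  have hT : Function.Involutive T := fun w => by simp [T]
  calc 𝔼 u, 𝔼 r, F (Function.update u i r)
      = 𝔼 w : (ι → R) × R, F (Function.update w.1 i w.2) := by
        rw [← Finset.univ_product_univ, Finset.expect_product]
    _ = 𝔼 w : (ι → R) × R, F w.1 :=
        Fintype.expect_equiv hT.toPerm _ _ fun w => rfl
    _ = 𝔼 u, F u := by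
        rw [← Finset.univ_product_univ, Finset.expect_product]
        simp

theorem expect_prod_eq {ι : Type*} [Fintype ι] [DecidableEq ι] {A : ι → Type*}
    [∀ i, Fintype (A i)] (g : ∀ i, A i → ℝ) :
    𝔼 u : ∀ i, A i, ∏ i, g i (u i) = ∏ i, 𝔼 a, g i a := by
  simp only [Fintype.expect_eq_sum_div_card, Finset.prod_div_distrib, Fintype.card_pi]
  rw [Finset.prod_univ_sum, Fintype.piFinset_univ]
  push_cast
  rfl

/-- The function equal to `u` on `Q` and to `v` off `Q`. -/
def mix {ι R : Type*} [DecidableEq ι] (Q : Finset ι) (u v : ι → R) (y : ι) : R :=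
  if y ∈ Q then u y else v y

/-- If `Q u` and `o u` depend only on the restriction of `u` to `Q u`, then the values of `u` off
`Q u` can be replaced by independent ones. -/
theorem expect_mix {ι R A : Type*} [Fintype ι] [DecidableEq ι] [Fintype R] [Nonempty R]
    (Q : (ι → R) → Finset ι) (o : (ι → R) → A)
    (h : ∀ u v, (∀ y ∈ Q u, v y = u y) → o v = o u ∧ Q v = Q u) (F : (ι → R) → A → ℝ) :
    𝔼 u, F u (o u) = 𝔼 u, 𝔼 v, F (mix (Q u) u v) (o u) := by
  -- exchanging the values off `Q u` is an involution, since it leaves `Q u` and `o u` unchanged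
  let T : (ι → R) × (ι → R) → (ι → R) × (ι → R) :=
    fun w => (mix (Q w.1) w.1 w.2, mix (Q w.1) w.2 w.1)
  have hQ : ∀ u v, o (mix (Q u) u v) = o u ∧ Q (mix (Q u) u v) = Q u := fun u v =>
    h u _ fun y hy => by simp [mix, hy]
  have hT : Function.Involutive T := by
    rintro ⟨u, v⟩
    simp only [T, (hQ u v).2, Prod.mk.injEq]
    constructor <;> funext y <;> by_cases hy : y ∈ Q u <;> simp [mix, hy]
  calc 𝔼 u, F u (o u) = 𝔼 w : (ι → R) × (ι → R), F w.1 (o w.1) := by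
        rw [← Finset.univ_product_univ, Finset.expect_product]
        simp
    _ = 𝔼 w : (ι → R) × (ι → R), F (mix (Q w.1) w.1 w.2) (o w.1) := by
        refine (Fintype.expect_equiv hT.toPerm _ _ fun w => ?_).symm
        change _ = F (mix (Q w.1) w.1 w.2) (o (mix (Q w.1) w.1 w.2))
        rw [(hQ w.1 w.2).1]
    _ = _ := by rw [← Finset.univ_product_univ, Finset.expect_product]

end Product

/-! ### Rademacher sums -/

section Rademacher

/-- The sign `±1` encoded by a Boolean. -/
def sg (b : Bool) : ℝ := if b then 1 else -1

theorem sg_not (b : Bool) : sg (!b) = -sg b := by cases b <;> simp [sg]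

theorem abs_sg (b : Bool) : |sg b| = 1 := by cases b <;> simp [sg]

variable {ι : Type*} [Fintype ι] [DecidableEq ι]

theorem expect_bool (F : Bool → ℝ) : 𝔼 b, F b = (F true + F false) / 2 := by
  rw [Fintype.expect_eq_sum_div_card]; simp

theorem expect_comp_not (F : (ι → Bool) → ℝ) : 𝔼 u : ι → Bool, F (fun y => !(u y)) = 𝔼 u, F u := by
  have hT : Function.Involutive (fun (u : ι → Bool) y => !(u y)) := fun u => by funext y; simp
  exact Fintype.expect_equiv hT.toPerm _ _ fun u => rfl

theorem sum_update_eq {ι : Type*} [DecidableEq ι] (J : Finset ι) {a : ι} (ha : a ∉ J)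
    (u : ι → Bool) (b : Bool) :
    ∑ y ∈ J, sg (Function.update u a b y) = ∑ y ∈ J, sg (u y) :=
  Finset.sum_congr rfl fun y hy => by
    rw [Function.update_of_ne (by rintro rfl; exact ha hy)]

theorem expect_rademacher_sq (J : Finset ι) :
    𝔼 u : ι → Bool, (∑ y ∈ J, sg (u y)) ^ 2 = J.card := by
  induction J using Finset.induction_on with
  | empty => simp
  | insert a J ha ih =>
    rw [← expect_update _ a]
    have : ∀ u : ι → Bool, 𝔼 b, (∑ y ∈ insert a J, sg (Function.update u a b y)) ^ 2
        = (∑ y ∈ J, sg (u y)) ^ 2 + 1 := fun u => by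
      simp only [Finset.sum_insert ha, sum_update_eq J ha, Function.update_self]
      rw [expect_bool]; simp [sg]; ring
    simp only [this]
    rw [Finset.expect_add_distrib, ih, Fintype.expect_const, Finset.card_insert_of_notMem ha]
    push_cast; ring

theorem expect_rademacher_pow_four_le (J : Finset ι) :
    𝔼 u : ι → Bool, (∑ y ∈ J, sg (u y)) ^ 4 ≤ 3 * (J.card : ℝ) ^ 2 := by
  induction J using Finset.induction_on with
  | empty => simp
  | insert a J ha ih =>
    rw [← expect_update _ a]
    have : ∀ u : ι → Bool, 𝔼 b, (∑ y ∈ insert a J, sg (Function.update u a b y)) ^ 4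
        = (∑ y ∈ J, sg (u y)) ^ 4 + (6 * (∑ y ∈ J, sg (u y)) ^ 2 + 1) := fun u => by
      simp only [Finset.sum_insert ha, sum_update_eq J ha, Function.update_self]
      rw [expect_bool]; simp [sg]; ring
    simp only [this]
    rw [Finset.expect_add_distrib, Finset.expect_add_distrib, ← Finset.mul_expect,
      expect_rademacher_sq, Fintype.expect_const, Finset.card_insert_of_notMem ha]
    push_cast; linarith

/-- A linear form of Khintchine's inequality in `L_1`. -/
theorem expect_abs_rademacher_ge (J : Finset ι) {B : ℕ} (hJ : J.card ≤ B) :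
    (2 / 5 : ℝ) * J.card / √B ≤ 𝔼 u : ι → Bool, |∑ y ∈ J, sg (u y)| := by
  rcases Nat.eq_zero_or_pos B with rfl | hB
  · simp only [Nat.cast_zero, Real.sqrt_zero, div_zero]
    exact Finset.expect_nonneg fun u _ => abs_nonneg _
  have hB0 : (0 : ℝ) < B := by exact_mod_cast hB
  set s : ℝ := √B with hs
  have hs0 : 0 < s := Real.sqrt_pos.2 hB0
  have hss : s ^ 2 = B := Real.sq_sqrt hB0.le
  -- `|x| ≥ x² / (2 s) - x⁴ / (32 s³)` turns the second and fourth moments into a first one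
  have key : ∀ x : ℝ, x ^ 2 / (2 * s) - x ^ 4 / (32 * s ^ 3) ≤ |x| := by
    intro x
    have h1 : x ^ 2 = |x| ^ 2 := (sq_abs x).symm
    have h2 : x ^ 4 = |x| ^ 4 := by rw [show x ^ 4 = (x ^ 2) ^ 2 by ring, h1]; ring
    rw [h1, h2]
    set y := |x|
    have hy : 0 ≤ y := abs_nonneg x
    have : y ^ 2 / (2 * s) - y ^ 4 / (32 * s ^ 3) = (16 * s ^ 2 * y ^ 2 - y ^ 4) / (32 * s ^ 3) := by
      field_simp; ring
    rw [this, div_le_iff₀ (by positivity)]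
    -- with `v = y / (2 s)`: `1 - v + v³ / 4 ≥ 0`
    have h3 : 0 ≤ y ^ 3 - 16 * s ^ 2 * y + 32 * s ^ 3 := by
      nlinarith [mul_nonneg hy (sq_nonneg (y - 2.4 * s)), mul_nonneg hs0.le (sq_nonneg (y - 2.4 * s)),
        mul_nonneg hy hs0.le, pow_pos hs0 3]
    nlinarith [mul_nonneg hy h3]
  calc (2 / 5 : ℝ) * J.card / s
      ≤ 𝔼 u : ι → Bool, ((∑ y ∈ J, sg (u y)) ^ 2 / (2 * s)
          - (∑ y ∈ J, sg (u y)) ^ 4 / (32 * s ^ 3)) := by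
        rw [Finset.expect_sub_distrib, ← Finset.expect_div, ← Finset.expect_div,
          expect_rademacher_sq]
        have h4 := expect_rademacher_pow_four_le J
        have hJ' : (J.card : ℝ) ≤ s ^ 2 := by rw [hss]; exact_mod_cast hJ
        have h5 : (𝔼 u : ι → Bool, (∑ y ∈ J, sg (u y)) ^ 4) / (32 * s ^ 3)
            ≤ 3 * (J.card * s ^ 2) / (32 * s ^ 3) := by
          gcongr
          refine h4.trans ?_
          nlinarith [Nat.cast_nonneg (α := ℝ) J.card]
        have h6 : 3 * ((J.card : ℝ) * s ^ 2) / (32 * s ^ 3) = 3 / 32 * (J.card / s) := by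
          field_simp
        have h7 : (J.card : ℝ) / (2 * s) = 1 / 2 * (J.card / s) := by field_simp
        have h8 : (0 : ℝ) ≤ J.card / s := by positivity
        rw [h6] at h5
        rw [h7, mul_div_assoc]
        linarith
    _ ≤ _ := Finset.expect_le_expect fun u _ => key _

/-- A Rademacher sum is of the order of its standard deviation with constant probability, because its
fourth moment is bounded by the square of its second one. -/
theorem expect_rademacher_ge_ite (J : Finset ι) :
    (1 / 12 : ℝ) ≤ 𝔼 u : ι → Bool,
      (if √(J.card : ℝ) / 2 ≤ ∑ y ∈ J, sg (u y) then (1 : ℝ) else 0) := by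
  rcases J.eq_empty_or_nonempty with rfl | hJ
  · simp; norm_num
  set m : ℝ := (J.card : ℝ) with hm
  have hm0 : 0 < m := by rw [hm]; exact_mod_cast hJ.card_pos
  set X : (ι → Bool) → ℝ := fun u => ∑ y ∈ J, sg (u y) with hX
  set I : ℝ → ℝ := fun x => if √m / 2 ≤ x then 1 else 0 with hI
  have hsym : 𝔼 u, I (-X u) = 𝔼 u, I (X u) := by
    rw [← expect_comp_not]
    refine Finset.expect_congr rfl fun u _ => ?_
    simp [hX, sg_not]
  have hs : √m ^ 2 = m := Real.sq_sqrt hm0.le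
  have key : ∀ x : ℝ, x ^ 2 ≤ m / 4 + (x ^ 4 / (6 * m) + 3 * m / 2 * (I x + I (-x))) := by
    intro x
    have h1 : x ^ 2 ≤ x ^ 4 / (6 * m) + 3 * m / 2 := by
      have : x ^ 4 / (6 * m) + 3 * m / 2 - x ^ 2 = (x ^ 2 - 3 * m) ^ 2 / (6 * m) := by
        field_simp; ring
      have : 0 ≤ (x ^ 2 - 3 * m) ^ 2 / (6 * m) := by positivity
      linarith
    have hI0 : ∀ z, 0 ≤ I z := fun z => by simp only [hI]; split_ifs <;> norm_num
    have hx4 : 0 ≤ x ^ 4 / (6 * m) := by positivity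
    by_cases h2 : √m / 2 ≤ x
    · have : I x = 1 := by simp [hI, h2]
      rw [this]; nlinarith [hI0 (-x)]
    by_cases h3 : √m / 2 ≤ -x
    · have : I (-x) = 1 := by simp [hI, h3]
      rw [this]; nlinarith [hI0 x]
    have : x ^ 2 ≤ m / 4 := by
      push Not at h2 h3
      nlinarith
    nlinarith [hI0 x, hI0 (-x)]
  have h := Finset.expect_le_expect (s := Finset.univ) fun u (_ : u ∈ Finset.univ) => key (X u)
  rw [Finset.expect_add_distrib, Finset.expect_add_distrib, ← Finset.mul_expect,
    Finset.expect_add_distrib, hsym, Fintype.expect_const, ← Finset.expect_div] at h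
  have h2 : 𝔼 u, X u ^ 2 = m := expect_rademacher_sq J
  have h4 : 𝔼 u, X u ^ 4 ≤ 3 * m ^ 2 := expect_rademacher_pow_four_le J
  have h5 : (𝔼 u, X u ^ 4) / (6 * m) ≤ m / 2 := by
    rw [div_le_iff₀ (by positivity)]; nlinarith
  rw [h2] at h
  have h6 : m / 4 ≤ 3 * m * 𝔼 u, I (X u) := by linarith
  have h7 : (1 / 12 : ℝ) ≤ 𝔼 u, I (X u) := by
    by_contra hlt
    push Not at hlt
    nlinarith
  exact h7

end Rademacher

/-! ### Lower bounds from hard input distributions -/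

section RowMeanAlgebra

variable {𝕜 I J : Type*} [RCLike 𝕜] [Fintype J]

theorem rowMean_add (x y : I × J → 𝕜) : rowMean (x + y) = rowMean x + rowMean y := by
  funext i; simp [rowMean, Finset.sum_add_distrib, mul_add]

theorem rowMean_neg (x : I × J → 𝕜) : rowMean (-x) = -rowMean x := by
  funext i; simp [rowMean]

theorem rowMean_single [DecidableEq I] [DecidableEq J] (y : I × J) (c : 𝕜) :
    rowMean (Pi.single y c) = Pi.single y.1 ((Fintype.card J : 𝕜)⁻¹ * c) := by
  funext i
  obtain ⟨i', j'⟩ := y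
  rw [rowMean]
  rcases eq_or_ne i i' with rfl | h
  · rw [Pi.single_eq_same, Finset.sum_eq_single j']
    · rw [Pi.single_eq_same]
    · intro j _ hj
      rw [Pi.single_eq_of_ne]
      simpa using hj
    · simp
  · rw [Pi.single_eq_of_ne h]
    simp [h]

end RowMeanAlgebra

section RowCount

/-- The number of elements of `Q` in the row `i`. -/
def rowCount {I J : Type*} [DecidableEq I] [DecidableEq J] [Fintype J] (Q : Finset (I × J))
    (i : I) : ℕ :=
  (Finset.univ.filter fun j => (i, j) ∈ Q).card

variable {I J : Type*} [DecidableEq I] [DecidableEq J] [Fintype J]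

theorem sum_rowCount [Fintype I] (Q : Finset (I × J)) : ∑ i, rowCount Q i = Q.card := by
  have : Q.card = ∑ y : I × J, if y ∈ Q then 1 else 0 := by simp
  rw [this, Fintype.sum_prod_type]
  simp [rowCount]

theorem card_filter_notMem_add_rowCount (Q : Finset (I × J)) (i : I) :
    (Finset.univ.filter fun j => (i, j) ∉ Q).card + rowCount Q i = Fintype.card J := by
  rw [rowCount, add_comm, Finset.card_filter_add_card_filter_not, Finset.card_univ]

end RowCount

section Needle

open IBC

variable {𝕜 : Type*} [RCLike 𝕜] {p q : ℝ≥0∞} {N M B n : ℕ}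

/-- Half of the summands stem from the zero input, where the elements of `Z` are queried, and
account for `Z` by the cost of these queries; the other half stem from signed needles at `t`, which
remain undetected unless `t ∈ Z`. -/
theorem needle_sum_ge {T : Type*} [Fintype T] [DecidableEq T] (Z : Finset T) {R c : ℝ}
    (g : Bool × Bool × T → ℝ) (h0 : ∀ b t, 0 ≤ g (true, b, t))
    (h1 : ∀ t ∉ Z, 2 * R ≤ g (true, true, t) + g (true, false, t))
    (h2 : ∀ b t, c ≤ g (false, b, t)) (hc : c * Fintype.card T = R * Z.card) :
    2 * R * Fintype.card T ≤ ∑ w, g w := by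
  rw [Fintype.sum_prod_type, Fintype.sum_bool, Fintype.sum_prod_type, Fintype.sum_bool,
    Fintype.sum_prod_type, Fintype.sum_bool, ← Finset.sum_add_distrib, ← Finset.sum_add_distrib]
  have h3 : ∑ t : T, (2 * R - if t ∈ Z then 2 * R else 0)
      ≤ ∑ t, (g (true, true, t) + g (true, false, t)) := by
    refine Finset.sum_le_sum fun t _ => ?_
    by_cases ht : t ∈ Z
    · simpa [ht] using add_nonneg (h0 true t) (h0 false t)
    · simpa [ht] using h1 t ht
  have h4 : ∑ _t : T, 2 * c ≤ ∑ t, (g (false, true, t) + g (false, false, t)) :=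
    Finset.sum_le_sum fun t _ => by linarith [h2 true t, h2 false t]
  rw [Finset.sum_sub_distrib] at h3
  simp only [Finset.sum_const, Finset.card_univ, nsmul_eq_mul, Finset.sum_ite_mem,
    Finset.univ_inter] at h3 h4
  linarith

/-- The lower bound from inputs that vanish off a single point. -/
theorem eRan_ge_of_single [Fact (1 ≤ p)] [Fact (1 ≤ q)] (hN : 1 ≤ N) (hB : 1 ≤ B) (hBM : B ≤ M)
    (hn : 8 * n ≤ N * B) :
    ENNReal.ofReal (((N : ℝ) * B) ^ recip p / (8 * B * (N : ℝ) ^ recip q))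
      ≤ eRan.{u} 𝕜 p q N M n := by
  have hN0 : (0 : ℝ) < N := by exact_mod_cast hN
  have hB0 : (0 : ℝ) < B := by exact_mod_cast hB
  have : NeZero N := ⟨by omega⟩
  have : NeZero B := ⟨by omega⟩
  set h : ℝ := ((N : ℝ) * B) ^ recip p with hh
  have hh0 : 0 < h := by positivity
  set R : ℝ := h / (B * (N : ℝ) ^ recip q) with hR
  have hR0 : 0 < R := by positivity
  have hRB : 0 ≤ R / (N * B) := by positivity
  let x : Bool × Bool × (Fin N × Fin B) → (Fin N × Fin B) → 𝕜 := fun w =>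
    if w.1 then Pi.single w.2.2 (((sg w.2.1 * h : ℝ) : ℝ) : 𝕜) else 0
  have hx : ∀ w, meanNorm p (x w) ≤ 1 := by
    rintro ⟨z, b, y⟩
    cases z
    · have := meanNorm_le_of_forall_le (p := p) (x := (0 : (Fin N × Fin B) → 𝕜)) zero_le_one (by simp)
      simpa [x] using this
    · simp only [x, if_true, meanNorm_single, RCLike.norm_ofReal, abs_mul, abs_sg,
        one_mul, abs_of_pos hh0]
      rw [Fintype.card_prod, Fintype.card_fin, Fintype.card_fin, Nat.cast_mul, ← hh,
        div_self hh0.ne']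
  have key := eRan_ge_of_spread (𝕜 := 𝕜) (q := q) hB hBM x hx (κ := R / 2) (c := R / (N * B))
    (by positivity) (n := n) (by
      have : (8 : ℝ) * n ≤ N * B := by exact_mod_cast hn
      have h2 : R / (N * B) * n ≤ R / 8 := by
        rw [div_mul_eq_mul_div, div_le_div_iff₀ (by positivity) (by norm_num)]
        nlinarith
      linarith) ?_
  · refine le_trans (le_of_eq ?_) key
    congr 1
    rw [hR]; field_simp; norm_num
  intro out Q hloc
  set u0 : Bool × Bool × (Fin N × Fin B) := (false, false, (0, 0)) with hu0
  have hz : ∀ b y, Q (false, b, y) = Q u0 := fun b y =>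
    (hloc u0 (false, b, y) fun _ _ => by simp [x, hu0]).2
  have hneedle : ∀ b, ∀ y ∉ Q u0, out (true, b, y) = out u0 := fun b y hy => by
    refine (hloc u0 (true, b, y) fun y' hy' => ?_).1
    have : y' ≠ y := fun h => hy (h ▸ hy')
    simp [x, hu0, this]
  have := needle_sum_ge (T := (Fin N × Fin B)) (Q u0) (R := R) (c := R / (N * B) * (Q u0).card)
    (fun w => meanNorm q (rowMean (x w) - out w) + R / (N * B) * (Q w).card)
    (fun b t => add_nonneg (meanNorm_nonneg _) (by positivity)) (fun y hy => ?_)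
    (fun b t => ?_) ?_
  · refine le_trans (le_of_eq ?_) this
    simp; ring
  · simp only [hneedle _ y hy]
    have h1 : rowMean (x (true, true, y)) = 0 + Pi.single y.1 ((h / B : ℝ) : 𝕜) := by
      simp only [x, if_true, rowMean_single, zero_add]
      simp [sg, div_eq_inv_mul]
    have h2 : rowMean (x (true, false, y)) = 0 - Pi.single y.1 ((h / B : ℝ) : 𝕜) := by
      simp only [x, if_true, rowMean_single, zero_sub, ← Pi.single_neg]
      simp [sg, div_eq_inv_mul]
    have h3 := two_meanNorm_le (p := q) (Pi.single y.1 ((h / B : ℝ) : 𝕜)) 0 (out u0)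
    rw [meanNorm_single, RCLike.norm_ofReal, abs_of_pos (by positivity)] at h3
    rw [h1, h2]
    have h4 : R = h / B / (Fintype.card (Fin N) : ℝ) ^ recip q := by
      rw [hR, Fintype.card_fin]; field_simp
    have h5 : 0 ≤ R / (N * B) * (Q (true, true, y)).card :=
      mul_nonneg hRB (Nat.cast_nonneg _)
    have h6 : 0 ≤ R / (N * B) * (Q (true, false, y)).card :=
      mul_nonneg hRB (Nat.cast_nonneg _)
    linarith
  · simp only [hz]
    exact le_add_of_nonneg_left (meanNorm_nonneg _)
  · simp only [Fintype.card_prod, Fintype.card_fin, Nat.cast_mul]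
    field_simp

/-- The lower bound from inputs with at most one nonzero entry in each row. -/
theorem eRan_ge_of_row_needles [hp : Fact (1 ≤ p)] [Fact (1 ≤ q)] (hp' : p ≠ ∞) (hN : 1 ≤ N)
    (hB : 1 ≤ B) (hBM : B ≤ M) (hn : 8 * n ≤ N * B) :
    ENNReal.ofReal ((B : ℝ) ^ recip p / (8 * B)) ≤ eRan.{u} 𝕜 p q N M n := by
  have hN0 : (0 : ℝ) < N := by exact_mod_cast hN
  have hB0 : (0 : ℝ) < B := by exact_mod_cast hB
  have : NeZero N := ⟨by omega⟩
  have : NeZero B := ⟨by omega⟩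
  have hp1 := one_le_toReal (p := p) hp'
  set h : ℝ := (B : ℝ) ^ recip p with hh
  have hh0 : 0 < h := by positivity
  set R : ℝ := h / B with hR
  have hR0 : 0 < R := by positivity
  let x : (Fin N → Bool × Bool × Fin B) → Fin N × Fin B → 𝕜 := fun w y =>
    if (w y.1).1 ∧ y.2 = (w y.1).2.2 then ((sg (w y.1).2.1 * h : ℝ) : 𝕜) else 0
  have hx : ∀ w, meanNorm p (x w) ≤ 1 := by
    intro w
    refine meanNorm_le_of_rpow_le hp' zero_le_one ?_
    rw [Real.one_rpow, ← Finset.univ_product_univ, Finset.expect_product]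
    refine Finset.expect_le Finset.univ_nonempty fun i _ => ?_
    rw [Fintype.expect_eq_sum_div_card, div_le_one (by simpa using hB0), Fintype.card_fin]
    have hle : ∀ t, ‖x w (i, t)‖ ^ p.toReal ≤ if t = (w i).2.2 then (B : ℝ) else 0 := by
      intro t
      by_cases ht : t = (w i).2.2
      · rw [if_pos ht]
        have h1 : ‖x w (i, t)‖ ≤ h := by
          simp only [x]
          split_ifs
          · rw [RCLike.norm_ofReal, abs_mul, abs_sg, one_mul, abs_of_pos hh0]
          · simpa using hh0.le
        refine (Real.rpow_le_rpow (norm_nonneg _) h1 (by linarith)).trans (le_of_eq ?_)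
        rw [hh, ← Real.rpow_mul hB0.le, recip_eq, one_div_mul_cancel (by linarith), Real.rpow_one]
      · simp [x, ht, Real.zero_rpow (show p.toReal ≠ 0 by linarith)]
    refine (Finset.sum_le_sum fun t _ => hle t).trans ?_
    simp
  have key := eRan_ge_of_spread (𝕜 := 𝕜) (q := q) hB hBM x hx (κ := R / 2) (c := R / (N * B))
    (by positivity) (n := n) (by
      have : (8 : ℝ) * n ≤ N * B := by exact_mod_cast hn
      have h2 : R / (N * B) * n ≤ R / 8 := by
        rw [div_mul_eq_mul_div, div_le_div_iff₀ (by positivity) (by norm_num)]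
        nlinarith
      linarith) ?_
  · refine le_trans (le_of_eq ?_) key
    congr 1
    rw [hR]; field_simp; norm_num
  intro out Q hloc
  let E : Fin N → (Fin N → Bool × Bool × Fin B) → ℝ := fun i w =>
    ‖rowMean (x w) i - out w i‖ + R / B * rowCount (Q w) i
  have hE : ∀ i, R / 2 ≤ 𝔼 w, E i w := by
    intro i
    -- only the needle in the row `i` is resampled, the other rows are frozen
    rw [← expect_update _ i]
    refine Finset.le_expect Finset.univ_nonempty fun w _ => ?_
    rw [Fintype.expect_eq_sum_div_card, le_div_iff₀ (by simp; omega)]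
    set u0 := Function.update w i (false, false, 0) with hu0
    have hz : ∀ b t, Q (Function.update w i (false, b, t)) = Q u0 := fun b t => by
      refine (hloc u0 _ fun y _ => ?_).2
      rcases eq_or_ne y.1 i with h1 | h1 <;> simp [x, hu0, h1]
    have hneedle : ∀ b t, (i, t) ∉ Q u0 → out (Function.update w i (true, b, t)) = out u0 := by
      intro b t ht
      refine (hloc u0 _ fun y hy => ?_).1
      obtain ⟨i', t'⟩ := y
      rcases eq_or_ne i' i with rfl | h1
      · have : t' ≠ t := fun h => ht (h ▸ hy)
        simp [x, hu0, this]
      · simp [x, hu0, h1]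
    have := needle_sum_ge (T := Fin B) (Finset.univ.filter fun t => (i, t) ∈ Q u0) (R := R)
      (c := R / B * rowCount (Q u0) i)
      (fun r => E i (Function.update w i r))
      (fun b t => add_nonneg (norm_nonneg _) (by positivity)) (fun t ht => ?_)
      (fun b t => ?_) ?_
    · refine le_trans (le_of_eq ?_) this
      simp; ring
    · have ht' : (i, t) ∉ Q u0 := by simpa using ht
      simp only [E, hneedle _ t ht']
      have h1 : ∀ b, rowMean (x (Function.update w i (true, b, t))) i = ((sg b * R : ℝ) : 𝕜) := by
        intro b
        simp [rowMean, x, hR]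
        ring
      rw [h1, h1]
      have h3 := norm_sub_le (((sg true * R : ℝ) : 𝕜) - out u0 i)
        (((sg false * R : ℝ) : 𝕜) - out u0 i)
      rw [sub_sub_sub_cancel_right, ← RCLike.ofReal_sub, RCLike.norm_ofReal] at h3
      have h4 : |sg true * R - sg false * R| = 2 * R := by
        simp only [sg, if_true, Bool.false_eq_true, if_false]
        rw [abs_of_pos] <;> linarith
      rw [h4] at h3
      have h5 : 0 ≤ R / B * rowCount (Q (Function.update w i (true, true, t))) i := by positivity
      have h6 : 0 ≤ R / B * rowCount (Q (Function.update w i (true, false, t))) i := by positivity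
      linarith
    · simp only [E, hz]
      exact le_add_of_nonneg_left (norm_nonneg _)
    · simp only [rowCount, Fintype.card_fin]
      field_simp
  have hsum : R / 2 ≤ 𝔼 w, (meanNorm q (rowMean (x w) - out w) + R / (N * B) * (Q w).card) := by
    calc R / 2 ≤ 𝔼 i, 𝔼 w, E i w := Finset.le_expect Finset.univ_nonempty fun i _ => hE i
      _ = 𝔼 w, 𝔼 i, E i w := Finset.expect_comm _ _ _
      _ ≤ _ := by
        refine Finset.expect_le_expect fun w _ => ?_
        simp only [E]
        rw [Finset.expect_add_distrib]
        refine add_le_add (expect_norm_le_meanNorm (rowMean (x w) - out w)) (le_of_eq ?_)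
        rw [← Finset.mul_expect, Fintype.expect_eq_sum_div_card, ← sum_rowCount (Q w)]
        push_cast
        rw [Fintype.card_fin]
        field_simp
  rwa [Fintype.expect_eq_sum_div_card, le_div_iff₀ (by exact_mod_cast Fintype.card_pos)] at hsum

end Needle

section Signs

open IBC

variable {𝕜 : Type*} [RCLike 𝕜] {p q : ℝ≥0∞} {N M B n : ℕ}

/-- The random array with entries `± a y`. -/
def signArray (𝕜 : Type*) [RCLike 𝕜] {Y : Type*} (a : Y → ℝ) (u : Y → Bool) (y : Y) : 𝕜 :=
  ((a y * sg (u y) : ℝ) : 𝕜)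

/-- The part of a sign array that is left undetermined by the entries in `Q`. -/
def unseen (𝕜 : Type*) [RCLike 𝕜] {Y : Type*} [DecidableEq Y] (a : Y → ℝ) (Q : Finset Y)
    (v : Y → Bool) (y : Y) : 𝕜 :=
  if y ∈ Q then 0 else signArray 𝕜 a v y

/-- Given the entries in `Q u`, the remaining signs are still independent and symmetric; hence the
error is at least the norm of the contribution of the unseen entries. -/
theorem expect_unseen_le [Fact (1 ≤ q)] (a : Fin N × Fin B → ℝ)
    (out : (Fin N × Fin B → Bool) → Fin N → 𝕜) (Q : (Fin N × Fin B → Bool) → Finset (Fin N × Fin B))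
    (hloc : ∀ u v, (∀ y ∈ Q u, v y = u y) → out v = out u ∧ Q v = Q u) :
    𝔼 u, 𝔼 v, meanNorm q (rowMean (unseen 𝕜 a (Q u) v))
      ≤ 𝔼 u, meanNorm q (rowMean (signArray 𝕜 a u) - out u) := by
  rw [expect_mix Q out hloc (fun u o => meanNorm q (rowMean (signArray 𝕜 a u) - o))]
  refine Finset.expect_le_expect fun u _ => ?_
  let k : Fin N × Fin B → 𝕜 := fun y => if y ∈ Q u then signArray 𝕜 a u y else 0
  have h1 : ∀ v, signArray 𝕜 a (mix (Q u) u v) = k + unseen 𝕜 a (Q u) v := fun v => by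
    funext y
    by_cases hy : y ∈ Q u <;> simp [k, unseen, signArray, mix, hy]
  have h2 : ∀ v, unseen 𝕜 a (Q u) (fun y => !(v y)) = -unseen 𝕜 a (Q u) v := fun v => by
    funext y
    by_cases hy : y ∈ Q u <;> simp [unseen, signArray, hy, sg_not]
  have h3 : ∀ v, 2 * meanNorm q (rowMean (unseen 𝕜 a (Q u) v))
      ≤ meanNorm q (rowMean (signArray 𝕜 a (mix (Q u) u v)) - out u)
        + meanNorm q (rowMean (signArray 𝕜 a (mix (Q u) u fun y => !(v y))) - out u) := fun v => by
    rw [h1, h1, h2, rowMean_add, rowMean_add, rowMean_neg, ← sub_eq_add_neg]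
    exact two_meanNorm_le _ _ _
  have h4 := Finset.expect_le_expect (s := Finset.univ) fun v (_ : v ∈ Finset.univ) => h3 v
  rw [Finset.expect_add_distrib, ← Finset.mul_expect,
    expect_comp_not (fun v => meanNorm q (rowMean (signArray 𝕜 a (mix (Q u) u v)) - out u))] at h4
  linarith

theorem norm_rowMean_unseen (a : Fin N × Fin B → ℝ) (Q : Finset (Fin N × Fin B))
    (v : Fin N × Fin B → Bool) (i : Fin N) {α : ℝ} (ha : ∀ t, a (i, t) = α) :
    ‖rowMean (unseen 𝕜 a Q v) i‖
      = |α| / B * |∑ t ∈ Finset.univ.filter (fun t => (i, t) ∉ Q), sg (v (i, t))| := by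
  have h : rowMean (unseen 𝕜 a Q v) i = ((α / B *
      ∑ t ∈ Finset.univ.filter (fun t => (i, t) ∉ Q), sg (v (i, t)) : ℝ) : 𝕜) := by
    rw [rowMean, Finset.sum_filter, RCLike.ofReal_mul, RCLike.ofReal_sum, RCLike.ofReal_div,
      div_mul_eq_mul_div, mul_comm, Finset.mul_sum, Finset.sum_mul, Finset.sum_div]
    refine Finset.sum_congr rfl fun t _ => ?_
    by_cases ht : (i, t) ∈ Q
    · simp [unseen, ht]
    · simp [unseen, ht, signArray, ha, div_eq_mul_inv]
  rw [h, RCLike.norm_ofReal, abs_mul, abs_div, Nat.abs_cast]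

theorem expect_norm_rowMean_unseen_ge (hB : 1 ≤ B) (a : Fin N × Fin B → ℝ)
    (Q : Finset (Fin N × Fin B)) (i : Fin N) {α : ℝ} (ha : ∀ t, a (i, t) = α) :
    2 / 5 * |α| / √B * (1 - rowCount Q i / B) ≤ 𝔼 v, ‖rowMean (unseen 𝕜 a Q v) i‖ := by
  have hB0 : (0 : ℝ) < B := by exact_mod_cast hB
  simp only [norm_rowMean_unseen a Q _ i ha]
  rw [← Finset.mul_expect]
  set J := Finset.univ.filter (fun t => (i, t) ∉ Q) with hJ
  have hc := card_filter_notMem_add_rowCount Q i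
  rw [← hJ, Fintype.card_fin] at hc
  let φ : Fin B ↪ Fin N × Fin B := ⟨fun t => (i, t), fun s t h => by simpa using h⟩
  have h1 := expect_abs_rademacher_ge (J.map φ) (B := B) (by rw [Finset.card_map]; omega)
  simp only [Finset.sum_map, Finset.card_map] at h1
  have h2 : (J.card : ℝ) = B - rowCount Q i := by
    have : (J.card : ℝ) + rowCount Q i = B := by exact_mod_cast hc
    linarith
  rw [h2] at h1
  refine le_trans (le_of_eq ?_) (mul_le_mul_of_nonneg_left h1 (by positivity : 0 ≤ |α| / B))
  field_simp

theorem expect_rowCount_div (Q : Finset (Fin N × Fin B)) :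
    𝔼 i, ((rowCount Q i : ℝ) / B) = Q.card / (N * B) := by
  rw [← Finset.expect_div, Fintype.expect_eq_sum_div_card, ← sum_rowCount Q]
  push_cast
  rw [Fintype.card_fin, div_div]

/-- The lower bound from independent random signs. -/
theorem eRan_ge_of_signs [Fact (1 ≤ p)] [Fact (1 ≤ q)] (hN : 1 ≤ N) (hB : 1 ≤ B) (hBM : B ≤ M)
    (hn : 8 * n ≤ N * B) :
    ENNReal.ofReal (1 / (10 * √B)) ≤ eRan.{u} 𝕜 p q N M n := by
  have hN0 : (0 : ℝ) < N := by exact_mod_cast hN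
  have hB0 : (0 : ℝ) < B := by exact_mod_cast hB
  have : NeZero N := ⟨by omega⟩
  have hs : 0 < √(B : ℝ) := Real.sqrt_pos.2 hB0
  set κ : ℝ := 2 / 5 / √B with hκ
  have hκ0 : 0 < κ := by positivity
  have hx : ∀ u : Fin N × Fin B → Bool, meanNorm p (signArray 𝕜 (fun _ => 1) u) ≤ 1 := fun u =>
    meanNorm_le_of_forall_le zero_le_one fun y => by
      rw [signArray, RCLike.norm_ofReal, one_mul, abs_sg]
  have key := eRan_ge_of_spread (𝕜 := 𝕜) (q := q) hB hBM (signArray 𝕜 fun _ => 1) hx (κ := κ)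
    (c := κ / (N * B)) (by positivity) (n := n) (by
      have : (8 : ℝ) * n ≤ N * B := by exact_mod_cast hn
      have h2 : κ / (N * B) * n ≤ κ / 8 := by
        rw [div_mul_eq_mul_div, div_le_div_iff₀ (by positivity) (by norm_num)]
        nlinarith
      linarith) ?_
  · refine le_trans (le_of_eq ?_) key
    congr 1
    rw [hκ]; field_simp; norm_num
  intro out Q hloc
  rw [← le_div_iff₀ (by exact_mod_cast Fintype.card_pos), ← Fintype.expect_eq_sum_div_card,
    Finset.expect_add_distrib]
  have h1 := expect_unseen_le (q := q) (fun _ => 1) out Q fun u v h =>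
    hloc u v fun y hy => by simp [signArray, h y hy]
  have h2 : ∀ u, κ * (1 - (Q u).card / (N * B))
      ≤ 𝔼 v, meanNorm q (rowMean (unseen 𝕜 (fun _ => 1) (Q u) v)) := by
    intro u
    calc κ * (1 - (Q u).card / (N * B)) = 𝔼 i, κ * (1 - rowCount (Q u) i / B) := by
          rw [← Finset.mul_expect, Finset.expect_sub_distrib, expect_rowCount_div,
            Fintype.expect_const]
      _ ≤ 𝔼 i, 𝔼 v, ‖rowMean (unseen 𝕜 (fun _ => 1) (Q u) v) i‖ := by
          refine Finset.expect_le_expect fun i _ => ?_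
          have := expect_norm_rowMean_unseen_ge (𝕜 := 𝕜) hB (fun _ => 1) (Q u) i (fun _ => rfl)
          simpa using this
      _ = 𝔼 v, 𝔼 i, ‖rowMean (unseen 𝕜 (fun _ => 1) (Q u) v) i‖ := Finset.expect_comm _ _ _
      _ ≤ _ := Finset.expect_le_expect fun v _ => expect_norm_le_meanNorm _
  have h3 := (Finset.expect_le_expect (s := Finset.univ)
    fun u (_ : u ∈ Finset.univ) => h2 u).trans h1
  have h4 : 𝔼 u, κ * (1 - ((Q u).card : ℝ) / (N * B))
      = κ - 𝔼 u, κ / (N * B) * (Q u).card := by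
    rw [← Fintype.expect_const (ι := Fin N × Fin B → Bool) κ, ← Finset.expect_sub_distrib]
    refine Finset.expect_congr rfl fun u _ => ?_
    rw [Fintype.expect_const]; ring
  rw [h4] at h3
  linarith

theorem meanNorm_le_one_of_row [hp : Fact (1 ≤ p)] (hN : 1 ≤ N) (hB : 1 ≤ B) (r : Fin N)
    {x : Fin N × Fin B → 𝕜} (h0 : ∀ i t, i ≠ r → x (i, t) = 0)
    (h1 : ∀ t, ‖x (r, t)‖ ≤ (N : ℝ) ^ recip p) : meanNorm p x ≤ 1 := by
  have hN0 : (0 : ℝ) < N := by exact_mod_cast hN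
  have : NeZero N := ⟨by omega⟩
  have : NeZero B := ⟨by omega⟩
  rcases eq_or_ne p ∞ with rfl | hp'
  · refine meanNorm_le_of_forall_le zero_le_one ?_
    rintro ⟨i, t⟩
    rcases eq_or_ne i r with rfl | hi
    · simpa [recip_top] using h1 t
    · simp [h0 i t hi]
  · have hp1 := one_le_toReal (p := p) hp'
    refine meanNorm_le_of_rpow_le hp' zero_le_one ?_
    rw [Real.one_rpow, ← Finset.univ_product_univ, Finset.expect_product]
    have hle : ∀ i, 𝔼 t, ‖x (i, t)‖ ^ p.toReal ≤ if i = r then (N : ℝ) else 0 := by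
      intro i
      refine Finset.expect_le Finset.univ_nonempty fun t _ => ?_
      rcases eq_or_ne i r with rfl | hi
      · rw [if_pos rfl]
        refine (Real.rpow_le_rpow (norm_nonneg _) (h1 t) (by linarith)).trans (le_of_eq ?_)
        rw [← Real.rpow_mul hN0.le, recip_eq, one_div_mul_cancel (by linarith), Real.rpow_one]
      · simp [h0 i t hi, hi, Real.zero_rpow (show p.toReal ≠ 0 by linarith)]
    refine (Finset.expect_le_expect fun i _ => hle i).trans ?_
    rw [Fintype.expect_eq_sum_div_card]
    simp [hN0.ne']

/-- The lower bound for non-adaptive algorithms from random signs in a single random row. -/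
theorem eRanNon_ge_of_row_signs [Fact (1 ≤ p)] [Fact (1 ≤ q)] (hN : 1 ≤ N)
    (hB : 1 ≤ B) (hBM : B ≤ M) (hn : 8 * n ≤ N * B) :
    ENNReal.ofReal ((N : ℝ) ^ (recip p - recip q) / (10 * √B)) ≤ eRanNon.{u} 𝕜 p q N M n := by
  have hN0 : (0 : ℝ) < N := by exact_mod_cast hN
  have hB0 : (0 : ℝ) < B := by exact_mod_cast hB
  have : NeZero N := ⟨by omega⟩
  have hs : 0 < √(B : ℝ) := Real.sqrt_pos.2 hB0
  set h : ℝ := (N : ℝ) ^ recip p with hh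
  have hh0 : 0 < h := by positivity
  set κ : ℝ := 2 / 5 * (h / (N : ℝ) ^ recip q) / √B with hκ
  have hκ0 : 0 < κ := by positivity
  let a : Fin N → Fin N × Fin B → ℝ := fun r y => if y.1 = r then h else 0
  let x : Fin N × (Fin N × Fin B → Bool) → Fin N × Fin B → 𝕜 := fun w => signArray 𝕜 (a w.1) w.2
  have hx : ∀ w, meanNorm p (x w) ≤ 1 := fun w =>
    meanNorm_le_one_of_row hN hB w.1 (fun i t hi => by simp [x, a, signArray, hi]) fun t => by
      simp only [x, a, signArray, if_true]
      rw [RCLike.norm_ofReal, abs_mul, abs_sg, mul_one, abs_of_pos hh0]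
  have key := eRanNon_ge_of_spread (𝕜 := 𝕜) (q := q) hB hBM x hx (κ := κ)
    (c := κ / (N * B)) (by positivity) (n := n) (by
      have : (8 : ℝ) * n ≤ N * B := by exact_mod_cast hn
      have h2 : κ / (N * B) * n ≤ κ / 8 := by
        rw [div_mul_eq_mul_div, div_le_div_iff₀ (by positivity) (by norm_num)]
        nlinarith
      linarith) ?_
  · refine le_trans (le_of_eq ?_) key
    congr 1
    rw [hκ, hh, Real.rpow_sub hN0]; field_simp; norm_num
  intro out Q hloc hQ
  rw [← le_div_iff₀ (by exact_mod_cast Fintype.card_pos), ← Fintype.expect_eq_sum_div_card,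
    Finset.expect_add_distrib]
  obtain ⟨Q₀, hQ₀⟩ : ∃ Q₀, ∀ w, Q w = Q₀ := ⟨Q (0, fun _ => true), fun w => hQ _ _⟩
  simp only [hQ₀] at hloc ⊢
  rw [Fintype.expect_const, ← Finset.univ_product_univ, Finset.expect_product]
  have h2 : ∀ r, κ * (1 - rowCount Q₀ r / B) ≤ 𝔼 u, meanNorm q (rowMean (x (r, u)) - out (r, u)) := by
    intro r
    have h1 := expect_unseen_le (q := q) (a r) (fun u => out (r, u)) (fun _ => Q₀) fun u v h =>
      ⟨(hloc (r, u) (r, v) fun y hy => by simp [x, signArray, h y hy]).1, rfl⟩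
    rw [Fintype.expect_const] at h1
    refine le_trans ?_ h1
    have h3 := expect_norm_rowMean_unseen_ge (𝕜 := 𝕜) hB (a r) Q₀ r (α := h)
      (fun t => by simp [a])
    rw [abs_of_pos hh0] at h3
    have h4 : 𝔼 v, ‖rowMean (unseen 𝕜 (a r) Q₀ v) r‖
        ≤ (N : ℝ) ^ recip q * 𝔼 v, meanNorm q (rowMean (unseen 𝕜 (a r) Q₀ v)) := by
      rw [Finset.mul_expect]
      refine Finset.expect_le_expect fun v _ => ?_
      simpa using norm_apply_le (p := q) (rowMean (unseen 𝕜 (a r) Q₀ v)) r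
    have h5 := h3.trans h4
    rw [← div_le_iff₀' (by positivity)] at h5
    refine le_trans (le_of_eq ?_) h5
    rw [hκ]; field_simp
  have h3 := Finset.expect_le_expect (s := Finset.univ) fun r (_ : r ∈ Finset.univ) => h2 r
  rw [← Finset.mul_expect, Finset.expect_sub_distrib, expect_rowCount_div,
    Fintype.expect_const] at h3
  refine le_trans (le_of_eq ?_) (add_le_add_left h3 _)
  ring

end Signs

section SignsMax

open IBC

variable {𝕜 : Type*} [RCLike 𝕜] {p : ℝ≥0∞} {N M s g n : ℕ}

/-- The unseen columns of the group `τ` of columns in row `i`. -/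
def unseenGroup (Q : Finset (Fin N × Fin (s * g))) (i : Fin N) (τ : Fin s) : Finset (Fin g) :=
  Finset.univ.filter fun l => (i, finProdFinEquiv (τ, l)) ∉ Q

theorem sum_unseenGroup (Q : Finset (Fin N × Fin (s * g))) (i : Fin N) (φ : Fin (s * g) → ℝ) :
    ∑ τ, ∑ l ∈ unseenGroup Q i τ, φ (finProdFinEquiv (τ, l))
      = ∑ t ∈ Finset.univ.filter (fun t => (i, t) ∉ Q), φ t := by
  simp only [unseenGroup, Finset.sum_filter]
  rw [← finProdFinEquiv.sum_comp, Fintype.sum_prod_type]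

/-- The indicator function of the event that every group of a row has a large sum. As a product it has
an explicit expectation. -/
def groupsLarge (J : Fin s → Finset (Fin g)) (w : Fin s → Fin g → Bool) : ℝ :=
  ∏ τ, if √((J τ).card : ℝ) / 2 ≤ ∑ l ∈ J τ, sg (w τ l) then (1 : ℝ) else 0

theorem groupsLarge_eq_zero_or (J : Fin s → Finset (Fin g)) (w : Fin s → Fin g → Bool) :
    groupsLarge J w = 0 ∨ groupsLarge J w = 1 ∧
      ∀ τ, √((J τ).card : ℝ) / 2 ≤ ∑ l ∈ J τ, sg (w τ l) := by
  by_cases h : ∀ τ, √((J τ).card : ℝ) / 2 ≤ ∑ l ∈ J τ, sg (w τ l)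
  · right
    refine ⟨?_, h⟩
    simp [groupsLarge, h]
  · left
    push Not at h
    obtain ⟨τ, hτ⟩ := h
    refine Finset.prod_eq_zero (Finset.mem_univ τ) ?_
    rw [if_neg (not_le.2 hτ)]

theorem expect_groupsLarge_ge (J : Fin s → Finset (Fin g)) :
    (1 / 12 : ℝ) ^ s ≤ 𝔼 w, groupsLarge J w := by
  have h := expect_prod_eq (A := fun _ : Fin s => Fin g → Bool)
    (fun τ w => if √((J τ).card : ℝ) / 2 ≤ ∑ l ∈ J τ, sg (w l) then (1 : ℝ) else 0)
  simp only [groupsLarge]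
  rw [h]
  calc (1 / 12 : ℝ) ^ s = ∏ _τ : Fin s, (1 / 12 : ℝ) := by simp
    _ ≤ _ := Finset.prod_le_prod (fun _ _ => by norm_num) fun τ _ => expect_rademacher_ge_ite (J τ)

/-- If at most a quarter of the entries is known, then at least half of the rows are known at most by
half. In each of these all `s` group sums are large with probability at least `12⁻¹ ^ s`, so
`N ≥ 2 * 12 ^ s` makes it likely that this happens in one of them. -/
theorem expect_max_unseen_ge (hs : 1 ≤ s) (hg : 1 ≤ g) (hN : 2 * 12 ^ s ≤ N)
    (Q : Finset (Fin N × Fin (s * g))) (hQ : 4 * Q.card ≤ N * (s * g)) :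
    1 / (8 * √g) ≤ 𝔼 v, meanNorm ∞ (rowMean (unseen 𝕜 (fun _ => 1) Q v)) := by
  have hs0 : (0 : ℝ) < s := by exact_mod_cast hs
  have hg0 : (0 : ℝ) < g := by exact_mod_cast hg
  have hsg : 0 < √(g : ℝ) := Real.sqrt_pos.2 hg0
  have hgg : √(g : ℝ) ^ 2 = g := Real.sq_sqrt hg0.le
  let A : Finset (Fin N) := Finset.univ.filter fun i => 2 * rowCount Q i ≤ s * g
  let P : (Fin N → Fin s → Fin g → Bool) → ℝ := fun w =>
    ∏ i, if i ∈ A then 1 - groupsLarge (unseenGroup Q i) (w i) else 1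
  let e : (Fin N → Fin s → Fin g → Bool) ≃ (Fin N × Fin (s * g) → Bool) :=
    ((Equiv.piCongrRight fun _ => (Equiv.curry _ _ _).symm.trans
      (Equiv.arrowCongr finProdFinEquiv (Equiv.refl _)))).trans (Equiv.curry _ _ _).symm
  have he : ∀ w i τ l, e w (i, finProdFinEquiv (τ, l)) = w i τ l := by
    intro w i τ l
    simp [e, Equiv.arrowCongr, Function.uncurry]
  have hP : 𝔼 w, P w ≤ 1 / 2 := by
    have h1 := expect_prod_eq (A := fun _ : Fin N => Fin s → Fin g → Bool)
      (fun i w => if i ∈ A then 1 - groupsLarge (unseenGroup Q i) w else 1)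
    have h2 : 𝔼 w, P w ≤ ∏ i, if i ∈ A then 1 - (1 / 12 : ℝ) ^ s else 1 := by
      simp only [P]
      rw [h1]
      refine Finset.prod_le_prod (fun i _ => Finset.expect_nonneg fun w _ => ?_) fun i _ => ?_
      · split_ifs
        · rcases groupsLarge_eq_zero_or (unseenGroup Q i) w with h | ⟨h, -⟩ <;> rw [h] <;> norm_num
        · norm_num
      · split_ifs
        · rw [Finset.expect_sub_distrib, Fintype.expect_const]
          linarith [expect_groupsLarge_ge (unseenGroup Q i)]
        · rw [Fintype.expect_const]
    have hA : N ≤ 2 * A.card := by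
      have h3 : (Finset.univ.filter fun i => ¬ 2 * rowCount Q i ≤ s * g).card * (s * g)
          ≤ 2 * Q.card := by
        rw [← sum_rowCount Q, Finset.mul_sum, ← smul_eq_mul, ← Finset.sum_const]
        refine (Finset.sum_le_sum (f := fun _ => s * g) (g := fun i => 2 * rowCount Q i)
          fun i hi => ?_).trans (Finset.sum_le_sum_of_subset (Finset.filter_subset _ _))
        have := (Finset.mem_filter.1 hi).2
        omega
      have h4 : A.card + (Finset.univ.filter fun i => ¬ 2 * rowCount Q i ≤ s * g).card = N := by
        rw [Finset.card_filter_add_card_filter_not, Finset.card_univ, Fintype.card_fin]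
      set D := (Finset.univ.filter fun i => ¬ 2 * rowCount Q i ≤ s * g).card
      have h5 : 2 * D * (s * g) ≤ N * (s * g) := by nlinarith
      have h6 := Nat.le_of_mul_le_mul_right h5 (Nat.mul_pos hs hg)
      omega
    set x : ℝ := (1 / 12 : ℝ) ^ s with hx
    have hx0 : 0 < x := by positivity
    have hx1 : x ≤ 1 := pow_le_one₀ (by norm_num) (by norm_num)
    have h3 : (∏ i, if i ∈ A then 1 - x else 1) = (1 - x) ^ A.card := by
      rw [Finset.prod_ite_mem, Finset.univ_inter, Finset.prod_const]
    have h4 : 1 ≤ x * A.card := by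
      have h5 : (2 * 12 ^ s : ℝ) ≤ 2 * A.card := by exact_mod_cast hN.trans hA
      have h6 : x * 12 ^ s = 1 := by rw [hx, ← mul_pow]; norm_num
      nlinarith
    have h5 : (1 - x) ^ A.card ≤ Real.exp (-1) := by
      calc (1 - x) ^ A.card ≤ Real.exp (-x) ^ A.card :=
            pow_le_pow_left₀ (by linarith) (by linarith [Real.add_one_le_exp (-x)]) _
        _ = Real.exp (-(x * A.card)) := by rw [← Real.exp_nat_mul]; ring_nf
        _ ≤ _ := Real.exp_le_exp.2 (by linarith)
    have h6 : Real.exp (-1) ≤ 1 / 2 := by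
      rw [Real.exp_neg, one_div]
      exact inv_anti₀ (by norm_num) (by linarith [Real.add_one_le_exp (1 : ℝ)])
    rw [h3] at h2
    linarith
  have hpt : ∀ w, 1 / (4 * √g) * (1 - P w)
      ≤ meanNorm ∞ (rowMean (unseen 𝕜 (fun _ => 1) Q (e w))) := by
    intro w
    by_cases hw : ∀ i ∈ A, groupsLarge (unseenGroup Q i) (w i) = 0
    · have : P w = 1 := by
        refine Finset.prod_eq_one fun i _ => ?_
        split_ifs with hi
        · rw [hw i hi, sub_zero]
        · rfl
      rw [this, sub_self, mul_zero]
      exact meanNorm_nonneg _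
    · push Not at hw
      obtain ⟨i, hi, hne⟩ := hw
      have hlarge := ((groupsLarge_eq_zero_or (unseenGroup Q i) (w i)).resolve_left hne).2
      have hP0 : 0 ≤ P w := by
        refine Finset.prod_nonneg fun j _ => ?_
        split_ifs
        · rcases groupsLarge_eq_zero_or (unseenGroup Q j) (w j) with h | ⟨h, -⟩ <;> rw [h] <;>
            norm_num
        · norm_num
      refine le_trans ?_ (norm_apply_le_meanNorm_top _ i)
      rw [norm_rowMean_unseen (fun _ => 1) Q (e w) i (α := 1) (fun _ => rfl), abs_one,
        ← sum_unseenGroup Q i (fun t => sg (e w (i, t)))]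
      simp only [he]
      have hm : ∀ τ, ((unseenGroup Q i τ).card : ℝ) / (2 * √g)
          ≤ ∑ l ∈ unseenGroup Q i τ, sg (w i τ l) := by
        intro τ
        refine le_trans ?_ (hlarge τ)
        set m : ℝ := ((unseenGroup Q i τ).card : ℝ)
        have hm0 : 0 ≤ m := by positivity
        have hmg : √m ≤ √g := by
          refine Real.sqrt_le_sqrt ?_
          have := Finset.card_le_univ (unseenGroup Q i τ)
          rw [Fintype.card_fin] at this
          simp only [m]
          exact_mod_cast this
        rw [div_le_div_iff₀ (by positivity) (by norm_num)]
        nlinarith [Real.mul_self_sqrt hm0, Real.sqrt_nonneg m]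
      have hcount : (s * g : ℝ) / 2 ≤ ∑ τ, ((unseenGroup Q i τ).card : ℝ) := by
        have h1 := sum_unseenGroup Q i (fun _ => 1)
        simp only [Finset.sum_const, nsmul_eq_mul, mul_one] at h1
        rw [h1]
        have h2 := card_filter_notMem_add_rowCount Q i
        rw [Fintype.card_fin] at h2
        have h3 : 2 * rowCount Q i ≤ s * g := (Finset.mem_filter.1 hi).2
        have h4 : s * g ≤ 2 * (Finset.univ.filter fun t => (i, t) ∉ Q).card := by omega
        have h5 : (s * g : ℝ) ≤ 2 * (Finset.univ.filter fun t => (i, t) ∉ Q).card := by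
          exact_mod_cast h4
        linarith
      have hsum : (s * g : ℝ) / 2 / (2 * √g)
          ≤ ∑ τ, ∑ l ∈ unseenGroup Q i τ, sg (w i τ l) := by
        refine le_trans ?_ (Finset.sum_le_sum fun τ _ => hm τ)
        rw [← Finset.sum_div]
        gcongr
      have h1 : 1 / (4 * √(g : ℝ)) = 1 / ((s * g : ℕ) : ℝ) * ((s * g : ℝ) / 2 / (2 * √g)) := by
        push_cast; field_simp; norm_num
      calc 1 / (4 * √(g : ℝ)) * (1 - P w) ≤ 1 / (4 * √(g : ℝ)) * 1 := by
            gcongr; linarith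
        _ = 1 / ((s * g : ℕ) : ℝ) * ((s * g : ℝ) / 2 / (2 * √g)) := by rw [mul_one, h1]
        _ ≤ _ := by
            gcongr
            exact hsum.trans (le_abs_self _)
  have h1 := Finset.expect_le_expect (s := Finset.univ) fun w (_ : w ∈ Finset.univ) => hpt w
  rw [← Finset.mul_expect, Finset.expect_sub_distrib, Fintype.expect_const,
    Fintype.expect_equiv e _ (fun v => meanNorm ∞ (rowMean (unseen 𝕜 (fun _ => 1) Q v)))
      fun w => rfl] at h1
  refine le_trans ?_ h1
  calc 1 / (8 * √(g : ℝ)) = 1 / (4 * √(g : ℝ)) * (1 - 1 / 2) := by field_simp; norm_num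
    _ ≤ _ := by gcongr

/-- The lower bound for the maximum norm from independent random signs. -/
theorem eRan_top_ge_of_signs [Fact (1 ≤ p)] (hs : 1 ≤ s) (hg : 1 ≤ g)
    (hN : 2 * 12 ^ s ≤ N) (hBM : s * g ≤ M) (hn : 8 * n ≤ N * (s * g)) :
    ENNReal.ofReal (1 / (32 * √g)) ≤ eRan.{u} 𝕜 p ∞ N M n := by
  have hN1 : 1 ≤ N := by have := Nat.one_le_pow s 12 (by norm_num); omega
  have hN0 : (0 : ℝ) < N := by exact_mod_cast hN1
  have hs0 : (0 : ℝ) < s := by exact_mod_cast hs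
  have hg0 : (0 : ℝ) < g := by exact_mod_cast hg
  have hsg : 0 < √(g : ℝ) := Real.sqrt_pos.2 hg0
  set κ : ℝ := 1 / (8 * √g) with hκ
  have hκ0 : 0 < κ := by positivity
  have hx : ∀ u : Fin N × Fin (s * g) → Bool, meanNorm p (signArray 𝕜 (fun _ => 1) u) ≤ 1 :=
    fun u => meanNorm_le_of_forall_le zero_le_one fun y => by
      rw [signArray, RCLike.norm_ofReal, one_mul, abs_sg]
  have key := eRan_ge_of_spread (𝕜 := 𝕜) (q := ∞) (Nat.mul_pos hs hg) hBM
    (signArray 𝕜 fun _ => 1) hx (κ := κ) (c := 4 * κ / (N * (s * g))) (by positivity) (n := n) (by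
      have : (8 : ℝ) * n ≤ N * (s * g) := by exact_mod_cast hn
      have h2 : 4 * κ / (N * (s * g)) * n ≤ κ / 2 := by
        rw [div_mul_eq_mul_div, div_le_div_iff₀ (by positivity) (by norm_num)]
        nlinarith
      linarith) ?_
  · refine le_trans (le_of_eq ?_) key
    congr 1
    rw [hκ]; field_simp; norm_num
  intro out Q hloc
  rw [← le_div_iff₀ (by exact_mod_cast Fintype.card_pos), ← Fintype.expect_eq_sum_div_card,
    Finset.expect_add_distrib]
  have h1 := expect_unseen_le (q := ∞) (fun _ => 1) out Q fun u v h =>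
    hloc u v fun y hy => by simp [signArray, h y hy]
  have h2 : ∀ u, κ - 4 * κ / (N * (s * g)) * (Q u).card
      ≤ 𝔼 v, meanNorm ∞ (rowMean (unseen 𝕜 (fun _ => 1) (Q u) v)) := by
    intro u
    by_cases hQ : 4 * (Q u).card ≤ N * (s * g)
    · refine le_trans ?_ (expect_max_unseen_ge hs hg hN (Q u) hQ)
      have : 0 ≤ 4 * κ / (N * (s * g)) * (Q u).card := by positivity
      linarith
    · refine le_trans ?_ (Finset.expect_nonneg fun v _ => meanNorm_nonneg _)
      have h3 : (N * (s * g) : ℝ) ≤ 4 * (Q u).card := by exact_mod_cast (not_le.1 hQ).le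
      rw [sub_nonpos, div_mul_eq_mul_div, le_div_iff₀ (by positivity)]
      nlinarith
  have h3 := (Finset.expect_le_expect (s := Finset.univ)
    fun u (_ : u ∈ Finset.univ) => h2 u).trans h1
  rw [Finset.expect_sub_distrib, Fintype.expect_const] at h3
  linarith

end SignsMax

/-! ### Building algorithms -/

section Build

open IBC MeasureTheory

variable {𝕜 : Type*} [RCLike 𝕜] {p : ℝ≥0∞} [Fact (1 ≤ p)] {N M : ℕ}

/-- The evaluation at a point, as an admissible functional. -/
def evalAt (x : Fin N × Fin M) : pointEvals 𝕜 p N M := ⟨fun f => f.1 x, x, rfl⟩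

/-- A tuple, continued by zeros. -/
def extendZero {i : ℕ} (y : Fin i → 𝕜) (t : ℕ) : 𝕜 := if h : t < i then y ⟨t, h⟩ else 0

/-- The first `L` terms of a sequence, continued by zeros. -/
def truncZero (L : ℕ) (y : ℕ → 𝕜) (t : ℕ) : 𝕜 := if t < L then y t else 0

/-- The algorithm that queries `P₁ 0, …, P₁ (L₁ - 1)`, obtaining the values `a`, and then queries
`P₂ a 0, …, P₂ a (L₂ a - 1)`. -/
def twoStageAlg {G : Type*} (L₁ : ℕ) (P₁ : ℕ → Fin N × Fin M) (L₂ : (ℕ → 𝕜) → ℕ)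
    (P₂ : (ℕ → 𝕜) → ℕ → Fin N × Fin M) (out : (ℕ → 𝕜) → (ℕ → 𝕜) → G) :
    DetAlg (pointEvals 𝕜 p N M) G where
  query i y := if i < L₁ then evalAt (P₁ i) else evalAt (P₂ (truncZero L₁ (extendZero y)) (i - L₁))
  halt i y := decide (L₁ ≤ i ∧ L₁ + L₂ (truncZero L₁ (extendZero y)) ≤ i)
  out _ y := out (truncZero L₁ (extendZero y)) fun t => extendZero y (L₁ + t)

section

variable {G : Type*} (L₁ : ℕ) (P₁ : ℕ → Fin N × Fin M) (L₂ : (ℕ → 𝕜) → ℕ)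
    (P₂ : (ℕ → 𝕜) → ℕ → Fin N × Fin M) (out : (ℕ → 𝕜) → (ℕ → 𝕜) → G) (f : MeanInput 𝕜 p N M)

theorem twoStageAlg_values (i : ℕ) :
    (twoStageAlg L₁ P₁ L₂ P₂ out).values f i = fun t : Fin i =>
      if (t : ℕ) < L₁ then f.1 (P₁ t)
      else f.1 (P₂ (truncZero L₁ fun t => f.1 (P₁ t)) (t - L₁)) := by
  induction i with
  | zero => funext t; exact t.elim0
  | succ i ih =>
    rw [DetAlg.values, ih]
    funext t
    refine Fin.lastCases ?_ (fun t => ?_) t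
    · rw [Fin.snoc_last]
      simp only [twoStageAlg, Fin.val_last]
      split_ifs with h
      · rfl
      · have : truncZero L₁ (extendZero fun t : Fin i => if (t : ℕ) < L₁ then f.1 (P₁ t)
            else f.1 (P₂ (truncZero L₁ fun t => f.1 (P₁ t)) (t - L₁)))
            = truncZero L₁ fun t => f.1 (P₁ t) := by
          funext t
          by_cases ht : t < L₁
          · simp [truncZero, extendZero, ht, show t < i by omega]
          · simp [truncZero, ht]
        rw [this]; rfl
    · rw [Fin.snoc_castSucc]
      simp

theorem twoStageAlg_trunc {i : ℕ} (hi : L₁ ≤ i) :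
    truncZero L₁ (extendZero ((twoStageAlg L₁ P₁ L₂ P₂ out).values f i))
      = truncZero L₁ fun t => f.1 (P₁ t) := by
  rw [twoStageAlg_values]
  funext t
  by_cases ht : t < L₁
  · simp [truncZero, extendZero, ht, show t < i by omega]
  · simp [truncZero, ht]

theorem twoStageAlg_stopsAt (i : ℕ) : (twoStageAlg L₁ P₁ L₂ P₂ out).StopsAt f i ↔
    L₁ + L₂ (truncZero L₁ fun t => f.1 (P₁ t)) ≤ i := by
  rw [DetAlg.StopsAt]
  have : (twoStageAlg (p := p) L₁ P₁ L₂ P₂ out).halt i ((twoStageAlg L₁ P₁ L₂ P₂ out).values f i)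
      = decide (L₁ ≤ i ∧ L₁ + L₂ (truncZero L₁ (extendZero
        ((twoStageAlg L₁ P₁ L₂ P₂ out).values f i))) ≤ i) := rfl
  rw [this, decide_eq_true_iff]
  constructor
  · rintro ⟨h1, h2⟩
    rwa [twoStageAlg_trunc _ _ _ _ _ _ h1] at h2
  · intro h
    have h1 : L₁ ≤ i := by omega
    exact ⟨h1, by rwa [twoStageAlg_trunc _ _ _ _ _ _ h1]⟩

theorem twoStageAlg_card : (twoStageAlg L₁ P₁ L₂ P₂ out).card f
    = (L₁ + L₂ (truncZero L₁ fun t => f.1 (P₁ t)) : ℕ) :=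
  DetAlg.card_eq_of_stopsAt _ ((twoStageAlg_stopsAt L₁ P₁ L₂ P₂ out f _).2 le_rfl)
    fun j hj => by rw [twoStageAlg_stopsAt]; omega

theorem twoStageAlg_output : (twoStageAlg L₁ P₁ L₂ P₂ out).output f
    = out (truncZero L₁ fun t => f.1 (P₁ t))
      (truncZero (L₂ (truncZero L₁ fun t => f.1 (P₁ t)))
        fun t => f.1 (P₂ (truncZero L₁ fun t => f.1 (P₁ t)) t)) := by
  rw [DetAlg.output_eq_of_stopsAt _ ((twoStageAlg_stopsAt L₁ P₁ L₂ P₂ out f _).2 le_rfl)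
    fun j hj => by rw [twoStageAlg_stopsAt]; omega]
  change out _ _ = _
  rw [twoStageAlg_trunc _ _ _ _ _ _ (by omega), twoStageAlg_values]
  congr 1
  funext t
  by_cases ht : t < L₂ (truncZero L₁ fun t => f.1 (P₁ t)) <;> simp [truncZero, extendZero, ht]

end

/-- Two-stage algorithms: the values `a` at the points `P₁` determine the points `P₂ a` of the
second stage. -/
theorem exists_twoStage {G : Type*} (hN : 1 ≤ N) (hM : 1 ≤ M) {α : Type} [Fintype α]
    (P₁ : α → Fin N × Fin M) (β : (α → 𝕜) → Type) [∀ a, Fintype (β a)]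
    (P₂ : ∀ a, β a → Fin N × Fin M) (out : ∀ a, (β a → 𝕜) → G) :
    ∃ D : DetAlg (pointEvals 𝕜 p N M) G, ((∀ a, IsEmpty (β a)) → D.IsNonadaptive) ∧
      ∀ f, D.card f = (Fintype.card α + Fintype.card (β fun x => f.1 (P₁ x)) : ℕ) ∧
        D.output f = out (fun x => f.1 (P₁ x)) fun b => f.1 (P₂ (fun x => f.1 (P₁ x)) b) := by
  classical
  let x₀ : Fin N × Fin M := (⟨0, hN⟩, ⟨0, hM⟩)
  let e := Fintype.equivFin α
  let e₂ := fun a => Fintype.equivFin (β a)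
  let dec : (ℕ → 𝕜) → α → 𝕜 := fun y x => y (e x)
  let P₁' : ℕ → Fin N × Fin M := fun t => if h : t < Fintype.card α then P₁ (e.symm ⟨t, h⟩) else x₀
  let P₂' : (ℕ → 𝕜) → ℕ → Fin N × Fin M := fun y t =>
    if h : t < Fintype.card (β (dec y)) then P₂ (dec y) ((e₂ (dec y)).symm ⟨t, h⟩) else x₀
  let D : DetAlg (pointEvals 𝕜 p N M) G := twoStageAlg (Fintype.card α) P₁'
    (fun y => Fintype.card (β (dec y))) P₂'
    (fun y z => out (dec y) fun b => z (e₂ (dec y) b))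
  have hdec : ∀ f : MeanInput 𝕜 p N M,
      dec (truncZero (Fintype.card α) fun t => f.1 (P₁' t)) = fun x => f.1 (P₁ x) := by
    intro f
    funext x
    simp [dec, truncZero, P₁']
  refine ⟨D, fun hβ i y z => ?_, fun f => ⟨?_, ?_⟩⟩
  · have hP : ∀ y, P₂' y = fun _ => x₀ := fun y => by
      funext t
      simp only [P₂']
      rw [dif_neg]
      simp
    constructor
    · simp only [D, twoStageAlg, hP]
    · have h0 : ∀ y, Fintype.card (β (dec y)) = 0 := fun y =>
        Fintype.card_eq_zero_iff.2 (hβ (dec y))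
      simp only [D, twoStageAlg, h0]
  · rw [twoStageAlg_card, hdec]
  · rw [twoStageAlg_output]
    have key : ∀ y : ℕ → 𝕜, ∀ a, dec y = a →
        (out (dec y) fun b => truncZero (Fintype.card (β (dec y))) (fun t => f.1 (P₂' y t))
          (e₂ (dec y) b)) = out a fun b => f.1 (P₂ a b) := by
      rintro y _ rfl
      congr 1
      funext b
      simp [truncZero, P₂']
    exact key _ _ (hdec f)

end Build

/-- The algorithm without queries and with output `0`. -/
theorem exists_zero_alg (𝕜 : Type*) [RCLike 𝕜] (p q : ℝ≥0∞) [Fact (1 ≤ p)] {N M : ℕ} (hN : 1 ≤ N)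
    (hM : 1 ≤ M) :
    ∃ D : IBC.DetAlg (pointEvals 𝕜 p N M) (MeanLp q 𝕜 (Fin N)), D.IsNonadaptive ∧
      ∀ f, D.card f = 0 ∧ D.output f = 0 := by
  obtain ⟨D, h1, h2⟩ := exists_twoStage (𝕜 := 𝕜) (p := p) hN hM (α := Empty) (fun x => x.elim)
    (fun _ => Empty) (fun _ x => x.elim) (fun _ _ => (0 : MeanLp q 𝕜 (Fin N)))
  exact ⟨D, h1 fun _ => inferInstance, fun f => ⟨by simpa using (h2 f).1, (h2 f).2⟩⟩

/-! ### Randomized algorithms with finitely many realizations -/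

section Finite

open IBC MeasureTheory

variable {𝕜 : Type*} [RCLike 𝕜] {p q : ℝ≥0∞} [Fact (1 ≤ p)] [Fact (1 ≤ q)] {N M n : ℕ}

/-- A finite family of deterministic algorithms with uniform distribution, as a randomized
algorithm. -/
def finRanAlg {Ω : Type} [Fintype Ω] [Nonempty Ω]
    (D : Ω → DetAlg (pointEvals 𝕜 p N M) (MeanLp q 𝕜 (Fin N))) :
    RanAlg.{u} (pointEvals 𝕜 p N M) (MeanLp q 𝕜 (Fin N)) where
  Ω := ULift.{u} Ω
  mΩ := ⊤
  P := @ProbabilityTheory.uniformOn _ ⊤ Set.univ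
  isProb :=
    let _ : MeasurableSpace (ULift.{u} Ω) := ⊤
    have : MeasurableSingletonClass (ULift.{u} Ω) := ⟨fun _ => trivial⟩
    ProbabilityTheory.isProbabilityMeasure_uniformOn Set.finite_univ Set.univ_nonempty
  alg ω := D ω.down
  measurable_card _ := fun _ _ => trivial
  measurable_output _ := fun _ _ => trivial
  separable_output f := ⟨Set.range fun ω : ULift.{u} Ω => (D ω.down).output f,
    (Set.finite_range _).countable.isSeparable, Filter.Eventually.of_forall fun ω => ⟨ω, rfl⟩⟩

theorem finRanAlg_lintegral {Ω : Type} [Fintype Ω] [Nonempty Ω]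
    (D : Ω → DetAlg (pointEvals 𝕜 p N M) (MeanLp q 𝕜 (Fin N))) (g : Ω → ℝ) (hg : ∀ ω, 0 ≤ g ω) :
    ∫⁻ ω, ENNReal.ofReal (g ω.down) ∂(finRanAlg.{u} D).P = ENNReal.ofReal (𝔼 ω, g ω) := by
  let : MeasurableSpace (ULift.{u} Ω) := ⊤
  have : MeasurableSingletonClass (ULift.{u} Ω) := ⟨fun _ => trivial⟩
  change ∫⁻ ω : ULift.{u} Ω, ENNReal.ofReal (g ω.down)
    ∂(ProbabilityTheory.uniformOn Set.univ) = _
  rw [lintegral_fintype]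
  have h1 : ∀ ω : ULift.{u} Ω, ProbabilityTheory.uniformOn Set.univ {ω}
      = ENNReal.ofReal (Fintype.card Ω : ℝ)⁻¹ := by
    intro ω
    rw [ProbabilityTheory.uniformOn_univ, ENNReal.ofReal_inv_of_pos (by
      exact_mod_cast Fintype.card_pos), ENNReal.ofReal_natCast]
    simp
  simp only [h1]
  rw [← Finset.sum_mul, ← ENNReal.ofReal_sum_of_nonneg fun ω _ => hg _,
    ← ENNReal.ofReal_mul (Finset.sum_nonneg fun ω _ => hg _), Fintype.expect_eq_sum_div_card,
    div_eq_mul_inv, ← Equiv.sum_comp (Equiv.ulift.{u} (α := Ω))]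
  rfl

theorem finRanAlg_error_le {Ω : Type} [Fintype Ω] [Nonempty Ω]
    (D : Ω → DetAlg (pointEvals 𝕜 p N M) (MeanLp q 𝕜 (Fin N))) {e : ℝ}
    (h : ∀ f, 𝔼 ω, ‖meanOp 𝕜 p q N M f - (D ω).output f‖ ≤ e) :
    (finRanAlg.{u} D).error (meanOp 𝕜 p q N M) ≤ ENNReal.ofReal e := by
  refine iSup_le fun f => le_trans (le_of_eq ?_) (ENNReal.ofReal_le_ofReal (h f))
  rw [← finRanAlg_lintegral D _ fun ω => norm_nonneg _]
  simp only [ofReal_norm]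
  rfl

theorem finRanAlg_card_le {Ω : Type} [Fintype Ω] [Nonempty Ω]
    (D : Ω → DetAlg (pointEvals 𝕜 p N M) (MeanLp q 𝕜 (Fin N))) (c : MeanInput 𝕜 p N M → Ω → ℕ)
    (hD : ∀ f ω, (D ω).card f = c f ω) (hc : ∀ f, 𝔼 ω, (c f ω : ℝ) ≤ n) :
    (finRanAlg.{u} D).card ≤ n := by
  refine iSup_le fun f => le_trans (le_of_eq ?_) ((ENNReal.ofReal_le_ofReal (hc f)).trans
    (le_of_eq (ENNReal.ofReal_natCast n)))
  rw [← finRanAlg_lintegral D (fun ω => (c f ω : ℝ)) fun ω => Nat.cast_nonneg _]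
  refine lintegral_congr fun ω => ?_
  change (((D ω.down).card f : ℕ∞) : ℝ≥0∞) = _
  rw [hD, ENNReal.ofReal_natCast]
  simp

theorem eRan_le_of_finite {Ω : Type} [Fintype Ω] [Nonempty Ω]
    (D : Ω → DetAlg (pointEvals 𝕜 p N M) (MeanLp q 𝕜 (Fin N))) (c : MeanInput 𝕜 p N M → Ω → ℕ)
    (hD : ∀ f ω, (D ω).card f = c f ω) (hc : ∀ f, 𝔼 ω, (c f ω : ℝ) ≤ n) {e : ℝ}
    (h : ∀ f, 𝔼 ω, ‖meanOp 𝕜 p q N M f - (D ω).output f‖ ≤ e) :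
    eRan.{u} 𝕜 p q N M n ≤ ENNReal.ofReal e :=
  (iInf₂_le (finRanAlg D) (finRanAlg_card_le D c hD hc)).trans (finRanAlg_error_le D h)

theorem eRanNon_le_of_finite {Ω : Type} [Fintype Ω] [Nonempty Ω]
    (D : Ω → DetAlg (pointEvals 𝕜 p N M) (MeanLp q 𝕜 (Fin N))) (hnon : ∀ ω, (D ω).IsNonadaptive)
    (hD : ∀ f ω, (D ω).card f ≤ n) {e : ℝ}
    (h : ∀ f, 𝔼 ω, ‖meanOp 𝕜 p q N M f - (D ω).output f‖ ≤ e) :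
    eRanNon.{u} 𝕜 p q N M n ≤ ENNReal.ofReal e := by
  refine (iInf₂_le_of_le (finRanAlg D) (fun ω : ULift.{u} Ω => hnon ω.down) (iInf_le _ ?_)).trans
    (finRanAlg_error_le D h)
  have h' : ∀ f ω, ∃ k : ℕ, (D ω).card f = k ∧ k ≤ n := fun f ω => by
    obtain ⟨k, hk⟩ := ENat.ne_top_iff_exists.1 (ne_top_of_le_ne_top (ENat.natCast_ne_top n) (hD f ω))
    refine ⟨k, hk.symm, ?_⟩
    have := hD f ω
    rw [← hk] at this
    exact_mod_cast this
  choose c hc hcn using h'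
  exact finRanAlg_card_le D c hc fun f => Finset.expect_le Finset.univ_nonempty fun ω _ => by
    exact_mod_cast hcn f ω

theorem eRan_le_eRanNon : eRan.{u} 𝕜 p q N M n ≤ eRanNon.{u} 𝕜 p q N M n :=
  le_iInf₂ fun A _ => le_iInf fun hA => iInf₂_le A hA

theorem eDet_le_eDetNon : eDet 𝕜 p q N M n ≤ eDetNon 𝕜 p q N M n :=
  le_iInf₂ fun A _ => le_iInf fun hA => iInf₂_le A hA

/-! ### The zero algorithm and the deterministic setting -/

theorem norm_meanOp_le (hN : 1 ≤ N) (f : MeanInput 𝕜 p N M) :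
    ‖meanOp 𝕜 p q N M f‖ ≤ (N : ℝ) ^ max (recip p - recip q) 0 := by
  have : NeZero N := ⟨by omega⟩
  have h := norm_meanOp_sub (q := q) f 0
  rw [sub_zero] at h
  have h0 : meanOp 𝕜 p q N M f - (show MeanLp q 𝕜 (Fin N) from (0 : Fin N → 𝕜))
      = meanOp 𝕜 p q N M f := sub_zero _
  rw [h0] at h
  rw [h]
  refine (meanNorm_le_card_rpow_max_mul (p := p) _).trans ?_
  rw [Fintype.card_fin]
  exact mul_le_of_le_one_right (by positivity)
    ((meanNorm_rowMean_le _).trans (meanNorm_input_le f))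

theorem eDetNon_le (hN : 1 ≤ N) (hM : 1 ≤ M) :
    eDetNon 𝕜 p q N M n ≤ ENNReal.ofReal ((N : ℝ) ^ max (recip p - recip q) 0) := by
  obtain ⟨D, h1, h2⟩ := exists_zero_alg 𝕜 p q hN hM
  refine iInf₂_le_of_le D h1 (iInf_le_of_le (by simp [h2]) (iSup_le fun f => ?_))
  rw [(h2 f).2, sub_zero, ← ofReal_norm]
  exact ENNReal.ofReal_le_ofReal (norm_meanOp_le hN f)

theorem eRanNon_le_zero_alg (hN : 1 ≤ N) (hM : 1 ≤ M) :
    eRanNon.{u} 𝕜 p q N M n ≤ ENNReal.ofReal ((N : ℝ) ^ max (recip p - recip q) 0) := by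
  obtain ⟨D, h1, h2⟩ := exists_zero_alg 𝕜 p q hN hM
  refine eRanNon_le_of_finite (Ω := Unit) (fun _ => D) (fun _ => h1) (fun f _ => by simp [h2])
    fun f => ?_
  rw [(h2 f).2, sub_zero, Fintype.expect_const]
  exact norm_meanOp_le hN f

/-- In the deterministic setting an input may vanish at all queried points. -/
theorem eDet_ge (hN : 1 ≤ N) (hM : 1 ≤ M) (hn : 2 * n ≤ N * M) :
    ENNReal.ofReal (1 / 2 * (N : ℝ) ^ max (recip p - recip q) 0) ≤ eDet 𝕜 p q N M n := by
  classical
  refine le_iInf₂ fun D hD => ?_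
  have hN0 : (0 : ℝ) < N := by exact_mod_cast hN
  have : NeZero N := ⟨by omega⟩
  have hz : meanNorm p (0 : Fin N × Fin M → 𝕜) ≤ 1 :=
    meanNorm_le_of_forall_le zero_le_one (by simp)
  set Q := D.queried (mkInput 0 hz) with hQ
  have hQn : Q.card ≤ n := by
    have h1 := (D.card_queried_le (mkInput 0 hz)).trans ((le_iSup _ _).trans hD)
    exact_mod_cast h1
  -- it suffices to find an input that vanishes on `Q` with a large vector of row means
  suffices h : ∃ x : Fin N × Fin M → 𝕜, meanNorm p x ≤ 1 ∧ (∀ y ∈ Q, x y = 0) ∧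
      1 / 2 * (N : ℝ) ^ max (recip p - recip q) 0 ≤ meanNorm q (rowMean x) by
    obtain ⟨x, hx, hxQ, hge⟩ := h
    have hx' : meanNorm p (-x) ≤ 1 := by rwa [meanNorm_neg]
    let o : Fin N → 𝕜 := D.output (mkInput 0 hz)
    have h1 : D.output (mkInput x hx) = o :=
      (D.output_queried_congr (f := mkInput 0 hz) (g := mkInput x hx) fun y hy => hxQ y hy).1
    have h2 : D.output (mkInput (-x) hx') = o :=
      (D.output_queried_congr (f := mkInput 0 hz) (g := mkInput (-x) hx') fun y hy => by
        change -x y = 0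
        rw [hxQ y hy, neg_zero]).1
    have h3 := two_meanNorm_le (p := q) (rowMean x) 0 o
    have h4 := norm_meanOp_sub (q := q) (mkInput x hx) o
    have h5 := norm_meanOp_sub (q := q) (mkInput (-x) hx') o
    have h6 : ∀ f, ‖meanOp 𝕜 p q N M f - D.output f‖ₑ
        ≤ ⨆ f, ‖meanOp 𝕜 p q N M f - D.output f‖ₑ := fun f => le_iSup
          (fun f => ‖meanOp 𝕜 p q N M f - D.output f‖ₑ) f
    rcases le_total (meanNorm q (0 + rowMean x - o)) (meanNorm q (rowMean x)) with h7 | h7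
    · refine le_trans ?_ (h6 (mkInput (-x) hx'))
      rw [h2, ← ofReal_norm]
      refine ENNReal.ofReal_le_ofReal (hge.trans ?_)
      refine le_trans ?_ h5.ge
      have : rowMean ((mkInput (-x) hx').1 : Fin N × Fin M → 𝕜) = 0 - rowMean x := by
        rw [zero_sub, ← rowMean_neg]; rfl
      rw [this]
      linarith
    · refine le_trans ?_ (h6 (mkInput x hx))
      rw [h1, ← ofReal_norm]
      refine ENNReal.ofReal_le_ofReal (hge.trans ?_)
      refine le_trans ?_ h4.ge
      rw [zero_add] at h7
      exact h7
  have hM0 : (0 : ℝ) < M := by exact_mod_cast hM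
  have hrow : ∀ (c : 𝕜) i, rowMean (fun y => if y ∈ Q then 0 else c) i
      = ((1 - (rowCount Q i : ℝ) / M : ℝ) : 𝕜) * c := by
    intro c i
    have h1 := card_filter_notMem_add_rowCount Q i
    rw [Fintype.card_fin] at h1
    have h2 : (((Finset.univ.filter fun j => (i, j) ∉ Q).card : ℝ) : 𝕜) = (M : 𝕜) - rowCount Q i := by
      have : ((Finset.univ.filter fun j => (i, j) ∉ Q).card : ℝ) = M - rowCount Q i := by
        have : ((Finset.univ.filter fun j => (i, j) ∉ Q).card : ℝ) + rowCount Q i = M := by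
          exact_mod_cast h1
        linarith
      rw [this]; simp
    have h3 : ∑ j, (if (i, j) ∈ Q then 0 else c)
        = (((Finset.univ.filter fun j => (i, j) ∉ Q).card : ℝ) : 𝕜) * c := by
      simp only [← ite_not (_ ∈ Q)]
      rw [← Finset.sum_filter, Finset.sum_const, nsmul_eq_mul]
      simp
    have hMk : (M : 𝕜) ≠ 0 := by exact_mod_cast (by omega : M ≠ 0)
    rw [rowMean, h3, h2, Fintype.card_fin]
    push_cast
    field_simp
  have hnorm : ∀ (c : 𝕜) i, ‖rowMean (fun y => if y ∈ Q then 0 else c) i‖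
      = (1 - (rowCount Q i : ℝ) / M) * ‖c‖ := by
    intro c i
    rw [hrow, norm_mul, RCLike.norm_ofReal, abs_of_nonneg]
    have h1 := card_filter_notMem_add_rowCount Q i
    rw [Fintype.card_fin] at h1
    rw [sub_nonneg, div_le_one hM0]
    exact_mod_cast (by omega : rowCount Q i ≤ M)
  have havg : (1 / 2 : ℝ) ≤ 𝔼 i, (1 - (rowCount Q i : ℝ) / M) := by
    rw [Finset.expect_sub_distrib, expect_rowCount_div, Fintype.expect_const]
    have : (2 * Q.card : ℝ) ≤ N * M := by exact_mod_cast (by omega : 2 * Q.card ≤ N * M)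
    have : (Q.card : ℝ) / (N * M) ≤ 1 / 2 := by
      rw [div_le_div_iff₀ (by positivity) (by norm_num)]; linarith
    linarith
  rcases le_total q p with hqp | hpq
  · refine ⟨fun y => if y ∈ Q then 0 else 1, ?_, fun y hy => by simp [hy], ?_⟩
    · refine meanNorm_le_of_forall_le zero_le_one fun y => ?_
      split_ifs <;> simp
    · rw [max_eq_right (by linarith [recip_anti hqp]), Real.rpow_zero, mul_one]
      refine le_trans ?_ (expect_norm_le_meanNorm _)
      simpa only [hnorm, norm_one, mul_one] using havg
  · rw [max_eq_left (by linarith [recip_anti hpq])]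
    obtain ⟨i, -, hi⟩ := Finset.exists_le_of_le_expect Finset.univ_nonempty havg
    set h : ℝ := (N : ℝ) ^ recip p with hh
    have hh0 : 0 < h := by positivity
    refine ⟨fun y => if y ∈ Q then 0 else if y.1 = i then (h : 𝕜) else 0,
      meanNorm_le_one_of_row hN hM i (fun i' t hi' => by simp [hi']) fun t => ?_,
      fun y hy => by simp [hy], ?_⟩
    · split_ifs with hy
      · simpa using hh0.le
      · rw [RCLike.norm_ofReal, abs_of_pos hh0]
      · simp_all
    · set x : Fin N × Fin M → 𝕜 := fun y => if y ∈ Q then 0 else if y.1 = i then (h : 𝕜) else 0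
      have h1 : rowMean x i = rowMean (fun y => if y ∈ Q then 0 else (h : 𝕜)) i := by
        simp [rowMean, x]
      have h2 := norm_apply_le (p := q) (rowMean x) i
      rw [h1, hnorm, RCLike.norm_ofReal, abs_of_pos hh0, Fintype.card_fin,
        ← div_le_iff₀' (by positivity)] at h2
      refine le_trans ?_ h2
      rw [Real.rpow_sub hN0, ← hh, ← mul_div_assoc]
      gcongr

end Finite

/-! ### Moments of Monte Carlo sums -/

section MonteCarlo

variable {A ι : Type*} [Fintype A] [Nonempty A] [Fintype ι] [DecidableEq ι]

theorem expect_eval (g : A → ℝ) (l : ι) : 𝔼 ξ : ι → A, g (ξ l) = 𝔼 a, g a := by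
  rw [← expect_update _ l]
  simp

/-- Symmetrization: centred sums are dominated by sums with random signs of differences of
independent copies. The independent copy enters by Jensen's inequality; exchanging it with the
original at the places with a negative sign preserves the distribution. -/
theorem expect_convex_le_symmetrized {Ψ : ℝ → ℝ} (hΨ : ConvexOn ℝ Set.univ Ψ) (y : A → ℝ) :
    𝔼 ξ : ι → A, Ψ (∑ l, (y (ξ l) - 𝔼 a, y a))
      ≤ 𝔼 ξ : ι → A, 𝔼 ξ' : ι → A, 𝔼 u : ι → Bool,
        Ψ (∑ l, sg (u l) * (y (ξ l) - y (ξ' l))) := by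
  have h1 : 𝔼 ξ : ι → A, Ψ (∑ l, (y (ξ l) - 𝔼 a, y a))
      ≤ 𝔼 ξ : ι → A, 𝔼 ξ' : ι → A, Ψ (∑ l, (y (ξ l) - y (ξ' l))) := by
    refine Finset.expect_le_expect fun ξ _ => ?_
    have h2 : ∑ l, (y (ξ l) - 𝔼 a, y a) = 𝔼 ξ' : ι → A, ∑ l, (y (ξ l) - y (ξ' l)) := by
      rw [Finset.expect_sum_comm]
      refine Finset.sum_congr rfl fun l _ => ?_
      rw [Finset.expect_sub_distrib, Fintype.expect_const, expect_eval y l]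
    rw [h2, Fintype.expect_eq_sum_div_card, Fintype.expect_eq_sum_div_card]
    have h3 := hΨ.map_sum_le (t := (Finset.univ : Finset (ι → A)))
      (w := fun _ => (Fintype.card (ι → A) : ℝ)⁻¹) (p := fun ξ' => ∑ l, (y (ξ l) - y (ξ' l)))
      (fun _ _ => by positivity) (by simp) (fun _ _ => trivial)
    simp only [smul_eq_mul] at h3
    rw [← Finset.mul_sum, ← Finset.mul_sum] at h3
    rwa [div_eq_inv_mul, div_eq_inv_mul]
  refine h1.trans (le_of_eq ?_)
  have h2 : ∀ u : ι → Bool, 𝔼 ξ : ι → A, 𝔼 ξ' : ι → A, Ψ (∑ l, sg (u l) * (y (ξ l) - y (ξ' l)))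
      = 𝔼 ξ : ι → A, 𝔼 ξ' : ι → A, Ψ (∑ l, (y (ξ l) - y (ξ' l))) := by
    intro u
    let T : (ι → A) × (ι → A) → (ι → A) × (ι → A) := fun w =>
      (fun l => if u l then w.1 l else w.2 l, fun l => if u l then w.2 l else w.1 l)
    have hT : Function.Involutive T := by
      rintro ⟨ξ, ξ'⟩
      refine Prod.ext ?_ ?_ <;> funext l <;> by_cases h : u l <;> simp [T, h]
    have := Fintype.expect_equiv hT.toPerm
      (fun w : (ι → A) × (ι → A) => Ψ (∑ l, sg (u l) * (y (w.1 l) - y (w.2 l))))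
      (fun w => Ψ (∑ l, (y (w.1 l) - y (w.2 l)))) (fun w => by
        congr 1
        refine Finset.sum_congr rfl fun l _ => ?_
        by_cases h : u l <;> simp [T, h, sg])
    rwa [← Finset.univ_product_univ, Finset.expect_product, Finset.expect_product] at this
  calc 𝔼 ξ : ι → A, 𝔼 ξ' : ι → A, Ψ (∑ l, (y (ξ l) - y (ξ' l)))
      = 𝔼 u : ι → Bool, 𝔼 ξ : ι → A, 𝔼 ξ' : ι → A,
          Ψ (∑ l, sg (u l) * (y (ξ l) - y (ξ' l))) := by
        simp only [h2]; rw [Fintype.expect_const]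
    _ = 𝔼 ξ : ι → A, 𝔼 u : ι → Bool, 𝔼 ξ' : ι → A,
          Ψ (∑ l, sg (u l) * (y (ξ l) - y (ξ' l))) := Finset.expect_comm _ _ _
    _ = _ := Finset.expect_congr rfl fun ξ _ => Finset.expect_comm _ _ _

/-- The hyperbolic cosine covers both tails of the sum and, unlike `exp |·|`, factorizes after splitting
into exponentials. -/
theorem expect_cosh_rademacher_le (x : ι → ℝ) (c : ℝ) :
    𝔼 u : ι → Bool, Real.cosh (c * ∑ l, sg (u l) * x l) ≤ Real.exp (c ^ 2 * (∑ l, x l ^ 2) / 2) := by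
  have h1 : ∀ c : ℝ, 𝔼 u : ι → Bool, Real.exp (c * ∑ l, sg (u l) * x l)
      ≤ Real.exp (c ^ 2 * (∑ l, x l ^ 2) / 2) := by
    intro c
    have h2 := expect_prod_eq (A := fun _ : ι => Bool) (fun l b => Real.exp (c * (sg b * x l)))
    simp only [← Real.exp_sum, ← Finset.mul_sum] at h2
    rw [h2]
    have h3 : Real.exp (c ^ 2 * (∑ l, x l ^ 2) / 2) = ∏ l, Real.exp ((c * x l) ^ 2 / 2) := by
      rw [← Real.exp_sum]
      congr 1
      rw [Finset.mul_sum, Finset.sum_div]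
      exact Finset.sum_congr rfl fun l _ => by ring
    rw [h3]
    refine Finset.prod_le_prod (fun l _ => Finset.expect_nonneg fun b _ => (Real.exp_pos _).le)
      fun l _ => ?_
    rw [expect_bool]
    refine le_trans (le_of_eq ?_) (Real.cosh_le_exp_half_sq (c * x l))
    simp [sg, Real.cosh_eq]
  have h2 := h1 c
  have h3 := h1 (-c)
  simp only [Real.cosh_eq]
  rw [← Finset.expect_div, Finset.expect_add_distrib]
  simp only [neg_mul, neg_sq] at h3
  linarith

/-- Khintchine's inequality. -/
theorem expect_rademacher_rpow_le (x : ι → ℝ) {r : ℝ} (hr : 1 ≤ r) :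
    𝔼 u : ι → Bool, |∑ l, sg (u l) * x l| ^ r ≤ 4 * r ^ r * (∑ l, x l ^ 2) ^ (r / 2) := by
  have hr0 : 0 < r := by linarith
  rcases (Finset.sum_nonneg fun l (_ : l ∈ Finset.univ) => sq_nonneg (x l)).eq_or_lt with h0 | h0
  · have hx : ∀ l, x l = 0 := fun l => by
      have := (Finset.sum_eq_zero_iff_of_nonneg fun l (_ : l ∈ Finset.univ) => sq_nonneg (x l)).1
        h0.symm l (Finset.mem_univ l)
      exact pow_eq_zero_iff (two_ne_zero) |>.1 this
    simp [hx, Real.zero_rpow hr0.ne', Real.zero_rpow (show r / 2 ≠ 0 by positivity)]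
  set v : ℝ := ∑ l, x l ^ 2 with hv
  have hs : 0 < √v := Real.sqrt_pos.2 h0
  -- `t ^ r ≤ r ^ r e ^ t` for `t = |s| / √v`
  have key : ∀ s : ℝ, |s| ^ r ≤ 2 * r ^ r * v ^ (r / 2) * Real.cosh ((√v)⁻¹ * s) := by
    intro s
    have h1 : |s| / √v / r ≤ Real.exp (|s| / √v / r) := by
      linarith [Real.add_one_le_exp (|s| / √v / r)]
    have h2 := Real.rpow_le_rpow (by positivity) h1 hr0.le
    rw [← Real.exp_mul, div_mul_cancel₀ _ hr0.ne', Real.div_rpow (by positivity) hr0.le,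
      Real.div_rpow (by positivity) hs.le, Real.sqrt_eq_rpow, ← Real.rpow_mul h0.le,
      ← Real.sqrt_eq_rpow, show 1 / 2 * r = r / 2 by ring] at h2
    rw [div_le_iff₀ (by positivity), div_le_iff₀ (by positivity)] at h2
    have h3 : Real.exp (|s| / √v) ≤ 2 * Real.cosh ((√v)⁻¹ * s) := by
      rw [← Real.cosh_abs, abs_mul, abs_of_pos (inv_pos.2 hs), Real.cosh_eq, ← div_eq_inv_mul]
      linarith [Real.exp_pos (-(|s| / √v))]
    calc |s| ^ r ≤ Real.exp (|s| / √v) * r ^ r * v ^ (r / 2) := h2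
      _ ≤ 2 * Real.cosh ((√v)⁻¹ * s) * r ^ r * v ^ (r / 2) := by gcongr
      _ = _ := by ring
  refine (Finset.expect_le_expect fun u _ => key _).trans ?_
  rw [← Finset.mul_expect]
  have h4 := expect_cosh_rademacher_le x (√v)⁻¹
  have h5 : (√v)⁻¹ ^ 2 * (∑ l, x l ^ 2) / 2 = 1 / 2 := by
    rw [← hv, inv_pow, Real.sq_sqrt h0.le, inv_mul_cancel₀ h0.ne']
  have h6 : Real.exp (1 / 2) ≤ 2 := by
    have h7 : Real.exp (1 / 2) ^ 2 ≤ 2 ^ 2 := by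
      rw [← Real.exp_nat_mul]
      norm_num
      linarith [Real.exp_one_lt_d9]
    exact le_of_sq_le_sq h7 (by norm_num)
  rw [h5] at h4
  calc _ ≤ 2 * r ^ r * v ^ (r / 2) * 2 := by gcongr; linarith
    _ = _ := by ring

/-- The sampling error of the empirical mean at the sample points `ξ`. -/
def mcErr {𝕜 : Type*} [RCLike 𝕜] (y : A → 𝕜) (ξ : ι → A) : 𝕜 :=
  (Fintype.card A : 𝕜)⁻¹ * ∑ a, y a - (Fintype.card ι : 𝕜)⁻¹ * ∑ l, y (ξ l)

theorem mcErr_real {ι : Type*} [Fintype ι] [Nonempty ι] (y : A → ℝ) (ξ : ι → A) :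
    mcErr y ξ = -((Fintype.card ι : ℝ)⁻¹ * ∑ l, (y (ξ l) - 𝔼 a, y a)) := by
  have h : (Fintype.card ι : ℝ) ≠ 0 := by exact_mod_cast Fintype.card_ne_zero
  rw [mcErr, Finset.sum_sub_distrib, Finset.sum_const, Finset.card_univ, nsmul_eq_mul,
    Fintype.expect_eq_sum_div_card]
  field_simp
  simp

variable {p : ℝ≥0∞} [hp : Fact (1 ≤ p)]

theorem add_rpow_le_two_rpow_mul {a b r : ℝ} (ha : 0 ≤ a) (hb : 0 ≤ b) (hr : 0 ≤ r) :
    (a + b) ^ r ≤ 2 ^ r * (a ^ r + b ^ r) := by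
  have h1 : (a + b) ^ r ≤ (2 * max a b) ^ r :=
    Real.rpow_le_rpow (by positivity) (by linarith [le_max_left a b, le_max_right a b]) hr
  refine h1.trans ?_
  rw [Real.mul_rpow (by norm_num) (le_max_of_le_left ha)]
  gcongr
  rcases max_cases a b with ⟨h, -⟩ | ⟨h, -⟩ <;> rw [h]
  · linarith [Real.rpow_nonneg hb r]
  · linarith [Real.rpow_nonneg ha r]

theorem convexOn_abs_rpow {r : ℝ} (hr : 1 ≤ r) : ConvexOn ℝ Set.univ fun t : ℝ => |t| ^ r := by
  refine ⟨convex_univ, fun x _ y _ a b ha hb hab => ?_⟩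
  have h1 := (convexOn_rpow hr).2 (abs_nonneg x) (abs_nonneg y) ha hb hab
  refine le_trans (Real.rpow_le_rpow (abs_nonneg _) ?_ (by linarith)) h1
  refine (abs_add_le _ _).trans (le_of_eq ?_)
  simp [abs_mul, abs_of_nonneg ha, abs_of_nonneg hb]

theorem convexOn_cosh_mul (c : ℝ) : ConvexOn ℝ Set.univ fun t : ℝ => Real.cosh (c * t) := by
  refine ⟨convex_univ, fun x _ y _ a b ha hb hab => ?_⟩
  have h1 := convexOn_exp.2 (Set.mem_univ (c * x)) (Set.mem_univ (c * y)) ha hb hab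
  have h2 := convexOn_exp.2 (Set.mem_univ (-(c * x))) (Set.mem_univ (-(c * y))) ha hb hab
  simp only [smul_eq_mul, Real.cosh_eq] at *
  rw [show a * (c * x) + b * (c * y) = c * (a * x + b * y) by ring] at h1
  rw [show a * -(c * x) + b * -(c * y) = -(c * (a * x + b * y)) by ring] at h2
  linarith

theorem recip_min_two (p : ℝ≥0∞) [Fact (1 ≤ p)] :
    recip (min p 2) = 1 / 2 + max (recip p - recip 2) 0 := by
  have : Fact ((1 : ℝ≥0∞) ≤ 2) := ⟨by norm_num⟩
  rcases le_total p 2 with h | h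
  · rw [min_eq_left h, max_eq_left (by linarith [recip_anti h]), recip_two]; ring
  · rw [min_eq_right h, max_eq_right (by linarith [recip_anti h, recip_two]), recip_two]; ring

/-- Comparison of the `ℓ_2`-norm with `p`-th moments, on both sides of `p = 2`. -/
theorem sum_sq_rpow_le {ι : Type*} [Fintype ι] [Nonempty ι] (h : p ≠ ∞) (x : ι → ℝ) :
    (∑ l, x l ^ 2) ^ (p.toReal / 2)
      ≤ (Fintype.card ι : ℝ) ^ (p.toReal * recip (min p 2)) * 𝔼 l, |x l| ^ p.toReal := by
  have hr := one_le_toReal (p := p) h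
  have : Fact ((1 : ℝ≥0∞) ≤ 2) := ⟨by norm_num⟩
  set r := p.toReal with hrdef
  set m : ℝ := (Fintype.card ι : ℝ) with hm
  have hm0 : 0 < m := by rw [hm]; exact_mod_cast Fintype.card_pos
  have h1 := meanNorm_le_card_rpow_max_mul (p := p) (q := 2) x
  have h2 := Real.rpow_le_rpow (meanNorm_nonneg x) h1 (by linarith : 0 ≤ r)
  rw [Real.mul_rpow (by positivity) (meanNorm_nonneg x), meanNorm_rpow h, ← hm,
    ← Real.rpow_mul hm0.le] at h2
  have h3 : ∑ l, x l ^ 2 = m * meanNorm 2 x ^ (2 : ℝ) := by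
    have := meanNorm_rpow (p := 2) (by norm_num) x
    simp only [ENNReal.toReal_ofNat] at this
    rw [this, hm, Fintype.card_mul_expect]
    simp
  rw [h3, Real.mul_rpow hm0.le (Real.rpow_nonneg (meanNorm_nonneg x) _),
    ← Real.rpow_mul (meanNorm_nonneg x), show 2 * (r / 2) = r by ring, recip_min_two p]
  calc m ^ (r / 2) * meanNorm 2 x ^ r
      ≤ m ^ (r / 2) * (m ^ (max (recip p - recip 2) 0 * r) * 𝔼 l, |x l| ^ r) := by
        gcongr
        simpa using h2
    _ = _ := by
        rw [← mul_assoc, ← Real.rpow_add hm0]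
        congr 2
        ring

theorem expect_abs_mcErr_rpow_le [Nonempty ι] (h : p ≠ ∞) (y : A → ℝ) :
    𝔼 ξ : ι → A, |mcErr y ξ| ^ p.toReal
      ≤ 8 * (2 * p.toReal) ^ p.toReal
        * ((Fintype.card ι : ℝ) ^ (-(1 - recip (min p 2)))) ^ p.toReal * 𝔼 a, |y a| ^ p.toReal := by
  have hr := one_le_toReal (p := p) h
  set r := p.toReal with hrdef
  have hr0 : 0 < r := by linarith
  set m : ℝ := (Fintype.card ι : ℝ) with hm
  have hm0 : 0 < m := by rw [hm]; exact_mod_cast Fintype.card_pos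
  set ρ := recip (min p 2)
  have h1 : ∀ ξ ξ' : ι → A, 𝔼 u : ι → Bool, |∑ l, sg (u l) * (y (ξ l) - y (ξ' l))| ^ r
      ≤ 4 * r ^ r * (m ^ (r * ρ) * 𝔼 l, |y (ξ l) - y (ξ' l)| ^ r) := fun ξ ξ' =>
    (expect_rademacher_rpow_le _ hr).trans
      (mul_le_mul_of_nonneg_left (sum_sq_rpow_le h _) (by positivity))
  have h2 : 𝔼 ξ : ι → A, 𝔼 ξ' : ι → A, 𝔼 l, |y (ξ l) - y (ξ' l)| ^ r
      ≤ 2 ^ r * (2 * 𝔼 a, |y a| ^ r) := by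
    calc 𝔼 ξ : ι → A, 𝔼 ξ' : ι → A, 𝔼 l, |y (ξ l) - y (ξ' l)| ^ r
        ≤ 𝔼 ξ : ι → A, 𝔼 ξ' : ι → A, 𝔼 l, 2 ^ r * (|y (ξ l)| ^ r + |y (ξ' l)| ^ r) := by
          refine Finset.expect_le_expect fun ξ _ => Finset.expect_le_expect fun ξ' _ =>
            Finset.expect_le_expect fun l _ => ?_
          exact (Real.rpow_le_rpow (abs_nonneg _) (abs_sub _ _) hr0.le).trans
            (add_rpow_le_two_rpow_mul (abs_nonneg _) (abs_nonneg _) hr0.le)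
      _ = 2 ^ r * (2 * 𝔼 a, |y a| ^ r) := by
          simp only [← Finset.mul_expect, Finset.expect_add_distrib, Fintype.expect_const]
          rw [Finset.expect_comm]
          simp only [expect_eval (fun a => |y a| ^ r), Fintype.expect_const]
          ring
  have h3 : ∀ ξ : ι → A, |mcErr y ξ| ^ r = m ^ (-r) * |∑ l, (y (ξ l) - 𝔼 a, y a)| ^ r := by
    intro ξ
    rw [mcErr_real, abs_neg, abs_mul, Real.mul_rpow (abs_nonneg _) (abs_nonneg _), ← hm,
      abs_of_pos (inv_pos.2 hm0), Real.inv_rpow hm0.le, Real.rpow_neg hm0.le]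
  simp only [h3]
  rw [← Finset.mul_expect]
  calc m ^ (-r) * 𝔼 ξ : ι → A, |∑ l, (y (ξ l) - 𝔼 a, y a)| ^ r
      ≤ m ^ (-r) * (4 * r ^ r * (m ^ (r * ρ) * (2 ^ r * (2 * 𝔼 a, |y a| ^ r)))) := by
        gcongr
        refine (expect_convex_le_symmetrized (convexOn_abs_rpow hr) y).trans ?_
        refine (Finset.expect_le_expect fun ξ _ => Finset.expect_le_expect fun ξ' _ =>
          h1 ξ ξ').trans ?_
        simp only [← Finset.mul_expect]
        gcongr
    _ = _ := by
        rw [← Real.rpow_mul hm0.le, Real.mul_rpow (by norm_num) hr0.le,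
          show -(1 - ρ) * r = -r + r * ρ by ring, Real.rpow_add hm0]
        ring

theorem re_mcErr {𝕜 A ι : Type*} [RCLike 𝕜] [Fintype A] [Fintype ι] (y : A → 𝕜) (ξ : ι → A) :
    RCLike.re (mcErr y ξ) = mcErr (fun a => RCLike.re (y a)) ξ := by
  have h1 : ∀ n : ℕ, (n : 𝕜)⁻¹ = (((n : ℝ)⁻¹ : ℝ) : 𝕜) := fun n => by push_cast; rfl
  simp only [mcErr, h1, map_sub, RCLike.re_ofReal_mul, map_sum]

theorem im_mcErr {𝕜 A ι : Type*} [RCLike 𝕜] [Fintype A] [Fintype ι] (y : A → 𝕜) (ξ : ι → A) :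
    RCLike.im (mcErr y ξ) = mcErr (fun a => RCLike.im (y a)) ξ := by
  have h1 : ∀ n : ℕ, (n : 𝕜)⁻¹ = (((n : ℝ)⁻¹ : ℝ) : 𝕜) := fun n => by push_cast; rfl
  simp only [mcErr, h1, map_sub, RCLike.im_ofReal_mul, map_sum]

theorem norm_le_abs_re_add_abs_im {𝕜 : Type*} [RCLike 𝕜] (z : 𝕜) :
    ‖z‖ ≤ |RCLike.re z| + |RCLike.im z| := by
  refine abs_le_of_sq_le_sq' ?_ (by positivity) |>.2
  rw [RCLike.norm_sq_eq_def]
  nlinarith [mul_nonneg (abs_nonneg (RCLike.re z)) (abs_nonneg (RCLike.im z)),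
    abs_mul_abs_self (RCLike.re z), abs_mul_abs_self (RCLike.im z)]

/-- The `p`-th moment of the error of the empirical mean. -/
theorem expect_norm_mcErr_rpow_le {𝕜 : Type*} [RCLike 𝕜] [Nonempty ι] (h : p ≠ ∞) (y : A → 𝕜) :
    𝔼 ξ : ι → A, ‖mcErr y ξ‖ ^ p.toReal
      ≤ 16 * (4 * p.toReal) ^ p.toReal
        * ((Fintype.card ι : ℝ) ^ (-(1 - recip (min p 2)))) ^ p.toReal * 𝔼 a, ‖y a‖ ^ p.toReal := by
  have hr := one_le_toReal (p := p) h
  have h1 := expect_abs_mcErr_rpow_le (ι := ι) h (fun a => RCLike.re (y a))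
  have h2 := expect_abs_mcErr_rpow_le (ι := ι) h (fun a => RCLike.im (y a))
  set r := p.toReal with hrdef
  have hr0 : 0 < r := by linarith
  set K := ((Fintype.card ι : ℝ) ^ (-(1 - recip (min p 2)))) ^ r with hK
  have hK0 : 0 ≤ K := by positivity
  have h3 : 𝔼 a, |RCLike.re (y a)| ^ r ≤ 𝔼 a, ‖y a‖ ^ r := Finset.expect_le_expect fun a _ =>
    Real.rpow_le_rpow (abs_nonneg _) (RCLike.abs_re_le_norm _) hr0.le
  have h4 : 𝔼 a, |RCLike.im (y a)| ^ r ≤ 𝔼 a, ‖y a‖ ^ r := Finset.expect_le_expect fun a _ =>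
    Real.rpow_le_rpow (abs_nonneg _) (RCLike.abs_im_le_norm _) hr0.le
  calc 𝔼 ξ : ι → A, ‖mcErr y ξ‖ ^ r
      ≤ 𝔼 ξ : ι → A, 2 ^ r * (|mcErr (fun a => RCLike.re (y a)) ξ| ^ r
          + |mcErr (fun a => RCLike.im (y a)) ξ| ^ r) := by
        refine Finset.expect_le_expect fun ξ _ => ?_
        rw [← re_mcErr, ← im_mcErr]
        exact (Real.rpow_le_rpow (norm_nonneg _) (norm_le_abs_re_add_abs_im _) hr0.le).trans
          (add_rpow_le_two_rpow_mul (abs_nonneg _) (abs_nonneg _) hr0.le)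
    _ ≤ 2 ^ r * (8 * (2 * r) ^ r * K * 𝔼 a, ‖y a‖ ^ r + 8 * (2 * r) ^ r * K * 𝔼 a, ‖y a‖ ^ r) := by
        rw [← Finset.mul_expect, Finset.expect_add_distrib]
        gcongr
        · exact h1.trans (by gcongr)
        · exact h2.trans (by gcongr)
    _ = _ := by
        rw [show (4 : ℝ) * r = 2 * (2 * r) by ring, Real.mul_rpow (x := 2) (y := 2 * r)
          (by norm_num) (by positivity)]
        ring

/-- The maximum `b ξ` of the errors of simultaneous empirical means of bounded functions grows like the
square root of the logarithm of their number. -/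
theorem expect_max_mcErr_le [Nonempty ι] {N : ℕ} (hN : 1 ≤ N) (y : Fin N → A → ℝ)
    (hy : ∀ i a, |y i a| ≤ 1) (b : (ι → A) → ℝ)
    (hb : ∀ ξ, ∃ i, b ξ = |mcErr (y i) ξ|) :
    𝔼 ξ, b ξ ≤ 4 * √(Real.logb 2 (N + 1) / Fintype.card ι) := by
  have hN1 : (1 : ℝ) ≤ N := by exact_mod_cast hN
  set m : ℝ := (Fintype.card ι : ℝ) with hm
  have hm0 : 0 < m := by rw [hm]; exact_mod_cast Fintype.card_pos
  set L : ℝ := Real.logb 2 (N + 1) with hL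
  have hL1 : 1 ≤ L := by
    rw [hL, Real.le_logb_iff_rpow_le (by norm_num) (by linarith)]
    norm_num; linarith
  have hlog : Real.log (2 * N) ≤ 2 * L := by
    have h1 : Real.log (2 * N) ≤ 2 * Real.log (N + 1) := by
      rw [← Real.log_rpow (by linarith)]
      refine Real.log_le_log (by linarith) ?_
      norm_cast
      nlinarith
    have h2 : Real.log (N + 1) ≤ L := by
      rw [hL, Real.logb, le_div_iff₀ (Real.log_pos (by norm_num))]
      nlinarith [Real.log_nonneg (show (1 : ℝ) ≤ N + 1 by linarith), Real.log_two_lt_d9]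
    linarith
  set c : ℝ := √(L / m) with hc
  have hc0 : 0 < c := Real.sqrt_pos.2 (by positivity)
  have hcc : c ^ 2 = L / m := Real.sq_sqrt (by positivity)
  let S : Fin N → (ι → A) → ℝ := fun i ξ => ∑ l, (y i (ξ l) - 𝔼 a, y i a)
  have hcosh : ∀ i, 𝔼 ξ, Real.cosh (c * S i ξ) ≤ Real.exp (2 * c ^ 2 * m) := by
    intro i
    refine (expect_convex_le_symmetrized (convexOn_cosh_mul c) (y i)).trans ?_
    refine Finset.expect_le Finset.univ_nonempty fun ξ _ =>
      Finset.expect_le Finset.univ_nonempty fun ξ' _ => ?_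
    refine (expect_cosh_rademacher_le _ c).trans (Real.exp_le_exp.2 ?_)
    have h1 : ∑ l, (y i (ξ l) - y i (ξ' l)) ^ 2 ≤ ∑ _l : ι, 4 := by
      refine Finset.sum_le_sum fun l _ => ?_
      have h2 := abs_le.1 (hy i (ξ l))
      have h3 := abs_le.1 (hy i (ξ' l))
      nlinarith
    rw [Finset.sum_const, Finset.card_univ, nsmul_eq_mul, ← hm] at h1
    nlinarith [sq_nonneg c]
  set a : ℝ := 2 * N * Real.exp (2 * c ^ 2 * m) with ha
  have ha0 : 0 < a := by positivity
  have hloga : Real.log a = Real.log (2 * N) + 2 * c ^ 2 * m := by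
    rw [ha, Real.log_mul (by positivity) (Real.exp_pos _).ne', Real.log_exp]
  -- `t ≤ log a + (e ^ t / a - 1)`, summed over all rows
  have hpt : ∀ ξ, c * m * b ξ ≤ (Real.log a - 1) + (∑ i, 2 * Real.cosh (c * S i ξ)) / a := by
    intro ξ
    obtain ⟨i, hi⟩ := hb ξ
    have h1 : c * m * b ξ = |c * S i ξ| := by
      rw [hi, mcErr_real, abs_neg, abs_mul, abs_mul, ← hm, abs_of_pos (inv_pos.2 hm0),
        abs_of_pos hc0]
      field_simp
      rfl
    have h2 := Real.add_one_le_exp (|c * S i ξ| - Real.log a)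
    rw [Real.exp_sub, Real.exp_log ha0] at h2
    have h3 : Real.exp |c * S i ξ| ≤ ∑ i, 2 * Real.cosh (c * S i ξ) := by
      refine le_trans ?_ (Finset.single_le_sum (f := fun i => 2 * Real.cosh (c * S i ξ))
        (fun j _ => by positivity) (Finset.mem_univ i))
      rw [← Real.cosh_abs, Real.cosh_eq]
      linarith [Real.exp_pos (-|c * S i ξ|)]
    have h4 : Real.exp |c * S i ξ| / a ≤ (∑ i, 2 * Real.cosh (c * S i ξ)) / a := by gcongr
    rw [h1]
    linarith
  have h1 := Finset.expect_le_expect (s := Finset.univ) fun ξ (_ : ξ ∈ Finset.univ) => hpt ξ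
  rw [← Finset.mul_expect, Finset.expect_add_distrib, Fintype.expect_const, ← Finset.expect_div,
    Finset.expect_sum_comm] at h1
  have h2 : ∑ i, 𝔼 ξ, 2 * Real.cosh (c * S i ξ) ≤ a := by
    calc ∑ i, 𝔼 ξ, 2 * Real.cosh (c * S i ξ) ≤ ∑ _i : Fin N, 2 * Real.exp (2 * c ^ 2 * m) := by
          refine Finset.sum_le_sum fun i _ => ?_
          rw [← Finset.mul_expect]
          linarith [hcosh i]
      _ = a := by simp [ha]; ring
  have h3 : (∑ i, 𝔼 ξ, 2 * Real.cosh (c * S i ξ)) / a ≤ 1 := (div_le_one ha0).2 h2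
  have h4 : c * m * 𝔼 ξ, b ξ ≤ c * m * (4 * c) := by
    have : c * m * (4 * c) = 4 * (c ^ 2 * m) := by ring
    rw [this]
    have h5 : c ^ 2 * m = L := by rw [hcc]; field_simp
    nlinarith
  exact le_of_mul_le_mul_left h4 (by positivity)

end MonteCarlo

/-! ### Non-adaptive Monte Carlo algorithms -/

section MonteCarloAlg

open IBC

variable {𝕜 : Type*} [RCLike 𝕜] {p q : ℝ≥0∞} [hp : Fact (1 ≤ p)] [hq : Fact (1 ≤ q)] {N M m n : ℕ}

/-- The same random columns are sampled in all rows. -/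
theorem eRanNon_le_of_mcErr (hN : 1 ≤ N) (hM : 1 ≤ M) (hn : N * m ≤ n) {e : ℝ}
    (h : ∀ x : Fin N × Fin M → 𝕜, meanNorm p x ≤ 1 →
      𝔼 ξ : Fin m → Fin M, meanNorm q (fun i => mcErr (fun j => x (i, j)) ξ) ≤ e) :
    eRanNon.{u} 𝕜 p q N M n ≤ ENNReal.ofReal e := by
  have : NeZero M := ⟨by omega⟩
  have hD := fun ξ : Fin m → Fin M => exists_twoStage (𝕜 := 𝕜) (p := p)
    (G := MeanLp q 𝕜 (Fin N)) hN hM (α := Fin N × Fin m)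
    (fun w => (w.1, ξ w.2)) (fun _ => Empty) (fun _ x => x.elim)
    (fun a _ => show Fin N → 𝕜 from fun i => (m : 𝕜)⁻¹ * ∑ l, a (i, l))
  choose D hD1 hD2 using hD
  refine eRanNon_le_of_finite D (fun ξ => hD1 ξ fun _ => inferInstance) (fun f ξ => ?_) fun f => ?_
  · rw [(hD2 ξ f).1]
    simp only [Fintype.card_prod, Fintype.card_fin, Fintype.card_empty, add_zero]
    exact_mod_cast hn
  · refine le_trans (Finset.expect_le_expect fun ξ _ => ?_) (h f.1 (meanNorm_input_le f))
    rw [(hD2 ξ f).2]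
    refine (norm_meanOp_sub (q := q) f (fun i => (m : 𝕜)⁻¹ * ∑ l, f.1 (i, ξ l))).trans_le
      (le_of_eq ?_)
    congr 1
    funext i
    simp [rowMean, mcErr]

/-- The constant in the `p`-th moment bound of the empirical mean. -/
def mcConst (p : ℝ≥0∞) : ℝ := (16 * (4 * p.toReal) ^ p.toReal) ^ (1 / p.toReal)

theorem mcConst_pos (h : p ≠ ∞) : 0 < mcConst p := by
  have := one_le_toReal (p := p) h
  unfold mcConst
  positivity

theorem expect_meanNorm_mcErr_le (h : p ≠ ∞) (hM : 1 ≤ M) (hm : 1 ≤ m) (x : Fin N × Fin M → 𝕜)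
    (hx : meanNorm p x ≤ 1) :
    𝔼 ξ : Fin m → Fin M, meanNorm p (fun i => mcErr (fun j => x (i, j)) ξ)
      ≤ mcConst p * (m : ℝ) ^ (-(1 - recip (min p 2))) := by
  have : NeZero M := ⟨by omega⟩
  have : NeZero m := ⟨by omega⟩
  have hr := one_le_toReal (p := p) h
  have hr0 : 0 < p.toReal := by linarith
  have hc := mcConst_pos h
  let E : (Fin m → Fin M) → ℝ := fun ξ => meanNorm p (fun i => mcErr (fun j => x (i, j)) ξ)
  have hE : ∀ ξ, ‖E ξ‖ = E ξ := fun ξ => Real.norm_of_nonneg (meanNorm_nonneg _)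
  have h1 := expect_norm_le_meanNorm (p := p) E
  simp only [hE] at h1
  refine h1.trans (meanNorm_le_of_rpow_le h (by positivity) ?_)
  simp only [hE, E, meanNorm_rpow h]
  rw [Finset.expect_comm]
  calc 𝔼 i, 𝔼 ξ : Fin m → Fin M, ‖mcErr (fun j => x (i, j)) ξ‖ ^ p.toReal
      ≤ 𝔼 i, 16 * (4 * p.toReal) ^ p.toReal
        * ((m : ℝ) ^ (-(1 - recip (min p 2)))) ^ p.toReal * 𝔼 j, ‖x (i, j)‖ ^ p.toReal := by
        refine Finset.expect_le_expect fun i _ => ?_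
        simpa using expect_norm_mcErr_rpow_le (ι := Fin m) h (fun j => x (i, j))
    _ = 16 * (4 * p.toReal) ^ p.toReal
        * ((m : ℝ) ^ (-(1 - recip (min p 2)))) ^ p.toReal * meanNorm p x ^ p.toReal := by
        rw [← Finset.mul_expect, meanNorm_rpow h, ← Finset.univ_product_univ,
          Finset.expect_product]
    _ ≤ 16 * (4 * p.toReal) ^ p.toReal
        * ((m : ℝ) ^ (-(1 - recip (min p 2)))) ^ p.toReal * 1 := by
        gcongr
        exact Real.rpow_le_one (meanNorm_nonneg _) hx hr0.le
    _ = _ := by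
        have h2 : mcConst p ^ p.toReal = 16 * (4 * p.toReal) ^ p.toReal := by
          rw [mcConst, ← Real.rpow_mul (by positivity), one_div_mul_cancel hr0.ne', Real.rpow_one]
        rw [Real.mul_rpow hc.le (by positivity), h2, mul_one]

theorem eRanNon_le_mc (h : p ≠ ∞) (hN : 1 ≤ N) (hM : 1 ≤ M) (hm : 1 ≤ m) (hn : N * m ≤ n) :
    eRanNon.{u} 𝕜 p q N M n ≤ ENNReal.ofReal (mcConst p * (N : ℝ) ^ max (recip p - recip q) 0
      * (m : ℝ) ^ (-(1 - recip (min p 2)))) := by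
  have : NeZero N := ⟨by omega⟩
  refine eRanNon_le_of_mcErr hN hM hn fun x hx => ?_
  calc 𝔼 ξ : Fin m → Fin M, meanNorm q (fun i => mcErr (fun j => x (i, j)) ξ)
      ≤ 𝔼 ξ : Fin m → Fin M, (N : ℝ) ^ max (recip p - recip q) 0
          * meanNorm p (fun i => mcErr (fun j => x (i, j)) ξ) := by
        refine Finset.expect_le_expect fun ξ _ => ?_
        simpa using meanNorm_le_card_rpow_max_mul (p := p) (q := q)
          (fun i => mcErr (fun j => x (i, j)) ξ)
    _ ≤ (N : ℝ) ^ max (recip p - recip q) 0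
          * (mcConst p * (m : ℝ) ^ (-(1 - recip (min p 2)))) := by
        rw [← Finset.mul_expect]
        gcongr
        exact expect_meanNorm_mcErr_le h hM hm x hx
    _ = _ := by ring

/-- For `p = ∞ > q` the moment bound is applied with the finite exponent `max q 2`. -/
theorem eRanNon_top_le_mc (h : q ≠ ∞) (hN : 1 ≤ N) (hM : 1 ≤ M) (hm : 1 ≤ m) (hn : N * m ≤ n) :
    eRanNon.{u} 𝕜 ∞ q N M n ≤ ENNReal.ofReal (mcConst (max q 2) * (m : ℝ) ^ (-(1 / 2) : ℝ)) := by
  have hs : Fact (1 ≤ max q 2) := ⟨le_max_of_le_left hq.out⟩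
  have hst : max q 2 ≠ ∞ := by simp [h]
  refine eRanNon_le_of_mcErr hN hM hn fun x hx => ?_
  have h1 := expect_meanNorm_mcErr_le hst hM hm x
    ((meanNorm_le_meanNorm (p := ∞) le_top x).trans hx)
  have h2 : -(1 - recip (min (max q 2) 2)) = -(1 / 2) := by
    rw [min_eq_right (le_max_right _ _)]
    simp [recip_eq]; norm_num
  rw [h2] at h1
  exact (Finset.expect_le_expect fun ξ _ => meanNorm_le_meanNorm (le_max_left q 2) _).trans h1

theorem eRanNon_top_top_le_mc (hN : 1 ≤ N) (hM : 1 ≤ M) (hm : 1 ≤ m) (hn : N * m ≤ n) :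
    eRanNon.{u} 𝕜 ∞ ∞ N M n ≤ ENNReal.ofReal (8 * √(Real.logb 2 (N + 1) / m)) := by
  have : NeZero M := ⟨by omega⟩
  have : NeZero m := ⟨by omega⟩
  have : NeZero N := ⟨by omega⟩
  refine eRanNon_le_of_mcErr hN hM hn fun x hx => ?_
  have hx1 : ∀ i j, ‖x (i, j)‖ ≤ 1 := fun i j => (norm_apply_le_meanNorm_top x _).trans hx
  have hmax : ∀ y : Fin N → Fin M → ℝ, ∀ ξ : Fin m → Fin M, ∃ i,
      meanNorm ∞ (fun i => mcErr (y i) ξ) = |mcErr (y i) ξ| := by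
    intro y ξ
    obtain ⟨i, hi⟩ := exists_eq_ciSup_of_finite (f := fun i => ‖mcErr (y i) ξ‖)
    exact ⟨i, by rw [meanNorm_top, ← hi]; rfl⟩
  have h1 := expect_max_mcErr_le (ι := Fin m) hN (fun i j => RCLike.re (x (i, j)))
    (fun i j => (RCLike.abs_re_le_norm _).trans (hx1 i j)) _ (hmax _)
  have h2 := expect_max_mcErr_le (ι := Fin m) hN (fun i j => RCLike.im (x (i, j)))
    (fun i j => (RCLike.abs_im_le_norm _).trans (hx1 i j)) _ (hmax _)
  rw [Fintype.card_fin] at h1 h2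
  calc 𝔼 ξ : Fin m → Fin M, meanNorm ∞ (fun i => mcErr (fun j => x (i, j)) ξ)
      ≤ 𝔼 ξ : Fin m → Fin M, (meanNorm ∞ (fun i => mcErr (fun j => RCLike.re (x (i, j))) ξ)
          + meanNorm ∞ (fun i => mcErr (fun j => RCLike.im (x (i, j))) ξ)) := by
        refine Finset.expect_le_expect fun ξ _ => ?_
        refine meanNorm_le_of_forall_le (add_nonneg (meanNorm_nonneg _) (meanNorm_nonneg _))
          fun i => (norm_le_abs_re_add_abs_im _).trans ?_
        rw [re_mcErr, im_mcErr]
        exact add_le_add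
          (norm_apply_le_meanNorm_top (fun i => mcErr (fun j => RCLike.re (x (i, j))) ξ) i)
          (norm_apply_le_meanNorm_top (fun i => mcErr (fun j => RCLike.im (x (i, j))) ξ) i)
    _ ≤ _ := by
        rw [Finset.expect_add_distrib]
        linarith

end MonteCarloAlg

/-! ### Medians of means -/

section MedianOfMeans

variable {A ι : Type*} [Fintype A] [Nonempty A] [Fintype ι] [DecidableEq ι]

open scoped Classical in
/-- The probability of an event under the uniform distribution. -/
def prob {Ω : Type*} [Fintype Ω] (E : Ω → Prop) : ℝ := 𝔼 ω, if E ω then 1 else 0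

theorem prob_mono {Ω : Type*} [Fintype Ω] {E F : Ω → Prop} (h : ∀ ω, E ω → F ω) :
    prob E ≤ prob F := by
  classical
  refine Finset.expect_le_expect fun ω _ => ?_
  by_cases hE : E ω
  · simp [hE, h ω hE]
  · rw [if_neg hE]; split_ifs <;> norm_num

/-- Markov's inequality. -/
theorem prob_le_of_expect_le {Ω : Type*} [Fintype Ω] {E : Ω → Prop} {Z : Ω → ℝ} {c d : ℝ}
    (hc : 0 < c) (hZ : ∀ ω, 0 ≤ Z ω) (hE : ∀ ω, E ω → c ≤ Z ω) (hd : 𝔼 ω, Z ω ≤ c * d) :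
    prob E ≤ d := by
  classical
  have h : c * prob E ≤ 𝔼 ω, Z ω := by
    rw [prob, Finset.mul_expect]
    refine Finset.expect_le_expect fun ω _ => ?_
    split_ifs with h
    · simpa using hE ω h
    · simpa using hZ ω
  exact le_of_mul_le_mul_left (h.trans hd) hc

open scoped Classical in
/-- If an event has probability at most `1 / 16`, then it is very unlikely to occur in at least half
of `ℓ` independent trials: Markov's inequality is applied to `16` to the number of occurrences. -/
theorem prob_majority_le {Θ : Type*} [Fintype Θ] [Nonempty Θ] (ℓ : ℕ) (E : Θ → Prop)
    (hE : prob E ≤ 1 / 16) :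
    prob (fun ω : Fin ℓ → Θ => ℓ ≤ 2 * (Finset.univ.filter fun t => E (ω t)).card)
      ≤ (1 / 2) ^ ℓ := by
  have h1 := expect_prod_eq (A := fun _ : Fin ℓ => Θ) (fun _ θ => if E θ then (16 : ℝ) else 1)
  have h2 : 𝔼 θ, (if E θ then (16 : ℝ) else 1) ≤ 2 := by
    have : ∀ θ, (if E θ then (16 : ℝ) else 1) = 15 * (if E θ then 1 else 0) + 1 := fun θ => by
      split_ifs <;> norm_num
    simp only [this]
    rw [Finset.expect_add_distrib, ← Finset.mul_expect, Fintype.expect_const]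
    unfold prob at hE
    linarith
  have h3 : 0 ≤ 𝔼 θ, (if E θ then (16 : ℝ) else 1) := Finset.expect_nonneg fun θ _ => by
    split_ifs <;> norm_num
  refine prob_le_of_expect_le (Z := fun ω => ∏ t, if E (ω t) then (16 : ℝ) else 1) (c := 4 ^ ℓ)
    (by positivity) (fun ω => Finset.prod_nonneg fun t _ => by split_ifs <;> norm_num)
    (fun ω hω => ?_) ?_
  · rw [Finset.prod_ite, Finset.prod_const, Finset.prod_const_one, mul_one,
      show (16 : ℝ) = 4 ^ 2 by norm_num, ← pow_mul]
    exact pow_le_pow_right₀ (by norm_num) hω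
  · rw [h1, Finset.prod_const, Finset.card_univ, Fintype.card_fin, ← mul_pow]
    refine pow_le_pow_left₀ h3 (by linarith) _

/-- The variance of a sum of independent copies. -/
theorem expect_sum_sub_sq_le_real (y : A → ℝ) (J : Finset ι) :
    𝔼 η : ι → A, (∑ l ∈ J, (y (η l) - 𝔼 a, y a)) ^ 2 ≤ J.card * 𝔼 a, y a ^ 2 := by
  induction J using Finset.induction_on with
  | empty => simp
  | insert b J hb ih =>
    set μ := 𝔼 a, y a with hμ
    rw [← expect_update _ b]
    have hsum : ∀ (η : ι → A) a, ∑ l ∈ J, (y (Function.update η b a l) - μ)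
        = ∑ l ∈ J, (y (η l) - μ) := fun η a => Finset.sum_congr rfl fun l hl => by
      rw [Function.update_of_ne (by rintro rfl; exact hb hl)]
    have h0 : 𝔼 a, (y a - μ) = 0 := by
      rw [Finset.expect_sub_distrib, Fintype.expect_const, hμ, sub_self]
    have h1 : 𝔼 a, (y a - μ) ^ 2 ≤ 𝔼 a, y a ^ 2 := by
      have : ∀ a, (y a - μ) ^ 2 = y a ^ 2 - 2 * μ * y a + μ ^ 2 := fun a => by ring
      simp only [this]
      rw [Finset.expect_add_distrib, Finset.expect_sub_distrib, Fintype.expect_const,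
        ← Finset.mul_expect, ← hμ]
      nlinarith [sq_nonneg μ]
    have h2 : ∀ η : ι → A, 𝔼 a, (∑ l ∈ insert b J, (y (Function.update η b a l) - μ)) ^ 2
        = (∑ l ∈ J, (y (η l) - μ)) ^ 2 + 𝔼 a, (y a - μ) ^ 2 := fun η => by
      simp only [Finset.sum_insert hb, hsum, Function.update_self]
      set T := ∑ l ∈ J, (y (η l) - μ)
      have : ∀ a, (y a - μ + T) ^ 2 = T ^ 2 + 2 * T * (y a - μ) + (y a - μ) ^ 2 := fun a => by ring
      simp only [this]
      rw [Finset.expect_add_distrib, Finset.expect_add_distrib, Fintype.expect_const,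
        ← Finset.mul_expect, h0]
      ring
    simp only [h2]
    rw [Finset.expect_add_distrib, Fintype.expect_const, Finset.card_insert_of_notMem hb]
    push_cast
    linarith

variable {𝕜 : Type*} [RCLike 𝕜]

/-- The mean of a function on a finite type. -/
def avg (y : A → 𝕜) : 𝕜 := (Fintype.card A : 𝕜)⁻¹ * ∑ a, y a

/-- The variance of a sum of independent copies, for scalars in `𝕜`. -/
theorem expect_norm_sum_sub_sq_le (y : A → 𝕜) (J : Finset ι) :
    𝔼 η : ι → A, ‖∑ l ∈ J, (y (η l) - avg y)‖ ^ 2 ≤ J.card * 𝔼 a, ‖y a‖ ^ 2 := by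
  have hk : ∀ k : ℕ, (k : 𝕜)⁻¹ = (((k : ℝ)⁻¹ : ℝ) : 𝕜) := fun k => by push_cast; rfl
  have hre : RCLike.re (avg y) = 𝔼 a, RCLike.re (y a) := by
    rw [avg, hk, RCLike.re_ofReal_mul, map_sum, Fintype.expect_eq_sum_div_card, div_eq_inv_mul]
  have him : RCLike.im (avg y) = 𝔼 a, RCLike.im (y a) := by
    rw [avg, hk, RCLike.im_ofReal_mul, map_sum, Fintype.expect_eq_sum_div_card, div_eq_inv_mul]
  have h1 := expect_sum_sub_sq_le_real (fun a => RCLike.re (y a)) J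
  have h2 := expect_sum_sub_sq_le_real (fun a => RCLike.im (y a)) J
  have h3 : ∀ z : 𝕜, ‖z‖ ^ 2 = RCLike.re z ^ 2 + RCLike.im z ^ 2 := fun z => by
    rw [RCLike.norm_sq_eq_def]; ring
  simp only [h3, map_sum, map_sub, hre, him]
  rw [Finset.expect_add_distrib, Finset.expect_add_distrib, mul_add]
  linarith

/-- Chebyshev's inequality for the mean over the sample points with index in `J`. -/
theorem prob_mean_sub_avg_le (y : A → 𝕜) (J : Finset ι) (hJ : J.Nonempty) :
    prob (fun η : ι → A => 4 * √(𝔼 a, ‖y a‖ ^ 2) / √(J.card : ℝ)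
      < ‖(J.card : 𝕜)⁻¹ * ∑ l ∈ J, y (η l) - avg y‖) ≤ 1 / 16 := by
  have hJ0 : (0 : ℝ) < J.card := by exact_mod_cast hJ.card_pos
  have hJk : (J.card : 𝕜) ≠ 0 := by exact_mod_cast hJ.card_pos.ne'
  set v : ℝ := 𝔼 a, ‖y a‖ ^ 2 with hv
  have hv0 : 0 ≤ v := Finset.expect_nonneg fun a _ => by positivity
  have hform : ∀ η : ι → A, ‖∑ l ∈ J, (y (η l) - avg y)‖
      = J.card * ‖(J.card : 𝕜)⁻¹ * ∑ l ∈ J, y (η l) - avg y‖ := by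
    intro η
    have : ∑ l ∈ J, (y (η l) - avg y)
        = (J.card : 𝕜) * ((J.card : 𝕜)⁻¹ * ∑ l ∈ J, y (η l) - avg y) := by
      rw [Finset.sum_sub_distrib, Finset.sum_const, nsmul_eq_mul, mul_sub, ← mul_assoc,
        mul_inv_cancel₀ hJk, one_mul]
    rw [this, norm_mul, RCLike.norm_natCast]
  have hexp := expect_norm_sum_sub_sq_le (ι := ι) y J
  rcases hv0.eq_or_lt with h0 | h0
  · -- all values vanish, and the event is empty
    have hy : ∀ a, y a = 0 := fun a => by
      have h1 : ∑ a, ‖y a‖ ^ 2 = 0 := by rw [← Fintype.card_mul_expect, ← hv, ← h0, mul_zero]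
      have h2 := (Finset.sum_eq_zero_iff_of_nonneg fun a _ => by positivity).1 h1 a
        (Finset.mem_univ a)
      simpa using h2
    have : prob (fun η : ι → A => 4 * √v / √(J.card : ℝ)
        < ‖(J.card : 𝕜)⁻¹ * ∑ l ∈ J, y (η l) - avg y‖) = 0 := by
      simp [prob, hy, avg, ← h0]
    rw [this]; norm_num
  · refine prob_le_of_expect_le (c := 16 * (J.card * v))
      (Z := fun η => ‖∑ l ∈ J, (y (η l) - avg y)‖ ^ 2) (by positivity) (fun η => by positivity)
      (fun η hη => ?_) (by linarith)
    rw [hform, mul_pow]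
    have h1 := pow_le_pow_left₀ (by positivity) hη.le 2
    rw [div_pow, mul_pow, Real.sq_sqrt hv0, Real.sq_sqrt hJ0.le, div_le_iff₀ hJ0] at h1
    nlinarith

/-- The pilot estimate of a second moment is unlikely to be too small, provided that the second
moment is large compared with the `p`-th moment. The proof truncates at the level `T`. -/
theorem prob_pilot_group_le {m : ℕ} (hm : 1 ≤ m) {p : ℝ≥0∞} [Fact (1 ≤ p)] (hp2 : 2 < p)
    (hp' : p ≠ ∞) (y : A → 𝕜) {v : ℝ} (hv : v = 𝔼 a, ‖y a‖ ^ 2) (hv0 : 0 < v)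
    (h : 16 * meanNorm p y * (m : ℝ) ^ (-(1 / 2 - recip p)) ≤ √v) :
    prob (fun θ : Fin m → A => 𝔼 l, ‖y (θ l)‖ ^ 2 < v / 4) ≤ 1 / 16 := by
  have : NeZero m := ⟨by omega⟩
  have hm0 : (0 : ℝ) < m := by exact_mod_cast hm
  have hr : 2 < p.toReal := by
    simpa using (ENNReal.toReal_lt_toReal (by norm_num) hp').2 hp2
  set r := p.toReal with hrdef
  set s : ℝ := √v with hs
  have hs0 : 0 < s := Real.sqrt_pos.2 hv0
  have hsv : s ^ 2 = v := Real.sq_sqrt hv0.le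
  set τ : ℝ := √m * s / 16 with hτ
  have hτ0 : 0 < τ := by positivity
  have hτ2 : τ ^ 2 = m * v / 256 := by
    rw [hτ, div_pow, mul_pow, Real.sq_sqrt hm0.le, hsv]; norm_num
  -- the contribution of the large values to the second moment
  have htail : 𝔼 a, (if ‖y a‖ ≤ τ then 0 else ‖y a‖ ^ 2) ≤ v / 2 := by
    have h1 : ∀ a, (if ‖y a‖ ≤ τ then 0 else ‖y a‖ ^ 2) ≤ τ ^ (2 - r) * ‖y a‖ ^ r := by
      intro a
      split_ifs with ha
      · positivity
      · push Not at ha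
        have hy0 : 0 < ‖y a‖ := hτ0.trans ha
        have h2 : ‖y a‖ ^ 2 = ‖y a‖ ^ (2 - r) * ‖y a‖ ^ r := by
          rw [← Real.rpow_add hy0, sub_add_cancel, Real.rpow_two]
        rw [h2]
        gcongr ?_ * _
        exact Real.rpow_le_rpow_of_nonpos hτ0 ha.le (by linarith)
    have h3 : 𝔼 a, ‖y a‖ ^ r ≤ s ^ r * (m : ℝ) ^ (r / 2 - 1) / 16 ^ r := by
      rw [← meanNorm_rpow hp']
      have h4 : meanNorm p y ≤ s * (m : ℝ) ^ (1 / 2 - recip p) / 16 := by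
        rw [Real.rpow_neg hm0.le, ← div_eq_mul_inv, div_le_iff₀ (by positivity)] at h
        linarith
      refine (Real.rpow_le_rpow (meanNorm_nonneg _) h4 (by linarith)).trans (le_of_eq ?_)
      rw [Real.div_rpow (by positivity) (by norm_num), Real.mul_rpow hs0.le (by positivity),
        ← Real.rpow_mul hm0.le]
      congr 3
      rw [recip_eq, ← hrdef]
      field_simp
    calc 𝔼 a, (if ‖y a‖ ≤ τ then 0 else ‖y a‖ ^ 2) ≤ 𝔼 a, τ ^ (2 - r) * ‖y a‖ ^ r :=
          Finset.expect_le_expect fun a _ => h1 a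
      _ ≤ τ ^ (2 - r) * (s ^ r * (m : ℝ) ^ (r / 2 - 1) / 16 ^ r) := by
          rw [← Finset.mul_expect]; gcongr
      _ = v / 256 := by
          rw [hτ, Real.div_rpow (by positivity) (by norm_num), Real.mul_rpow (by positivity) hs0.le,
            Real.sqrt_eq_rpow, ← Real.rpow_mul hm0.le, ← hsv]
          have e1 : (m : ℝ) ^ (1 / 2 * (2 - r)) * (m : ℝ) ^ (r / 2 - 1) = 1 := by
            rw [← Real.rpow_add hm0, show 1 / 2 * (2 - r) + (r / 2 - 1) = 0 by ring, Real.rpow_zero]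
          have e2 : s ^ (2 - r) * s ^ r = s ^ 2 := by
            rw [← Real.rpow_add hs0, sub_add_cancel, Real.rpow_two]
          have e3 : (16 : ℝ) ^ (2 - r) * 16 ^ r = 256 := by
            rw [← Real.rpow_add (by norm_num), sub_add_cancel, Real.rpow_two]; norm_num
          calc (m : ℝ) ^ (1 / 2 * (2 - r)) * s ^ (2 - r) / 16 ^ (2 - r)
                * (s ^ r * (m : ℝ) ^ (r / 2 - 1) / 16 ^ r)
              = ((m : ℝ) ^ (1 / 2 * (2 - r)) * (m : ℝ) ^ (r / 2 - 1)) * (s ^ (2 - r) * s ^ r)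
                / ((16 : ℝ) ^ (2 - r) * 16 ^ r) := by ring
            _ = _ := by rw [e1, e2, e3, one_mul]
      _ ≤ v / 2 := by linarith
  let z : A → ℝ := fun a => if ‖y a‖ ≤ τ then ‖y a‖ ^ 2 else 0
  have hz : ∀ a, z a ≤ ‖y a‖ ^ 2 := fun a => by
    simp only [z]; split_ifs
    · exact le_rfl
    · positivity
  have hzmean : v / 2 ≤ 𝔼 a, z a := by
    have h1 : 𝔼 a, ‖y a‖ ^ 2 = 𝔼 a, z a + 𝔼 a, (if ‖y a‖ ≤ τ then 0 else ‖y a‖ ^ 2) := by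
      rw [← Finset.expect_add_distrib]
      refine Finset.expect_congr rfl fun a _ => ?_
      simp only [z]; split_ifs <;> simp
    rw [← hv] at h1
    linarith
  have hzsq : 𝔼 a, z a ^ 2 ≤ τ ^ 2 * v := by
    rw [hv, Finset.mul_expect]
    refine Finset.expect_le_expect fun a _ => ?_
    simp only [z]; split_ifs with ha
    · have : ‖y a‖ ^ 2 ≤ τ ^ 2 := pow_le_pow_left₀ (norm_nonneg _) ha 2
      nlinarith [sq_nonneg ‖y a‖]
    · simp; positivity
  have hvar := expect_sum_sub_sq_le_real (ι := Fin m) z Finset.univ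
  rw [Finset.card_univ, Fintype.card_fin] at hvar
  refine prob_le_of_expect_le (c := (m * (v / 4)) ^ 2)
    (Z := fun θ => (∑ l, (z (θ l) - 𝔼 a, z a)) ^ 2) (by positivity) (fun θ => by positivity)
    (fun θ hθ => ?_) ?_
  · rw [Finset.sum_sub_distrib, Finset.sum_const, Finset.card_univ, Fintype.card_fin, nsmul_eq_mul]
    have h1 : ∑ l, z (θ l) ≤ m * (v / 4) := by
      refine (Finset.sum_le_sum fun l _ => hz (θ l)).trans ?_
      rw [Fintype.expect_eq_sum_div_card, Fintype.card_fin, div_lt_iff₀ hm0] at hθ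
      linarith
    have h2 : m * (v / 2) ≤ m * 𝔼 a, z a := by gcongr
    have h3 : m * (v / 4) ≤ m * 𝔼 a, z a - ∑ l, z (θ l) := by linarith
    have h4 := pow_le_pow_left₀ (by positivity) h3 2
    linarith [show (m * 𝔼 a, z a - ∑ l, z (θ l)) ^ 2 = (∑ l, z (θ l) - m * 𝔼 a, z a) ^ 2 by ring]
  · calc 𝔼 θ : Fin m → A, (∑ l, (z (θ l) - 𝔼 a, z a)) ^ 2 ≤ m * (τ ^ 2 * v) :=
          hvar.trans (by gcongr)
      _ = _ := by rw [hτ2]; ring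

/-- The pilot estimate of a second moment from the sampled values `a`. -/
def pilot {ℓ m : ℕ} (a : Fin ℓ × Fin m → 𝕜) : ℝ := 𝔼 w, ‖a w‖ ^ 2

/-- If at least half of the `ℓ` groups estimate the second moment by `v / 4` or more, then their average
is at least `v / 8`. -/
theorem prob_pilot_le {ℓ m : ℕ} (hm : 1 ≤ m) {p : ℝ≥0∞} [Fact (1 ≤ p)] (hp2 : 2 < p)
    (hp' : p ≠ ∞) (y : A → 𝕜) {v : ℝ} (hv : v = 𝔼 a, ‖y a‖ ^ 2)
    (h : 16 * meanNorm p y * (m : ℝ) ^ (-(1 / 2 - recip p)) ≤ √v) :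
    prob (fun ξ : Fin ℓ → Fin m → A => pilot (fun w : Fin ℓ × Fin m => y (ξ w.1 w.2)) < v / 8)
      ≤ (1 / 2) ^ ℓ := by
  classical
  have hv0 : 0 ≤ v := by rw [hv]; exact Finset.expect_nonneg fun a _ => by positivity
  rcases hv0.eq_or_lt with h0 | h0
  · have : prob (fun ξ : Fin ℓ → Fin m → A =>
        pilot (fun w : Fin ℓ × Fin m => y (ξ w.1 w.2)) < v / 8) = 0 := by
      refine Finset.expect_eq_zero fun ξ _ => ?_
      rw [if_neg]
      rw [← h0, zero_div, not_lt]
      exact Finset.expect_nonneg fun w _ => by positivity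
    rw [this]; positivity
  refine le_trans (prob_mono fun ξ hξ => ?_)
    (prob_majority_le ℓ _ (prob_pilot_group_le hm hp2 hp' y hv h0 h))
  by_contra hlt
  push Not at hlt
  refine absurd hξ (not_lt.2 ?_)
  rcases Nat.eq_zero_or_pos ℓ with rfl | hℓ
  · omega
  have hℓ0 : (0 : ℝ) < ℓ := by exact_mod_cast hℓ
  rw [pilot, ← Finset.univ_product_univ, Finset.expect_product, Fintype.expect_eq_sum_div_card,
    le_div_iff₀ (by simpa using hℓ0), Fintype.card_fin]
  set G := Finset.univ.filter fun t => ¬ 𝔼 l, ‖y (ξ t l)‖ ^ 2 < v / 4 with hG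
  have hcard : ℓ ≤ 2 * G.card := by
    have h1 := Finset.card_filter_add_card_filter_not (s := (Finset.univ : Finset (Fin ℓ)))
      (fun t => 𝔼 l, ‖y (ξ t l)‖ ^ 2 < v / 4)
    rw [Finset.card_univ, Fintype.card_fin] at h1
    have h2 : 2 * (Finset.univ.filter fun t => 𝔼 l, ‖y (ξ t l)‖ ^ 2 < v / 4).card < ℓ := by
      convert hlt
    have h3 : G.card = (Finset.univ.filter fun t => ¬ 𝔼 l, ‖y (ξ t l)‖ ^ 2 < v / 4).card := by
      rw [hG]
    omega
  have hcard' : (ℓ : ℝ) ≤ 2 * G.card := by exact_mod_cast hcard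
  calc v / 8 * ℓ ≤ G.card * (v / 4) := by nlinarith
    _ = ∑ _t ∈ G, v / 4 := by rw [Finset.sum_const, nsmul_eq_mul]
    _ ≤ ∑ t ∈ G, 𝔼 l, ‖y (ξ t l)‖ ^ 2 :=
        Finset.sum_le_sum fun t ht => not_lt.1 (Finset.mem_filter.1 ht).2
    _ ≤ _ := Finset.sum_le_sum_of_subset_of_nonneg (Finset.filter_subset _ _)
        fun t _ _ => Finset.expect_nonneg fun l _ => by positivity

/-- A median of finitely many points: it is close to every point that is close to more than half of
them. -/
theorem exists_median {ℓ : ℕ} (hℓ : 1 ≤ ℓ) (z : Fin ℓ → 𝕜) :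
    ∃ t, ∀ (c : 𝕜) (ρ : ℝ), ℓ < 2 * (Finset.univ.filter fun l => ‖z l - c‖ ≤ ρ).card →
      ‖z t - c‖ ≤ 3 * ρ := by
  classical
  have : NeZero ℓ := ⟨by omega⟩
  -- the pairs of a centre and a point such that the closed ball around the centre through the point
  -- contains a majority; the median is the centre of a smallest such ball
  let P : Finset (Fin ℓ × Fin ℓ) := Finset.univ.filter fun w =>
    ℓ < 2 * (Finset.univ.filter fun l => ‖z l - z w.1‖ ≤ ‖z w.2 - z w.1‖).card
  have hP : ∀ (W : Finset (Fin ℓ)), ℓ < 2 * W.card → ∀ t, ∃ t' ∈ W, (t, t') ∈ P := by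
    intro W hW t
    have hne : W.Nonempty := Finset.card_pos.1 (by omega)
    obtain ⟨t', ht', hmax⟩ := W.exists_max_image (fun l => ‖z l - z t‖) hne
    refine ⟨t', ht', Finset.mem_filter.2 ⟨Finset.mem_univ _, ?_⟩⟩
    have : W.card ≤ (Finset.univ.filter fun l => ‖z l - z t‖ ≤ ‖z t' - z t‖).card :=
      Finset.card_le_card fun l hl => Finset.mem_filter.2 ⟨Finset.mem_univ _, hmax l hl⟩
    simp only
    omega
  obtain ⟨t₁, -, ht₁⟩ := hP Finset.univ (by rw [Finset.card_univ, Fintype.card_fin]; omega) 0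
  obtain ⟨⟨t, t'⟩, htP, hmin⟩ := P.exists_min_image (fun w => ‖z w.2 - z w.1‖) ⟨_, ht₁⟩
  refine ⟨t, fun c ρ hc => ?_⟩
  set W := Finset.univ.filter fun l => ‖z l - c‖ ≤ ρ with hW
  have hWmem : ∀ l ∈ W, ‖z l - c‖ ≤ ρ := fun l hl => (Finset.mem_filter.1 hl).2
  obtain ⟨s, hs⟩ : W.Nonempty := Finset.card_pos.1 (by omega)
  obtain ⟨s', hs', hsP⟩ := hP W hc s
  have h1 : ‖z t' - z t‖ ≤ 2 * ρ := by
    refine (hmin _ hsP).trans ?_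
    have := norm_sub_le (z s' - c) (z s - c)
    rw [sub_sub_sub_cancel_right] at this
    exact this.trans (by linarith [hWmem s hs, hWmem s' hs'])
  set V := Finset.univ.filter fun l => ‖z l - z t‖ ≤ ‖z t' - z t‖ with hV
  have hVc : ℓ < 2 * V.card := (Finset.mem_filter.1 htP).2
  -- two majorities intersect
  obtain ⟨l, hl⟩ : (V ∩ W).Nonempty := by
    refine Finset.card_pos.1 ?_
    have h2 := Finset.card_union_add_card_inter V W
    have h3 := Finset.card_le_univ (V ∪ W)
    rw [Fintype.card_fin] at h3
    omega
  have h2 : ‖z l - z t‖ ≤ ‖z t' - z t‖ := (Finset.mem_filter.1 (Finset.mem_inter.1 hl).1).2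
  have h3 := hWmem l (Finset.mem_inter.1 hl).2
  have h4 := norm_sub_le (z l - c) (z l - z t)
  rw [sub_sub_sub_cancel_left] at h4
  linarith

/-- The index of a median in the sense of `exists_median`. -/
def medianIdx {ℓ : ℕ} (hℓ : 1 ≤ ℓ) (z : Fin ℓ → 𝕜) : Fin ℓ := (exists_median hℓ z).choose

/-- The median of the means of `ℓ` independent groups of samples deviates from the mean by more than
a constant multiple of the standard deviation with exponentially small probability. -/
theorem prob_median_le {ℓ : ℕ} (hℓ : 1 ≤ ℓ) (y : A → 𝕜) (J : Finset ι) (hJ : J.Nonempty) :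
    prob (fun η : Fin ℓ → ι → A => 12 * √(𝔼 a, ‖y a‖ ^ 2) / √(J.card : ℝ)
      < ‖(fun t => (J.card : 𝕜)⁻¹ * ∑ l ∈ J, y (η t l))
        (medianIdx hℓ fun t => (J.card : 𝕜)⁻¹ * ∑ l ∈ J, y (η t l)) - avg y‖) ≤ (1 / 2) ^ ℓ := by
  classical
  refine le_trans (prob_mono fun η hη => ?_) (prob_majority_le ℓ _ (prob_mean_sub_avg_le y J hJ))
  by_contra hlt
  push Not at hlt
  refine absurd hη (not_lt.2 ?_)
  set z : Fin ℓ → 𝕜 := fun t => (J.card : 𝕜)⁻¹ * ∑ l ∈ J, y (η t l) with hz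
  set ρ := 4 * √(𝔼 a, ‖y a‖ ^ 2) / √(J.card : ℝ) with hρ
  have hc := Finset.card_filter_add_card_filter_not (s := (Finset.univ : Finset (Fin ℓ)))
    (fun t => ρ < ‖z t - avg y‖)
  rw [Finset.card_univ, Fintype.card_fin] at hc
  simp only [not_lt] at hc
  have hlt' : 2 * (Finset.univ.filter fun t => ρ < ‖z t - avg y‖).card < ℓ := by
    convert hlt
  have := (exists_median hℓ z).choose_spec (avg y) ρ (by omega)
  refine this.trans (le_of_eq ?_)
  rw [hρ]; ring

end MedianOfMeans

/-! ### The adaptive algorithm -/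

section Adaptive

variable {𝕜 : Type*} [RCLike 𝕜]

theorem prob_or_le {Ξ H : Type*} [Fintype Ξ] [Nonempty Ξ] [Fintype H] [Nonempty H]
    (F : Ξ → Prop) (G : Ξ → H → Prop) {a b : ℝ} (hF : prob F ≤ a) (hG : ∀ ξ, prob (G ξ) ≤ b) :
    prob (fun ω : Ξ × H => F ω.1 ∨ G ω.1 ω.2) ≤ a + b := by
  classical
  calc prob (fun ω : Ξ × H => F ω.1 ∨ G ω.1 ω.2)
      ≤ 𝔼 ω : Ξ × H, ((if F ω.1 then (1 : ℝ) else 0) + if G ω.1 ω.2 then (1 : ℝ) else 0) := by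
        refine Finset.expect_le_expect fun ω _ => ?_
        by_cases h1 : F ω.1 <;> by_cases h2 : G ω.1 ω.2 <;> simp [h1, h2]
    _ = 𝔼 ξ : Ξ, ((if F ξ then (1 : ℝ) else 0) + prob (G ξ)) := by
        rw [← Finset.univ_product_univ, Finset.expect_product]
        refine Finset.expect_congr rfl fun ξ _ => ?_
        change 𝔼 η : H, ((if F ξ then (1 : ℝ) else 0) + if G ξ η then (1 : ℝ) else 0) = _
        rw [Finset.expect_add_distrib, Finset.expect_const Finset.univ_nonempty]
        congr 1
    _ ≤ 𝔼 ξ : Ξ, ((if F ξ then (1 : ℝ) else 0) + b) :=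
        Finset.expect_le_expect fun ξ _ => by linarith [hG ξ]
    _ = prob F + b := by
        rw [Finset.expect_add_distrib, Fintype.expect_const]
        congr 1
    _ ≤ a + b := by linarith

theorem prob_exists_le {Ω I : Type*} [Fintype Ω] [Fintype I] (E : I → Ω → Prop) {b : ℝ}
    (h : ∀ i, prob (E i) ≤ b) : prob (fun ω => ∃ i, E i ω) ≤ Fintype.card I * b := by
  classical
  calc prob (fun ω => ∃ i, E i ω) ≤ 𝔼 ω, ∑ i, (if E i ω then (1 : ℝ) else 0) := by
        refine Finset.expect_le_expect fun ω _ => ?_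
        have h0 : ∀ i ∈ Finset.univ, 0 ≤ (if E i ω then (1 : ℝ) else 0) := fun i _ => by
          split_ifs <;> norm_num
        split_ifs with hω
        · obtain ⟨i, hi⟩ := hω
          refine le_trans ?_ (Finset.single_le_sum h0 (Finset.mem_univ i))
          simp [hi]
        · exact Finset.sum_nonneg h0
    _ = ∑ i, prob (E i) := by
        rw [Finset.expect_sum_comm]
        refine Finset.sum_congr rfl fun i _ => ?_
        unfold prob
        congr!
    _ ≤ _ := by
        refine (Finset.sum_le_sum fun i _ => h i).trans (le_of_eq ?_)
        rw [Finset.sum_const, Finset.card_univ, nsmul_eq_mul]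

section Row

variable {A : Type*} [Fintype A] {ℓ m R : ℕ}

/-- The median of the means of the `ℓ` groups of values `b t l`, `l ∈ J`. -/
def medianOfMeans {ι : Type*} (hℓ : 1 ≤ ℓ) (J : Finset ι) (b : Fin ℓ → J → 𝕜) : 𝕜 :=
  (fun t => (J.card : 𝕜)⁻¹ * ∑ l, b t l) (medianIdx hℓ fun t => (J.card : 𝕜)⁻¹ * ∑ l, b t l)

theorem medianOfMeans_coe {ι : Type*} (hℓ : 1 ≤ ℓ) (J : Finset ι) (b : Fin ℓ → ι → 𝕜) :
    medianOfMeans hℓ J (fun t l => b t l) = (fun t => (J.card : 𝕜)⁻¹ * ∑ l ∈ J, b t l)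
      (medianIdx hℓ fun t => (J.card : 𝕜)⁻¹ * ∑ l ∈ J, b t l) := by
  have : (fun t => (J.card : 𝕜)⁻¹ * ∑ l : J, b t l) = fun t => (J.card : 𝕜)⁻¹ * ∑ l ∈ J, b t l :=
    funext fun t => by rw [Finset.sum_coe_sort J (b t)]
  rw [medianOfMeans, this]

theorem norm_inv_card_mul_sum_le {ι : Type*} (J : Finset ι) (b : ι → 𝕜) {K : ℝ} (hK : 0 ≤ K)
    (hb : ∀ l, ‖b l‖ ≤ K) : ‖(J.card : 𝕜)⁻¹ * ∑ l ∈ J, b l‖ ≤ K := by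
  rw [norm_mul, norm_inv, RCLike.norm_natCast]
  rcases J.eq_empty_or_nonempty with rfl | hJ
  · simpa using hK
  have hJ0 : (0 : ℝ) < J.card := by exact_mod_cast hJ.card_pos
  rw [inv_mul_le_iff₀ hJ0]
  refine (norm_sum_le _ _).trans ((Finset.sum_le_sum fun l _ => hb l).trans (le_of_eq ?_))
  rw [Finset.sum_const, nsmul_eq_mul]

/-- The indices of the samples that are used in each group, when the pilot estimate of the second
moment is `s`. -/
def sampleIdx (m R : ℕ) (s : ℝ) : Finset (Fin (m * R)) :=
  Finset.univ.filter fun l => (l : ℕ) < m * (1 + ⌈s⌉₊)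

theorem card_sampleIdx (m R : ℕ) (s : ℝ) :
    (sampleIdx m R s).card = min (m * R) (m * (1 + ⌈s⌉₊)) := by
  rw [sampleIdx, Fin.card_filter_val_lt]

theorem le_card_sampleIdx (hR : 1 ≤ R) (s : ℝ) : m ≤ (sampleIdx m R s).card := by
  rw [card_sampleIdx, le_min_iff]
  exact ⟨Nat.le_mul_of_pos_right _ hR, Nat.le_mul_of_pos_right _ (by omega)⟩

theorem mul_le_card_sampleIdx {s w : ℝ} (hws : w ≤ s) (hwR : w ≤ R) :
    m * w ≤ (sampleIdx m R s).card := by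
  rw [card_sampleIdx]
  push_cast
  rw [le_min_iff]
  constructor
  · gcongr
  · have := Nat.le_ceil s
    gcongr
    linarith

theorem card_sampleIdx_le {s : ℝ} (hs : 0 ≤ s) : ((sampleIdx m R s).card : ℝ) ≤ m * (2 + s) := by
  have h1 : (sampleIdx m R s).card ≤ m * (1 + ⌈s⌉₊) := by
    rw [card_sampleIdx]; exact min_le_right _ _
  have h2 : ((sampleIdx m R s).card : ℝ) ≤ m * (1 + ⌈s⌉₊) := by exact_mod_cast h1
  have h3 := (Nat.ceil_lt_add_one hs).le
  exact h2.trans (mul_le_mul_of_nonneg_left (by linarith) (Nat.cast_nonneg _))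

/-- The estimator of a row mean: the pilot sample `ξ` determines how many of the samples `η` are
used. -/
def rowEst (hℓ : 1 ≤ ℓ) (y : A → 𝕜) (ω : (Fin ℓ → Fin m → A) × (Fin ℓ → Fin (m * R) → A)) : 𝕜 :=
  medianOfMeans hℓ (sampleIdx m R (pilot fun w : Fin ℓ × Fin m => y (ω.1 w.1 w.2)))
    fun t l => y (ω.2 t l)

/-- The first term bounds the error when the sample size is adapted to the second moment `v` of the row.
The second term bounds it when `v` is too small in comparison with the `p`-th moment for the pilot
sample to be reliable; then the guaranteed `m` samples per group suffice. -/
theorem prob_rowEst_le [Nonempty A] (hℓ : 1 ≤ ℓ) (hm : 1 ≤ m) (hR : 1 ≤ R) {p : ℝ≥0∞} [Fact (1 ≤ p)]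
    (hp2 : 2 < p) (hp' : p ≠ ∞) (y : A → 𝕜) (hv : 𝔼 a, ‖y a‖ ^ 2 ≤ R) :
    prob (fun ω : (Fin ℓ → Fin m → A) × (Fin ℓ → Fin (m * R) → A) =>
      36 * (m : ℝ) ^ (-(1 / 2) : ℝ) + 192 * (m : ℝ) ^ (-(1 - recip p)) * meanNorm p y
        < ‖rowEst hℓ y ω - avg y‖) ≤ 2 * (1 / 2) ^ ℓ := by
  classical
  set v : ℝ := 𝔼 a, ‖y a‖ ^ 2 with hvdef
  have hv0 : 0 ≤ v := Finset.expect_nonneg fun a _ => by positivity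
  have hm0 : (0 : ℝ) < m := by exact_mod_cast hm
  have hme : (0 : ℝ) < (m : ℝ) ^ (-(1 / 2) : ℝ) := by positivity
  have hsm : (√(m : ℝ))⁻¹ = (m : ℝ) ^ (-(1 / 2) : ℝ) := by
    rw [Real.sqrt_eq_rpow, ← Real.rpow_neg hm0.le]
  have hy0 : 0 ≤ meanNorm p y := meanNorm_nonneg y
  have : NeZero m := ⟨by omega⟩
  have : NeZero R := ⟨by omega⟩
  set J : (Fin ℓ → Fin m → A) → Finset (Fin (m * R)) := fun ξ =>
    sampleIdx m R (pilot fun w : Fin ℓ × Fin m => y (ξ w.1 w.2)) with hJ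
  have hJm : ∀ ξ, m ≤ (J ξ).card := fun ξ => le_card_sampleIdx hR _
  have hF : prob (fun ξ : Fin ℓ → Fin m → A =>
      16 * meanNorm p y * (m : ℝ) ^ (-(1 / 2 - recip p)) ≤ √v ∧
        pilot (fun w : Fin ℓ × Fin m => y (ξ w.1 w.2)) < v / 8) ≤ (1 / 2) ^ ℓ := by
    by_cases h : 16 * meanNorm p y * (m : ℝ) ^ (-(1 / 2 - recip p)) ≤ √v
    · exact (prob_mono fun ξ hξ => hξ.2).trans (prob_pilot_le hm hp2 hp' y hvdef h)
    · have : prob (fun ξ : Fin ℓ → Fin m → A =>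
          16 * meanNorm p y * (m : ℝ) ^ (-(1 / 2 - recip p)) ≤ √v ∧
            pilot (fun w : Fin ℓ × Fin m => y (ξ w.1 w.2)) < v / 8) = 0 :=
        Finset.expect_eq_zero fun ξ _ => by rw [if_neg fun h' => h h'.1]
      rw [this]; positivity
  have hG := fun ξ : Fin ℓ → Fin m → A => prob_median_le hℓ y (J ξ)
    (Finset.card_pos.1 (hm.trans (hJm ξ)))
  refine le_trans (prob_mono fun ω hω => ?_) ((prob_or_le _ _ hF hG).trans_eq (by ring))
  rw [or_iff_not_imp_left]
  intro hnot
  rw [rowEst, medianOfMeans_coe hℓ _ fun t l => y (ω.2 t l)] at hω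
  refine lt_of_le_of_lt ?_ hω
  rw [← hvdef]
  have hJ0 : (0 : ℝ) < (J ω.1).card := by exact_mod_cast hm.trans (hJm ω.1)
  by_cases h : 16 * meanNorm p y * (m : ℝ) ^ (-(1 / 2 - recip p)) ≤ √v
  · -- the second moment dominates, and the sample size is adapted to it
    have h1 : v / 8 ≤ pilot (fun w : Fin ℓ × Fin m => y (ω.1 w.1 w.2)) :=
      not_lt.1 fun h' => hnot ⟨h, h'⟩
    have h2 : m * (v / 8) ≤ (J ω.1).card := mul_le_card_sampleIdx h1 (by linarith)
    have h3 : √v / √((J ω.1).card : ℝ) ≤ 3 * (m : ℝ) ^ (-(1 / 2) : ℝ) := by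
      rw [← hsm, ← Real.sqrt_div hv0, Real.sqrt_le_left (by positivity), mul_pow, inv_pow,
        Real.sq_sqrt hm0.le, div_le_iff₀ hJ0]
      have : v ≤ 8 * (m : ℝ)⁻¹ * (J ω.1).card := by
        rw [mul_assoc, ← div_le_iff₀' (by norm_num), ← div_eq_inv_mul, le_div_iff₀ hm0]
        linarith
      have h5 : 0 ≤ (m : ℝ)⁻¹ * (J ω.1).card := by positivity
      nlinarith
    have h4 : 0 ≤ 192 * (m : ℝ) ^ (-(1 - recip p)) * meanNorm p y := by positivity
    calc 12 * √v / √((J ω.1).card : ℝ) = 12 * (√v / √((J ω.1).card : ℝ)) := by ring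
      _ ≤ 12 * (3 * (m : ℝ) ^ (-(1 / 2) : ℝ)) := by gcongr
      _ ≤ _ := by linarith
  · push Not at h
    have h1 : (√((J ω.1).card : ℝ))⁻¹ ≤ (m : ℝ) ^ (-(1 / 2) : ℝ) := by
      rw [← hsm]
      gcongr
      exact hJm ω.1
    calc 12 * √v / √((J ω.1).card : ℝ)
        = 12 * √v * (√((J ω.1).card : ℝ))⁻¹ := by rw [div_eq_mul_inv]
      _ ≤ 12 * (16 * meanNorm p y * (m : ℝ) ^ (-(1 / 2 - recip p))) * (m : ℝ) ^ (-(1 / 2) : ℝ) := by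
          gcongr
      _ = 192 * ((m : ℝ) ^ (-(1 / 2 - recip p)) * (m : ℝ) ^ (-(1 / 2) : ℝ)) * meanNorm p y := by
          ring
      _ = 192 * (m : ℝ) ^ (-(1 - recip p)) * meanNorm p y := by
          rw [← Real.rpow_add hm0]
          congr 3
          ring
      _ ≤ _ := by linarith

theorem norm_rowEst_sub_le (hℓ : 1 ≤ ℓ) (y : A → 𝕜) {K : ℝ} (hK : 0 ≤ K) (hy : ∀ a, ‖y a‖ ≤ K)
    (ω : (Fin ℓ → Fin m → A) × (Fin ℓ → Fin (m * R) → A)) : ‖rowEst hℓ y ω - avg y‖ ≤ 2 * K := by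
  have h1 : ‖rowEst hℓ y ω‖ ≤ K := by
    rw [rowEst, medianOfMeans_coe hℓ _ fun t l => y (ω.2 t l)]
    exact norm_inv_card_mul_sum_le _ _ hK fun l => hy _
  have h2 : ‖avg y‖ ≤ K := by
    have := norm_inv_card_mul_sum_le (Finset.univ : Finset A) y hK hy
    rwa [Finset.card_univ] at this
  linarith [norm_sub_le (rowEst hℓ y ω) (avg y)]

end Row

section Array

variable {p q : ℝ≥0∞} [hp : Fact (1 ≤ p)] [hq : Fact (1 ≤ q)] {N M ℓ m n R : ℕ}

theorem meanNorm_meanNorm_row (hp' : p ≠ ∞) (x : Fin N × Fin M → 𝕜) :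
    meanNorm p (fun i => meanNorm p fun j => x (i, j)) = meanNorm p x := by
  rw [meanNorm_of_ne_top hp', meanNorm_of_ne_top hp', ← Finset.univ_product_univ,
    Finset.expect_product]
  simp only [Real.norm_of_nonneg (meanNorm_nonneg _), meanNorm_rpow hp']

/-- The expected error of the array of row estimators. Outside of an event of polynomially small
probability the bound of `prob_rowEst_le` holds in all rows at once; on the exceptional event the
trivial bound `2 √(N M)` is used, as the entries are at most `(N M) ^ (1 / p)`. -/
theorem expect_meanNorm_rowEst_le (hN : 1 ≤ N) (hM : 1 ≤ M) (hℓ : 1 ≤ ℓ) (hm : 1 ≤ m)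
    (hmM : m ≤ N * M) (hpow : (N + M) ^ 4 ≤ 2 ^ ℓ) (hR : N * M ≤ R)
    (hp2 : 2 < p) (hpq : p ≤ q) (hp' : p ≠ ∞) (x : Fin N × Fin M → 𝕜) (hx : meanNorm p x ≤ 1) :
    𝔼 ω : (Fin ℓ → Fin m → Fin M) × (Fin ℓ → Fin (m * R) → Fin M),
      meanNorm q (rowMean x - fun i => rowEst hℓ (fun j => x (i, j)) ω)
      ≤ 192 * (N : ℝ) ^ (recip p - recip q) * (m : ℝ) ^ (-(1 - recip p))
        + 40 * (m : ℝ) ^ (-(1 / 2) : ℝ) := by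
  classical
  have : NeZero N := ⟨by omega⟩
  have : NeZero M := ⟨by omega⟩
  have : NeZero m := ⟨by omega⟩
  have hNM : 1 ≤ N * M := Nat.mul_pos hN hM
  have hNM0 : (1 : ℝ) ≤ N * M := by exact_mod_cast hNM
  have hN0 : (1 : ℝ) ≤ N := by exact_mod_cast hN
  have hM0 : (1 : ℝ) ≤ M := by exact_mod_cast hM
  have hm0 : (1 : ℝ) ≤ m := by exact_mod_cast hm
  have hmM' : (m : ℝ) ≤ N * M := by exact_mod_cast hmM
  set K : ℝ := √((N : ℝ) * M) with hK
  have hK0 : 0 ≤ K := Real.sqrt_nonneg _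
  have hK2 : K ^ 2 = N * M := Real.sq_sqrt (by linarith)
  have hrp : recip p ≤ 1 / 2 := by
    have h2 : Fact ((1 : ℝ≥0∞) ≤ 2) := ⟨by norm_num⟩
    have := recip_anti (p := 2) hp2.le
    rwa [recip_eq 2, ENNReal.toReal_ofNat] at this
  have hxK : ∀ w, ‖x w‖ ≤ K := fun w => by
    have h1 := norm_apply_le (p := p) x w
    rw [Fintype.card_prod, Fintype.card_fin, Fintype.card_fin, Nat.cast_mul] at h1
    refine h1.trans ((mul_le_of_le_one_right (by positivity) hx).trans ?_)
    rw [hK, Real.sqrt_eq_rpow]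
    exact Real.rpow_le_rpow_of_exponent_le hNM0 hrp
  let a : Fin N → ℝ := fun i => meanNorm p fun j => x (i, j)
  have ha : meanNorm q a ≤ (N : ℝ) ^ (recip p - recip q) := by
    have h1 := meanNorm_le_card_rpow_mul hpq a
    rw [Fintype.card_fin, meanNorm_meanNorm_row hp'] at h1
    exact h1.trans (mul_le_of_le_one_right (by positivity) hx)
  set u : ℝ := 36 * (m : ℝ) ^ (-(1 / 2) : ℝ) with hu
  set w : ℝ := 192 * (m : ℝ) ^ (-(1 - recip p)) with hw
  have hu0 : 0 ≤ u := by positivity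
  have hw0 : 0 ≤ w := by positivity
  let Ω := (Fin ℓ → Fin m → Fin M) × (Fin ℓ → Fin (m * R) → Fin M)
  let E : Fin N → Ω → Prop := fun i ω =>
    u + w * a i < ‖rowEst hℓ (fun j => x (i, j)) ω - avg fun j => x (i, j)‖
  have hE : ∀ i, prob (E i) ≤ 2 * (1 / 2) ^ ℓ := fun i =>
    prob_rowEst_le hℓ hm (hNM.trans hR) hp2 hp' (fun j => x (i, j)) (by
      refine Finset.expect_le Finset.univ_nonempty fun j _ => ?_
      have h1 := pow_le_pow_left₀ (norm_nonneg _) (hxK (i, j)) 2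
      rw [hK2] at h1
      exact h1.trans (by exact_mod_cast hR))
  have hprob := prob_exists_le E hE
  rw [Fintype.card_fin] at hprob
  have hrm : ∀ i, rowMean x i = avg fun j => x (i, j) := fun i => rfl
  have key : ∀ ω : Ω, meanNorm q (rowMean x - fun i => rowEst hℓ (fun j => x (i, j)) ω)
      ≤ (u + w * (N : ℝ) ^ (recip p - recip q)) + 2 * K * (if ∃ i, E i ω then (1 : ℝ) else 0) := by
    intro ω
    have hpos : 0 ≤ u + w * (N : ℝ) ^ (recip p - recip q) := by positivity
    split_ifs with h
    · refine (meanNorm_le_of_forall_le (C := 2 * K) (by positivity) fun i => ?_).trans (by linarith)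
      rw [Pi.sub_apply, hrm, norm_sub_rev]
      exact norm_rowEst_sub_le hℓ _ hK0 (fun j => hxK _) ω
    · push Not at h
      rw [mul_zero, add_zero]
      calc meanNorm q (rowMean x - fun i => rowEst hℓ (fun j => x (i, j)) ω)
          ≤ meanNorm q ((fun _ => u) + w • a) := by
            refine meanNorm_mono fun i => ?_
            rw [Pi.sub_apply, hrm, norm_sub_rev]
            refine (not_lt.1 (h i)).trans (le_of_eq ?_)
            simp only [Pi.add_apply, Pi.smul_apply, smul_eq_mul]
            rw [Real.norm_of_nonneg (add_nonneg hu0 (mul_nonneg hw0 (meanNorm_nonneg _)))]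
        _ ≤ _ := by
            refine (meanNorm_add_le _ _).trans (add_le_add ?_ ?_)
            · exact meanNorm_le_of_forall_le hu0 fun i => (Real.norm_of_nonneg hu0).le
            · rw [meanNorm_smul, Real.norm_of_nonneg hw0]
              gcongr
  have hbad : 2 * K * (N * (2 * (1 / 2) ^ ℓ)) ≤ 4 * (m : ℝ) ^ (-(1 / 2) : ℝ) := by
    have h1 : ((N : ℝ) + M) ^ 4 ≤ 2 ^ ℓ := by exact_mod_cast hpow
    have hKs : K ≤ N + M := by
      rw [hK, Real.sqrt_le_left (by positivity)]
      nlinarith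
    have h2 : ((1 : ℝ) / 2) ^ ℓ ≤ (((N : ℝ) + M) ^ 4)⁻¹ := by
      rw [one_div, inv_pow]
      gcongr
    have h3 : ((N : ℝ) + M)⁻¹ ≤ (m : ℝ) ^ (-(1 / 2) : ℝ) := by
      rw [Real.rpow_neg (by positivity), ← Real.sqrt_eq_rpow]
      refine inv_anti₀ (by positivity) ((Real.sqrt_le_sqrt hmM').trans hKs)
    have hs : 0 < (N : ℝ) + M := by linarith
    calc 2 * K * (N * (2 * (1 / 2) ^ ℓ))
        ≤ 2 * (N + M) * ((N + M) * (2 * (((N : ℝ) + M) ^ 4)⁻¹)) := by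
          gcongr
          linarith
      _ = 4 * (((N : ℝ) + M)⁻¹ * ((N : ℝ) + M)⁻¹) := by field_simp; norm_num
      _ ≤ 4 * (((N : ℝ) + M)⁻¹ * 1) := by
          gcongr
          exact inv_le_one_of_one_le₀ (by linarith)
      _ ≤ _ := by rw [mul_one]; gcongr
  calc 𝔼 ω : Ω, meanNorm q (rowMean x - fun i => rowEst hℓ (fun j => x (i, j)) ω)
      ≤ 𝔼 ω : Ω, ((u + w * (N : ℝ) ^ (recip p - recip q))
          + 2 * K * (if ∃ i, E i ω then (1 : ℝ) else 0)) :=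
        Finset.expect_le_expect fun ω _ => key ω
    _ = (u + w * (N : ℝ) ^ (recip p - recip q)) + 2 * K * prob (fun ω => ∃ i, E i ω) := by
        rw [Finset.expect_add_distrib, Finset.expect_const Finset.univ_nonempty,
          ← Finset.mul_expect]
        congr 2
        unfold prob
        congr!
    _ ≤ (u + w * (N : ℝ) ^ (recip p - recip q)) + 2 * K * (N * (2 * (1 / 2) ^ ℓ)) := by gcongr
    _ ≤ _ := by
        rw [hu, hw]
        linarith

/-- The expected number of samples. The second moments of the rows average to at most one. -/
theorem expect_card_samples_le (hM : 1 ≤ M) (hℓ : 1 ≤ ℓ) (hm : 1 ≤ m) (hp2 : 2 < p)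
    (x : Fin N × Fin M → 𝕜) (hx : meanNorm p x ≤ 1) :
    𝔼 ω : (Fin ℓ → Fin m → Fin M) × (Fin ℓ → Fin (m * R) → Fin M),
      ((N * (ℓ * m) + ∑ i, ℓ * (sampleIdx m R
        (pilot fun w : Fin ℓ × Fin m => x (i, ω.1 w.1 w.2))).card : ℕ) : ℝ) ≤ 4 * (N * ℓ * m) := by
  have : NeZero M := ⟨by omega⟩
  have : NeZero m := ⟨by omega⟩
  have : NeZero ℓ := ⟨by omega⟩
  have h2 : Fact ((1 : ℝ≥0∞) ≤ 2) := ⟨by norm_num⟩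
  have hsum : ∑ i, 𝔼 j, ‖x (i, j)‖ ^ 2 ≤ N := by
    have h1 := meanNorm_rpow (p := 2) (by norm_num) x
    simp only [ENNReal.toReal_ofNat, Real.rpow_two] at h1
    have h3 := (meanNorm_le_meanNorm hp2.le x).trans hx
    have h4 : 𝔼 w, ‖x w‖ ^ 2 ≤ 1 := by
      rw [← h1]
      exact pow_le_one₀ (meanNorm_nonneg _) h3
    rw [← Finset.univ_product_univ, Finset.expect_product] at h4
    have h5 := Fintype.card_mul_expect (fun i : Fin N => 𝔼 j, ‖x (i, j)‖ ^ 2)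
    rw [Fintype.card_fin] at h5
    rw [← h5]
    exact mul_le_of_le_one_right (Nat.cast_nonneg _) h4
  have hpil : ∀ i, 𝔼 ξ : Fin ℓ → Fin m → Fin M,
      pilot (fun w : Fin ℓ × Fin m => x (i, ξ w.1 w.2)) = 𝔼 j, ‖x (i, j)‖ ^ 2 := by
    intro i
    unfold pilot
    rw [Finset.expect_comm]
    refine (Finset.expect_congr rfl fun w _ => ?_).trans (Finset.expect_const
      Finset.univ_nonempty _)
    rw [expect_eval (fun θ : Fin m → Fin M => ‖x (i, θ w.2)‖ ^ 2) w.1,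
      expect_eval (fun j => ‖x (i, j)‖ ^ 2) w.2]
  rw [← Finset.univ_product_univ, Finset.expect_product]
  calc _ ≤ 𝔼 ξ : Fin ℓ → Fin m → Fin M, ((N : ℝ) * (ℓ * m)
        + ∑ i, (ℓ : ℝ) * (m * (2 + pilot fun w : Fin ℓ × Fin m => x (i, ξ w.1 w.2)))) := by
        refine Finset.expect_le_expect fun ξ _ => ?_
        simp only
        rw [Finset.expect_const Finset.univ_nonempty]
        push_cast
        gcongr
        exact card_sampleIdx_le (Finset.expect_nonneg fun w _ => by positivity)
    _ = (N : ℝ) * (ℓ * m) + ∑ i, (ℓ : ℝ) * (m * (2 + 𝔼 j, ‖x (i, j)‖ ^ 2)) := by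
        rw [Finset.expect_add_distrib, Fintype.expect_const, Finset.expect_sum_comm]
        congr 1
        refine Finset.sum_congr rfl fun i _ => ?_
        rw [← Finset.mul_expect, ← Finset.mul_expect, Finset.expect_add_distrib,
          Fintype.expect_const, hpil]
    _ = (N : ℝ) * (ℓ * m) + ℓ * (m * (2 * N + ∑ i, 𝔼 j, ‖x (i, j)‖ ^ 2)) := by
        rw [← Finset.mul_sum, ← Finset.mul_sum, Finset.sum_add_distrib, Finset.sum_const,
          Finset.card_univ, Fintype.card_fin, nsmul_eq_mul]
        ring
    _ ≤ (N : ℝ) * (ℓ * m) + ℓ * (m * (2 * N + N)) := by gcongr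
    _ = _ := by ring

/-- The adaptive algorithm: the pilot sample is the first stage, and the numbers of samples in the
second stage are truncated at `m * (N * M)` to keep the probability space finite. -/
theorem eRan_le_adaptive (hN : 1 ≤ N) (hM : 1 ≤ M) (hℓ : 1 ≤ ℓ) (hm : 1 ≤ m)
    (hmM : m ≤ N * M) (hpow : (N + M) ^ 4 ≤ 2 ^ ℓ) (hn : 4 * (N * ℓ * m) ≤ n)
    (hp2 : 2 < p) (hpq : p ≤ q) (hp' : p ≠ ∞) :
    eRan.{u} 𝕜 p q N M n ≤ ENNReal.ofReal
      (192 * (N : ℝ) ^ (recip p - recip q) * (m : ℝ) ^ (-(1 - recip p))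
        + 40 * (m : ℝ) ^ (-(1 / 2) : ℝ)) := by
  have : NeZero M := ⟨by omega⟩
  set R := N * M with hR
  have hD := fun ω : (Fin ℓ → Fin m → Fin M) × (Fin ℓ → Fin (m * R) → Fin M) =>
    exists_twoStage (𝕜 := 𝕜) (p := p) (G := MeanLp q 𝕜 (Fin N)) hN hM
      (α := Fin N × Fin ℓ × Fin m) (fun w => (w.1, ω.1 w.2.1 w.2.2))
      (fun a => Σ i, Fin ℓ × ↥(sampleIdx m R (pilot fun w => a (i, w))))
      (fun a b => (b.1, ω.2 b.2.1 b.2.2.1))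
      (fun a b => show Fin N → 𝕜 from fun i =>
        medianOfMeans hℓ (sampleIdx m R (pilot fun w => a (i, w))) fun t l => b ⟨i, (t, l)⟩)
  choose D _ hD2 using hD
  refine eRan_le_of_finite D (fun f ω => N * (ℓ * m) + ∑ i, ℓ * (sampleIdx m R
    (pilot fun w : Fin ℓ × Fin m => f.1 (i, ω.1 w.1 w.2))).card) (fun f ω => ?_) (fun f => ?_)
    fun f => ?_
  · rw [(hD2 ω f).1]
    simp only [Fintype.card_prod, Fintype.card_fin, Fintype.card_sigma, Fintype.card_coe]
  · refine (expect_card_samples_le hM hℓ hm hp2 f.1 (meanNorm_input_le f)).trans ?_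
    exact_mod_cast hn
  · refine le_trans (Finset.expect_le_expect fun ω _ => ?_) (expect_meanNorm_rowEst_le hN hM hℓ hm
      hmM hpow hR.ge hp2 hpq hp' f.1 (meanNorm_input_le f))
    rw [(hD2 ω f).2]
    exact (norm_meanOp_sub (q := q) f fun i => rowEst hℓ (fun j => f.1 (i, j)) ω).le

end Array

end Adaptive

/-! ### The rates -/

theorem rpow_neg_le_mul_rpow_neg {a b C s : ℝ} (hb : 0 < b) (hC : 1 ≤ C)
    (hba : b ≤ C * a) (hs : 0 ≤ s) (hs1 : s ≤ 1) : a ^ (-s) ≤ C * b ^ (-s) := by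
  have h1 : b / C ≤ a := by rwa [div_le_iff₀' (by linarith)]
  calc a ^ (-s) ≤ (b / C) ^ (-s) := Real.rpow_le_rpow_of_nonpos (by positivity) h1 (by linarith)
    _ = C ^ s * b ^ (-s) := by
        rw [Real.div_rpow hb.le (by linarith), Real.rpow_neg (by linarith : 0 ≤ C), div_inv_eq_mul,
          mul_comm]
    _ ≤ C ^ (1 : ℝ) * b ^ (-s) := by gcongr
    _ = _ := by rw [Real.rpow_one]

theorem inv_sqrt_eq_rpow {x : ℝ} (hx : 0 ≤ x) : (√x)⁻¹ = x ^ (-(1 / 2) : ℝ) := by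
  rw [Real.sqrt_eq_rpow, ← Real.rpow_neg hx]

theorem deltaTop_of_ne {p : ℝ≥0∞} (h : p ≠ ∞) : deltaTop p = 0 := if_neg h

theorem deltaTop_top : deltaTop ∞ = 1 := if_pos rfl

theorem one_le_logb_succ {N : ℕ} (hN : 1 ≤ N) : 1 ≤ Real.logb 2 ((N : ℝ) + 1) := by
  have : (1 : ℝ) ≤ N := by exact_mod_cast hN
  rw [Real.le_logb_iff_rpow_le (by norm_num) (by linarith), Real.rpow_one]
  linarith

theorem exists_ceilDiv {n N : ℕ} (hn : 1 ≤ n) (hN : 1 ≤ N) :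
    ∃ k : ℕ, ceilDiv n N = k ∧ 1 ≤ k ∧ n ≤ N * k ∧ N * k < n + N := by
  have hn0 : (0 : ℝ) < n := by exact_mod_cast hn
  have hN0 : (0 : ℝ) < N := by exact_mod_cast hN
  refine ⟨⌈(n : ℝ) / N⌉₊, rfl, Nat.one_le_iff_ne_zero.2 (Nat.ceil_pos.2 (by positivity)).ne', ?_, ?_⟩
  · have h := Nat.le_ceil ((n : ℝ) / N)
    rw [div_le_iff₀' hN0] at h
    exact_mod_cast h
  · have h := Nat.ceil_lt_add_one (show 0 ≤ (n : ℝ) / N by positivity)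
    have h1 := mul_lt_mul_of_pos_left h hN0
    rw [mul_add, mul_div_cancel₀ _ hN0.ne', mul_one] at h1
    exact_mod_cast h1

section Lower

variable {𝕜 : Type*} [RCLike 𝕜] {p q : ℝ≥0∞} [hp : Fact (1 ≤ p)] [hq : Fact (1 ≤ q)] {N M n k : ℕ}

/-- The number `B` of blocks of columns on which the fooling inputs live. -/
theorem exists_blocks (hM : 1 ≤ M) (hk : 1 ≤ k) (hn : n ≤ N * k)
    (hnM : 16 * n < N * M) : ∃ B : ℕ, 1 ≤ B ∧ B ≤ M ∧ 8 * n ≤ N * B ∧ B ≤ 8 * k := by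
  refine ⟨min M (8 * k), by omega, min_le_left _ _, ?_, min_le_right _ _⟩
  rcases le_total M (8 * k) with h | h
  · rw [min_eq_left h]; omega
  · rw [min_eq_right h]; nlinarith

theorem rpow_neg_block_ge {B : ℕ} {s : ℝ} (hB : 1 ≤ B) (hBk : B ≤ 8 * k) (hs : 0 ≤ s)
    (hs1 : s ≤ 1) : (k : ℝ) ^ (-s) ≤ 8 * (B : ℝ) ^ (-s) :=
  rpow_neg_le_mul_rpow_neg (by exact_mod_cast hB) (by norm_num)
    (by exact_mod_cast hBk) hs hs1

theorem eRan_ge_single_rate (hN : 1 ≤ N) (hM : 1 ≤ M) (hk : 1 ≤ k) (hn : n ≤ N * k)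
    (hnM : 16 * n < N * M) :
    ENNReal.ofReal (1 / 64 * ((N : ℝ) ^ (recip p - recip q) * (k : ℝ) ^ (-(1 - recip p))))
      ≤ eRan.{u} 𝕜 p q N M n := by
  obtain ⟨B, hB, hBM, hnB, hBk⟩ := exists_blocks hM hk hn hnM
  have hN0 : (0 : ℝ) < N := by exact_mod_cast hN
  have hB0 : (0 : ℝ) < B := by exact_mod_cast hB
  refine le_trans (ENNReal.ofReal_le_ofReal ?_) (eRan_ge_of_single (p := p) (q := q) hN hB hBM hnB)
  have h1 := rpow_neg_block_ge hB hBk (sub_nonneg.2 (recip_le_one (p := p)))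
    (by linarith [recip_nonneg p])
  have h2 : ((N : ℝ) * B) ^ recip p / (8 * B * (N : ℝ) ^ recip q)
      = 1 / 8 * ((N : ℝ) ^ (recip p - recip q) * (B : ℝ) ^ (-(1 - recip p))) := by
    rw [Real.mul_rpow hN0.le hB0.le, Real.rpow_sub hN0, neg_sub, Real.rpow_sub hB0, Real.rpow_one]
    field_simp
  rw [h2]
  have h3 : (0 : ℝ) ≤ (N : ℝ) ^ (recip p - recip q) := by positivity
  nlinarith [mul_le_mul_of_nonneg_left h1 h3]

theorem eRan_ge_row_rate (hp' : p ≠ ∞) (hN : 1 ≤ N) (hM : 1 ≤ M) (hk : 1 ≤ k) (hn : n ≤ N * k)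
    (hnM : 16 * n < N * M) :
    ENNReal.ofReal (1 / 64 * (k : ℝ) ^ (-(1 - recip p))) ≤ eRan.{u} 𝕜 p q N M n := by
  obtain ⟨B, hB, hBM, hnB, hBk⟩ := exists_blocks hM hk hn hnM
  have hB0 : (0 : ℝ) < B := by exact_mod_cast hB
  refine le_trans (ENNReal.ofReal_le_ofReal ?_)
    (eRan_ge_of_row_needles (p := p) (q := q) hp' hN hB hBM hnB)
  have h1 := rpow_neg_block_ge hB hBk (sub_nonneg.2 (recip_le_one (p := p)))
    (by linarith [recip_nonneg p])
  have h2 : (B : ℝ) ^ recip p / (8 * B) = 1 / 8 * (B : ℝ) ^ (-(1 - recip p)) := by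
    rw [neg_sub, Real.rpow_sub hB0, Real.rpow_one]
    field_simp
  rw [h2]
  linarith

theorem inv_sqrt_block_ge {B : ℕ} (hB : 1 ≤ B) (hBk : B ≤ 8 * k) :
    1 / 30 * (k : ℝ) ^ (-(1 / 2) : ℝ) ≤ 1 / (10 * √(B : ℝ)) := by
  have hB0 : (0 : ℝ) < B := by exact_mod_cast hB
  have hk0 : (0 : ℝ) < k := by exact_mod_cast (by omega : 0 < k)
  rw [← inv_sqrt_eq_rpow hk0.le, one_div, one_div, ← mul_inv]
  refine inv_anti₀ (by positivity) ?_
  have : √(B : ℝ) ≤ 3 * √(k : ℝ) := by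
    rw [Real.sqrt_le_left (by positivity), mul_pow, Real.sq_sqrt hk0.le]
    have : (B : ℝ) ≤ 8 * k := by exact_mod_cast hBk
    linarith
  linarith

theorem eRan_ge_signs_rate (hN : 1 ≤ N) (hM : 1 ≤ M) (hk : 1 ≤ k) (hn : n ≤ N * k)
    (hnM : 16 * n < N * M) :
    ENNReal.ofReal (1 / 30 * (k : ℝ) ^ (-(1 / 2) : ℝ)) ≤ eRan.{u} 𝕜 p q N M n := by
  obtain ⟨B, hB, hBM, hnB, hBk⟩ := exists_blocks hM hk hn hnM
  exact le_trans (ENNReal.ofReal_le_ofReal (inv_sqrt_block_ge hB hBk))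
    (eRan_ge_of_signs (p := p) (q := q) hN hB hBM hnB)

theorem eRanNon_ge_rate (hN : 1 ≤ N) (hM : 1 ≤ M) (hk : 1 ≤ k) (hn : n ≤ N * k)
    (hnM : 16 * n < N * M) :
    ENNReal.ofReal (1 / 30 * (N : ℝ) ^ (recip p - recip q) * (k : ℝ) ^ (-(1 / 2) : ℝ))
      ≤ eRanNon.{u} 𝕜 p q N M n := by
  obtain ⟨B, hB, hBM, hnB, hBk⟩ := exists_blocks hM hk hn hnM
  refine le_trans (ENNReal.ofReal_le_ofReal ?_)
    (eRanNon_ge_of_row_signs (p := p) (q := q) hN hB hBM hnB)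
  have h1 := mul_le_mul_of_nonneg_left (inv_sqrt_block_ge hB hBk)
    (show (0 : ℝ) ≤ (N : ℝ) ^ (recip p - recip q) by positivity)
  rw [mul_one_div] at h1
  linarith

/-- The logarithmic factor for `q = ∞`: about `16 k` columns are divided into `s ≈ min (log N) k`
groups. -/
theorem eRan_top_ge_rate (hN : 1 ≤ N) (hM : 1 ≤ M) (hk : 1 ≤ k) (hn : n ≤ N * k)
    (hnk : N * k < n + N) (hnM : 16 * n < N * M) :
    ENNReal.ofReal (1 / 384 * (√(min (Real.logb 2 ((N : ℝ) + 1)) k) * (k : ℝ) ^ (-(1 / 2) : ℝ)))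
      ≤ eRan.{u} 𝕜 p ∞ N M n := by
  have hk0 : (0 : ℝ) < k := by exact_mod_cast hk
  rcases lt_or_ge N 24 with hN24 | hN24
  · -- the logarithm is bounded
    refine le_trans (ENNReal.ofReal_le_ofReal ?_) (eRan_ge_signs_rate (p := p) hN hM hk hn hnM)
    have h1 : Real.logb 2 ((N : ℝ) + 1) ≤ 5 := by
      have : (N : ℝ) + 1 ≤ 24 := by exact_mod_cast hN24
      rw [Real.logb_le_iff_le_rpow (by norm_num) (by positivity)]
      norm_num
      linarith
    have h2 : √(min (Real.logb 2 ((N : ℝ) + 1)) k) ≤ 3 := by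
      rw [Real.sqrt_le_left (by norm_num)]
      exact (min_le_left _ _).trans (by linarith)
    have h3 : (0 : ℝ) ≤ (k : ℝ) ^ (-(1 / 2) : ℝ) := by positivity
    nlinarith [mul_le_mul_of_nonneg_right h2 h3]
  set s₀ := Nat.log 12 (N / 2) with hs₀
  have hs₀1 : 1 ≤ s₀ := Nat.log_pos (by norm_num) (by omega)
  set s := min s₀ k with hs
  have hs1 : 1 ≤ s := le_min hs₀1 hk
  have hkM : k ≤ M := by
    by_contra h
    push Not at h
    have h1 : N * (M + 1) ≤ N * k := Nat.mul_le_mul_left N h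
    nlinarith
  set B := min M (16 * k) with hB
  have hsB : s ≤ B := le_min ((min_le_right _ _).trans hkM) ((min_le_right _ _).trans (by omega))
  set g := B / s with hg
  have hg1 : 1 ≤ g := (Nat.one_le_div_iff hs1).2 hsB
  have hsgB : s * g ≤ B := Nat.mul_div_le B s
  have hBsg : B ≤ 2 * (s * g) := by
    have h1 := Nat.lt_mul_div_succ B (show 0 < s from hs1)
    rw [← hg] at h1
    nlinarith
  have hN12 : 2 * 12 ^ s ≤ N := by
    have h1 : 12 ^ s₀ ≤ N / 2 := Nat.pow_log_le_self 12 (by omega)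
    have h2 : 12 ^ s ≤ 12 ^ s₀ := Nat.pow_le_pow_right (by norm_num) (min_le_left _ _)
    omega
  have hnB : 16 * n ≤ N * B := by
    rcases le_total M (16 * k) with h | h
    · rw [hB, min_eq_left h]; omega
    · rw [hB, min_eq_right h]; nlinarith
  refine le_trans (ENNReal.ofReal_le_ofReal ?_) (eRan_top_ge_of_signs (p := p) hs1 hg1 hN12
    (hsgB.trans (min_le_left _ _)) (by nlinarith))
  have hg0 : (0 : ℝ) < g := by exact_mod_cast hg1
  have hlog : Real.logb 2 ((N : ℝ) + 1) ≤ 9 * s₀ := by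
    have h1 : N / 2 < 12 ^ (s₀ + 1) := Nat.lt_pow_succ_log_self (by norm_num) _
    have h2 : N + 1 ≤ 2 ^ (9 * s₀) := by
      calc N + 1 ≤ 2 * 12 ^ (s₀ + 1) := by omega
        _ ≤ 2 * 16 ^ (s₀ + 1) := by gcongr; norm_num
        _ = 2 ^ (4 * s₀ + 5) := by
            rw [show 16 = 2 ^ 4 by norm_num, ← pow_mul, ← pow_succ']
            congr 1
        _ ≤ 2 ^ (9 * s₀) := Nat.pow_le_pow_right (by norm_num) (by omega)
    have h3 : (N : ℝ) + 1 ≤ 2 ^ (9 * s₀) := by exact_mod_cast h2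
    rw [Real.logb_le_iff_le_rpow (by norm_num) (by positivity)]
    exact_mod_cast h3
  have hmin : min (Real.logb 2 ((N : ℝ) + 1)) k ≤ 9 * s := by
    rw [hs]
    push_cast
    rw [mul_min_of_nonneg _ _ (by norm_num)]
    exact min_le_min hlog (by linarith)
  have hsg : (s : ℝ) * g ≤ 16 * k := by
    exact_mod_cast hsgB.trans (min_le_right _ _)
  rw [← inv_sqrt_eq_rpow hk0.le, one_div (32 * √(g : ℝ)), ← div_eq_mul_inv, ← mul_div_assoc,
    div_le_iff₀ (by positivity), inv_mul_eq_div, le_div_iff₀ (by positivity)]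
  have h1 : √(min (Real.logb 2 ((N : ℝ) + 1)) k) * √(g : ℝ) ≤ 12 * √(k : ℝ) := by
    have h2 : √(min (Real.logb 2 ((N : ℝ) + 1)) k) * √(g : ℝ) ≤ √(9 * s) * √(g : ℝ) := by gcongr
    refine h2.trans ?_
    rw [← Real.sqrt_mul (by positivity), Real.sqrt_le_left (by positivity), mul_pow,
      Real.sq_sqrt hk0.le]
    linarith
  linarith

/-- The logarithm of the number of rows is dominated by its powers. -/
theorem logb_succ_le (hN : 1 ≤ N) (hp' : p ≠ ∞) :
    Real.logb 2 ((N : ℝ) + 1) ≤ 4 * p.toReal * (N : ℝ) ^ recip p := by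
  have hr := one_le_toReal (p := p) hp'
  have hN0 : (1 : ℝ) ≤ N := by exact_mod_cast hN
  have h1 := Real.log_le_rpow_div (show 0 ≤ (N : ℝ) + 1 by linarith)
    (show 0 < recip p by rw [recip_eq]; positivity)
  have h2 : ((N : ℝ) + 1) ^ recip p ≤ 2 * (N : ℝ) ^ recip p := by
    calc ((N : ℝ) + 1) ^ recip p ≤ (2 * N) ^ recip p := by
          gcongr
          · exact recip_nonneg p
          · linarith
      _ = 2 ^ recip p * (N : ℝ) ^ recip p := Real.mul_rpow (by norm_num) (by linarith)
      _ ≤ 2 ^ (1 : ℝ) * (N : ℝ) ^ recip p := by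
          gcongr
          · norm_num
          · exact recip_le_one
      _ = _ := by rw [Real.rpow_one]
  have h3 : ((N : ℝ) + 1) ^ recip p / recip p = p.toReal * ((N : ℝ) + 1) ^ recip p := by
    rw [recip_eq]; field_simp
  rw [h3] at h1
  have hl2 : (1 : ℝ) / 2 ≤ Real.log 2 := by linarith [Real.log_two_gt_d9]
  have hlog : 0 ≤ Real.log ((N : ℝ) + 1) := Real.log_nonneg (by linarith)
  calc Real.logb 2 ((N : ℝ) + 1) = Real.log (N + 1) / Real.log 2 := rfl
    _ ≤ Real.log (N + 1) / (1 / 2) := by gcongr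
    _ = 2 * Real.log (N + 1) := by ring
    _ ≤ 2 * (p.toReal * ((N : ℝ) + 1) ^ recip p) := by gcongr
    _ ≤ 2 * (p.toReal * (2 * (N : ℝ) ^ recip p)) := by gcongr
    _ = _ := by ring

theorem ofReal_le_of_le_max {x a b : ℝ} {E : ℝ≥0∞} (hx : x ≤ max a b) (ha : ENNReal.ofReal a ≤ E)
    (hb : ENNReal.ofReal b ≤ E) : ENNReal.ofReal x ≤ E := by
  refine (ENNReal.ofReal_le_ofReal hx).trans ?_
  rcases max_choice a b with h | h <;> rwa [h]

/-- The lower bound for `2 < p < q`. For `q = ∞` and `k < log₂ (N + 1)` the first term dominates the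
second one, since the logarithm is dominated by `N ^ (1 / p)`. -/
theorem eRan_ge_sum_rate (hpq : p < q) (hN : 1 ≤ N) (hM : 1 ≤ M) (hk : 1 ≤ k)
    (hn : n ≤ N * k) (hnk : N * k < n + N) (hnM : 16 * n < N * M) :
    ENNReal.ofReal (1 / (448 * (1 + 4 * p.toReal)) *
      ((N : ℝ) ^ (recip p - recip q) * (k : ℝ) ^ (-(1 - recip p))
        + (k : ℝ) ^ (-(1 / 2) : ℝ) * Real.logb 2 ((N : ℝ) + 1) ^ (deltaTop q / 2)))
      ≤ eRan.{u} 𝕜 p q N M n := by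
  have hp' : p ≠ ∞ := (hpq.trans_le le_top).ne
  have hr := one_le_toReal (p := p) hp'
  have hk0 : (1 : ℝ) ≤ k := by exact_mod_cast hk
  have hk00 : (0 : ℝ) < k := by linarith
  have hN0 : (1 : ℝ) ≤ N := by exact_mod_cast hN
  have h1 := eRan_ge_single_rate (𝕜 := 𝕜) (p := p) (q := q) hN hM hk hn hnM
  set X : ℝ := (N : ℝ) ^ (recip p - recip q) * (k : ℝ) ^ (-(1 - recip p)) with hX
  set Y : ℝ := (k : ℝ) ^ (-(1 / 2) : ℝ) * Real.logb 2 ((N : ℝ) + 1) ^ (deltaTop q / 2) with hY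
  have hL1 := one_le_logb_succ hN
  have hX0 : 0 ≤ X := by positivity
  have hY0 : 0 ≤ Y := mul_nonneg (by positivity) (Real.rpow_nonneg (by linarith) _)
  rw [← one_div_mul_one_div, mul_assoc, one_div_mul_eq_div (448 : ℝ)]
  set T : ℝ := 1 / (1 + 4 * p.toReal) * (X + Y) with hT
  -- the sum is dominated by the first term, or both terms are lower bounds
  have hcase : T ≤ X ∨ (T ≤ X + Y ∧ ENNReal.ofReal (1 / 384 * Y) ≤ eRan.{u} 𝕜 p q N M n) := by
    have hTle : T ≤ X + Y := by
      rw [hT, one_div_mul_eq_div]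
      exact div_le_self (by linarith) (by linarith)
    rcases eq_or_ne q ∞ with rfl | hq'
    · rw [deltaTop_top, ← Real.sqrt_eq_rpow] at hY
      rcases le_or_gt (Real.logb 2 ((N : ℝ) + 1)) k with hkL | hkL
      · right
        refine ⟨hTle, ?_⟩
        have h2 := eRan_top_ge_rate (𝕜 := 𝕜) (p := p) hN hM hk hn hnk hnM
        rw [min_eq_left hkL, mul_comm (√_)] at h2
        rwa [hY]
      · left
        rw [hT, one_div_mul_eq_div, div_le_iff₀ (by linarith)]
        suffices hYX : Y ≤ 4 * p.toReal * X by linarith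
        have h2 : (k : ℝ) ^ (-(1 / 2) : ℝ) ≤ √(Real.logb 2 ((N : ℝ) + 1))
            * (k : ℝ) ^ (-(1 - recip p)) := by
          calc (k : ℝ) ^ (-(1 / 2) : ℝ) = (k : ℝ) ^ (1 / 2 - recip p) * (k : ℝ) ^ (-(1 - recip p)) := by
                rw [← Real.rpow_add hk00]; congr 1; ring
            _ ≤ (k : ℝ) ^ (1 / 2 : ℝ) * (k : ℝ) ^ (-(1 - recip p)) := by
                gcongr
                linarith [recip_nonneg p]
            _ ≤ _ := by
                rw [← Real.sqrt_eq_rpow]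
                gcongr
        calc Y ≤ (√(Real.logb 2 ((N : ℝ) + 1)) * (k : ℝ) ^ (-(1 - recip p)))
              * √(Real.logb 2 ((N : ℝ) + 1)) := by rw [hY]; gcongr
          _ = Real.logb 2 ((N : ℝ) + 1) * (k : ℝ) ^ (-(1 - recip p)) := by
              rw [mul_right_comm, Real.mul_self_sqrt (by linarith)]
          _ ≤ 4 * p.toReal * (N : ℝ) ^ recip p * (k : ℝ) ^ (-(1 - recip p)) := by
              gcongr
              exact logb_succ_le hN hp'
          _ = 4 * p.toReal * X := by rw [hX, recip_top, sub_zero]; ring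
    · right
      refine ⟨hTle, ?_⟩
      rw [hY, deltaTop_of_ne hq', zero_div, Real.rpow_zero, mul_one]
      refine le_trans (ENNReal.ofReal_le_ofReal ?_)
        (eRan_ge_signs_rate (p := p) (q := q) hN hM hk hn hnM)
      have h3 : (0 : ℝ) ≤ (k : ℝ) ^ (-(1 / 2) : ℝ) := by positivity
      linarith
  rcases hcase with h | ⟨h, h2⟩
  · exact (ENNReal.ofReal_le_ofReal (by linarith)).trans h1
  · refine ofReal_le_of_le_max ?_ h1 h2
    have h3 := le_max_left (1 / 64 * X) (1 / 384 * Y)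
    have h4 := le_max_right (1 / 64 * X) (1 / 384 * Y)
    linarith

/-- The lower bound for `p ≤ 2` or `q ≤ p`. -/
theorem eRan_ge_rate (hpq : p ≤ 2 ∨ q ≤ p) (hN : 1 ≤ N) (hM : 1 ≤ M) (hk : 1 ≤ k)
    (hn : n ≤ N * k) (hnk : N * k < n + N) (hnM : 16 * n < N * M) :
    ENNReal.ofReal (1 / 384 * (N : ℝ) ^ max (recip p - recip q) 0
      * (k : ℝ) ^ (-(1 - recip (min p 2)))
      * min (Real.logb 2 ((N : ℝ) + 1)) k ^ (deltaTop p * deltaTop q / 2))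
      ≤ eRan.{u} 𝕜 p q N M n := by
  have hN0 : (0 : ℝ) < N := by exact_mod_cast hN
  have hk0 : (0 : ℝ) < k := by exact_mod_cast hk
  rcases le_or_gt p 2 with hp2 | hp2
  · have hp' : p ≠ ∞ := (hp2.trans_lt (by norm_num)).ne
    rw [min_eq_left hp2, deltaTop_of_ne hp', zero_mul, zero_div, Real.rpow_zero, mul_one]
    rcases le_total p q with h | h
    · rw [max_eq_left (by linarith [recip_anti h])]
      refine le_trans (ENNReal.ofReal_le_ofReal ?_)
        (eRan_ge_single_rate (p := p) (q := q) hN hM hk hn hnM)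
      rw [← mul_assoc]
      gcongr
      norm_num
    · rw [max_eq_right (by linarith [recip_anti h]), Real.rpow_zero, mul_one]
      refine le_trans (ENNReal.ofReal_le_ofReal ?_)
        (eRan_ge_row_rate (p := p) (q := q) hp' hN hM hk hn hnM)
      gcongr
      norm_num
  · have hqp : q ≤ p := hpq.resolve_left hp2.not_ge
    rw [max_eq_right (by linarith [recip_anti hqp]), Real.rpow_zero, mul_one, min_eq_right hp2.le,
      recip_two, show -(1 - 1 / 2 : ℝ) = -(1 / 2) by norm_num]
    by_cases hq' : q = ∞
    · subst hq'
      obtain rfl : p = ∞ := top_le_iff.1 hqp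
      rw [deltaTop_top, mul_one, ← Real.sqrt_eq_rpow, mul_assoc, mul_comm _ (√_)]
      exact eRan_top_ge_rate hN hM hk hn hnk hnM
    · rw [deltaTop_of_ne hq', mul_zero, zero_div, Real.rpow_zero, mul_one]
      refine le_trans (ENNReal.ofReal_le_ofReal ?_)
        (eRan_ge_signs_rate (p := p) (q := q) hN hM hk hn hnM)
      gcongr
      norm_num

end Lower

section Upper

variable {𝕜 : Type*} [RCLike 𝕜] {p q : ℝ≥0∞} [hp : Fact (1 ≤ p)] [hq : Fact (1 ≤ q)] {N M n k : ℕ}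

theorem one_sub_recip_min_two_mem : 0 ≤ 1 - recip (min p 2) ∧ 1 - recip (min p 2) ≤ 1 := by
  have : Fact (1 ≤ min p 2) := ⟨le_min hp.out (by norm_num)⟩
  exact ⟨sub_nonneg.2 recip_le_one, by linarith [recip_nonneg (min p 2)]⟩

/-- The number of samples in each row. -/
theorem exists_samples (hN : 1 ≤ N) (hnk : N * k < n + N) :
    k ≤ 1 ∨ ∃ m, 1 ≤ m ∧ N * m ≤ n ∧ k ≤ 2 * m := by
  rcases Nat.lt_or_ge n N with h | h
  · left
    by_contra hk
    push Not at hk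
    nlinarith
  · right
    have h1 := Nat.lt_mul_div_succ n (show 0 < N from hN)
    have h2 : 1 ≤ n / N := (Nat.one_le_div_iff hN).2 h
    refine ⟨n / N, h2, Nat.mul_div_le n N, ?_⟩
    have h3 : N * k < N * (n / N + 2) := by linarith
    have := Nat.lt_of_mul_lt_mul_left h3
    omega

/-- The zero algorithm is used for `n < N`, and also for `p = q = ∞` as long as the logarithm exceeds
`k`. -/
theorem exists_eRanNon_le_rate (𝕜 : Type*) [RCLike 𝕜] (p q : ℝ≥0∞) [hp : Fact (1 ≤ p)]
    [hq : Fact (1 ≤ q)] : ∃ c : ℝ, 0 < c ∧ ∀ n N M k : ℕ, 1 ≤ N → 1 ≤ M → 1 ≤ k →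
      N * k < n + N → eRanNon.{u} 𝕜 p q N M n ≤ ENNReal.ofReal
        (c * (N : ℝ) ^ max (recip p - recip q) 0 * (k : ℝ) ^ (-(1 - recip (min p 2)))
          * min (Real.logb 2 ((N : ℝ) + 1)) k ^ (deltaTop p * deltaTop q / 2)) := by
  have hs := one_sub_recip_min_two_mem (p := p)
  -- it suffices to consider at least two samples in each row
  suffices h : ∃ c : ℝ, 1 ≤ c ∧ ∀ n N M m k : ℕ, 1 ≤ N → 1 ≤ M → 1 ≤ k → 1 ≤ m → N * m ≤ n →
      k ≤ 2 * m → eRanNon.{u} 𝕜 p q N M n ≤ ENNReal.ofReal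
        (c * (N : ℝ) ^ max (recip p - recip q) 0 * (k : ℝ) ^ (-(1 - recip (min p 2)))
          * min (Real.logb 2 ((N : ℝ) + 1)) k ^ (deltaTop p * deltaTop q / 2)) by
    obtain ⟨c, hc, h⟩ := h
    refine ⟨c, by linarith, fun n N M k hN hM hk hnk => ?_⟩
    rcases exists_samples hN hnk with hk1 | ⟨m, hm, hmn, hkm⟩
    · obtain rfl : k = 1 := le_antisymm hk1 hk
      refine (eRanNon_le_zero_alg hN hM).trans (ENNReal.ofReal_le_ofReal ?_)
      rw [Nat.cast_one, Real.one_rpow, min_eq_right (one_le_logb_succ hN), Real.one_rpow, mul_one,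
        mul_one]
      exact le_mul_of_one_le_left (by positivity) hc
    · exact h n N M m k hN hM hk hm hmn hkm
  have hcmp : ∀ {m k : ℕ} {s : ℝ}, 1 ≤ k → k ≤ 2 * m → 0 ≤ s → s ≤ 1 →
      (m : ℝ) ^ (-s) ≤ 2 * (k : ℝ) ^ (-s) := fun hk hkm h0 h1 =>
    rpow_neg_le_mul_rpow_neg (by exact_mod_cast hk) (by norm_num)
      (by exact_mod_cast hkm) h0 h1
  rcases eq_or_ne p ∞ with rfl | hp'
  · have hmin : -(1 - recip (min ∞ 2)) = -(1 / 2) := by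
      rw [min_eq_right le_top, recip_two]; norm_num
    rcases eq_or_ne q ∞ with rfl | hq'
    · refine ⟨16, by norm_num, fun n N M m k hN hM hk hm hmn hkm => ?_⟩
      have hk0 : (0 : ℝ) < k := by exact_mod_cast hk
      have hm0 : (0 : ℝ) < m := by exact_mod_cast hm
      have hL := one_le_logb_succ hN
      rw [hmin, sub_self, max_self, Real.rpow_zero, mul_one, deltaTop_top, mul_one,
        ← Real.sqrt_eq_rpow, ← inv_sqrt_eq_rpow hk0.le]
      rcases le_total (k : ℝ) (Real.logb 2 ((N : ℝ) + 1)) with hkL | hkL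
      · refine (eRanNon_le_zero_alg hN hM).trans (ENNReal.ofReal_le_ofReal ?_)
        rw [min_eq_right hkL, sub_self, max_self, Real.rpow_zero,
          inv_mul_cancel_right₀ (by positivity)]
        norm_num
      · refine (eRanNon_top_top_le_mc hN hM hm hmn).trans (ENNReal.ofReal_le_ofReal ?_)
        rw [min_eq_left hkL, Real.sqrt_div (by linarith), div_eq_mul_inv, inv_sqrt_eq_rpow hm0.le,
          inv_sqrt_eq_rpow hk0.le]
        have h1 := hcmp (s := 1 / 2) hk hkm (by norm_num) (by norm_num)
        nlinarith [mul_le_mul_of_nonneg_left h1 (Real.sqrt_nonneg (Real.logb 2 ((N : ℝ) + 1)))]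
    · have : Fact (1 ≤ max q 2) := ⟨le_max_of_le_left hq.out⟩
      have hc : 0 < mcConst (max q 2) := mcConst_pos (by simp [hq'])
      refine ⟨1 + 2 * mcConst (max q 2), by linarith, fun n N M m k hN hM hk hm hmn hkm => ?_⟩
      refine (eRanNon_top_le_mc hq' hN hM hm hmn).trans (ENNReal.ofReal_le_ofReal ?_)
      rw [hmin, recip_top, zero_sub, max_eq_right (neg_nonpos.2 (recip_nonneg q)), Real.rpow_zero,
        mul_one, deltaTop_of_ne hq', mul_zero, zero_div, Real.rpow_zero, mul_one]
      have h1 := hcmp (s := 1 / 2) hk hkm (by norm_num) (by norm_num)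
      have h2 : (0 : ℝ) ≤ (k : ℝ) ^ (-(1 / 2) : ℝ) := by positivity
      nlinarith [mul_le_mul_of_nonneg_left h1 hc.le]
  · have hc := mcConst_pos hp'
    refine ⟨1 + 2 * mcConst p, by linarith, fun n N M m k hN hM hk hm hmn hkm => ?_⟩
    refine (eRanNon_le_mc hp' hN hM hm hmn).trans (ENNReal.ofReal_le_ofReal ?_)
    rw [deltaTop_of_ne hp', zero_mul, zero_div, Real.rpow_zero, mul_one]
    have h1 := hcmp hk hkm hs.1 hs.2
    have h2 : (0 : ℝ) ≤ (N : ℝ) ^ max (recip p - recip q) 0 := by positivity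
    have h3 : (0 : ℝ) ≤ (k : ℝ) ^ (-(1 - recip (min p 2))) := by positivity
    calc mcConst p * (N : ℝ) ^ max (recip p - recip q) 0 * (m : ℝ) ^ (-(1 - recip (min p 2)))
        ≤ mcConst p * (N : ℝ) ^ max (recip p - recip q) 0
          * (2 * (k : ℝ) ^ (-(1 - recip (min p 2)))) := by gcongr
      _ ≤ _ := by nlinarith [mul_nonneg h2 h3]

/-- The upper bound for `2 < p < q`, with the number `4 ⌈log₂ (N + M)⌉` of groups in the medians. The
zero algorithm is used while a pilot group would be empty. -/
theorem eRan_le_log_rate (hp2 : 2 < p) (hpq : p < q) (hn : 1 ≤ n) (hN : 1 ≤ N) (hM : 1 ≤ M)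
    (hnM : n ≤ N * M) :
    eRan.{u} 𝕜 p q N M n ≤ ENNReal.ofReal (24576 * (N : ℝ) ^ (recip p - recip q)
      * ceilDivLog n N M ^ (-(1 - recip p)) + 24576 * ceilDivLog n N M ^ (-(1 / 2) : ℝ)) := by
  have hp' : p ≠ ∞ := (hpq.trans_le le_top).ne
  have hn0 : (0 : ℝ) < n := by exact_mod_cast hn
  have hN0 : (1 : ℝ) ≤ N := by exact_mod_cast hN
  have hM0 : (1 : ℝ) ≤ M := by exact_mod_cast hM
  have hs0 : 0 ≤ 1 - recip p := sub_nonneg.2 recip_le_one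
  have hs1 : 1 - recip p ≤ 1 := by linarith [recip_nonneg p]
  set L : ℝ := Real.logb 2 ((N : ℝ) + M) with hL
  have hL1 : 1 ≤ L := by
    rw [hL, Real.le_logb_iff_rpow_le (by norm_num) (by linarith), Real.rpow_one]
    linarith
  set X : ℝ := (n : ℝ) / (N * L) with hX
  have hX0 : 0 < X := by positivity
  have hκ : ceilDivLog n N M = ⌈X⌉₊ := rfl
  rw [hκ]
  have hκ1 : (1 : ℝ) ≤ ⌈X⌉₊ := by exact_mod_cast Nat.ceil_pos.2 hX0
  have hκX := (Nat.ceil_lt_add_one hX0.le).le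
  set κ : ℝ := (⌈X⌉₊ : ℝ) with hκdef
  have hκ0 : 0 < κ := by linarith
  have hpos1 : 0 ≤ (N : ℝ) ^ (recip p - recip q) := by positivity
  have hpos2 : 0 ≤ κ ^ (-(1 - recip p)) := by positivity
  have hpos3 : 0 ≤ κ ^ (-(1 / 2) : ℝ) := by positivity
  rcases lt_or_ge X 32 with hX32 | hX32
  · refine (eRan_le_eRanNon.trans (eRanNon_le_zero_alg hN hM)).trans (ENNReal.ofReal_le_ofReal ?_)
    rw [max_eq_left (by linarith [recip_anti hpq.le])]
    have h1 := rpow_neg_le_mul_rpow_neg (a := 1) (C := 33) hκ0 (by norm_num) (by linarith)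
      hs0 hs1
    rw [Real.one_rpow] at h1
    nlinarith [mul_le_mul_of_nonneg_left h1 hpos1, mul_nonneg hpos1 hpos2]
  · set m := ⌊X / 32⌋₊ with hm
    have hm1 : 1 ≤ m := Nat.le_floor (by rw [Nat.cast_one]; linarith)
    have hmX : (m : ℝ) ≤ X / 32 := Nat.floor_le (by positivity)
    have hXm : X / 32 < m + 1 := Nat.lt_floor_add_one _
    have hm0 : (1 : ℝ) ≤ m := by exact_mod_cast hm1
    set b := Nat.clog 2 (N + M) with hb
    have hb1 : 1 ≤ b := Nat.clog_pos (by norm_num) (by omega)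
    have hpow : (N + M) ^ 4 ≤ 2 ^ (4 * b) := by
      rw [mul_comm, pow_mul]
      exact Nat.pow_le_pow_left (Nat.le_pow_clog (by norm_num) _) 4
    have hbL : (b : ℝ) ≤ 2 * L := by
      have h1 : 2 ^ (b - 1) < N + M := Nat.pow_pred_clog_lt_self (by norm_num) (by omega)
      have h2 : ((2 : ℝ)) ^ ((b - 1 : ℕ) : ℝ) ≤ N + M := by
        rw [Real.rpow_natCast]
        exact_mod_cast h1.le
      have h3 : ((b - 1 : ℕ) : ℝ) ≤ L := by
        rw [hL, Real.le_logb_iff_rpow_le (by norm_num) (by linarith)]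
        exact h2
      have h4 : ((b - 1 : ℕ) : ℝ) = b - 1 := by rw [Nat.cast_sub hb1, Nat.cast_one]
      linarith
    have hcost : 4 * (N * (4 * b) * m) ≤ n := by
      have h1 : (4 * (N * (4 * b) * m) : ℝ) ≤ n := by
        calc (4 * (N * (4 * b) * m) : ℝ) ≤ 4 * (N * (4 * (2 * L)) * (X / 32)) := by gcongr
          _ = N * L * X := by ring
          _ = n := mul_div_cancel₀ _ (by positivity)
      exact_mod_cast h1
    have hmn : m ≤ n := by
      refine le_trans ?_ hcost
      have : 1 ≤ N * (4 * b) := Nat.mul_pos hN (by omega)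
      nlinarith
    refine (eRan_le_adaptive hN hM (by omega) hm1 (hmn.trans hnM) hpow hcost hp2 hpq.le hp').trans
      (ENNReal.ofReal_le_ofReal ?_)
    have hκm : κ ≤ 128 * m := by linarith
    have h1 := rpow_neg_le_mul_rpow_neg hκ0 (by norm_num) hκm hs0 hs1
    have h2 := rpow_neg_le_mul_rpow_neg (s := 1 / 2) hκ0 (by norm_num) hκm
      (by norm_num) (by norm_num)
    have h3 := mul_le_mul_of_nonneg_left h1 hpos1
    linarith

end Upper

end

theorem theorem4p5 (𝕜 : Type*) [RCLike 𝕜] (p q : ℝ≥0∞) [Fact (1 ≤ p)] [Fact (1 ≤ q)] :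
    ∃ c₀ c₁ c₂ c₃ c₄ c₅ c₆ c₇ : ℝ, 0 < c₀ ∧ c₀ < 1 ∧ 0 < c₁ ∧ 0 < c₂ ∧ 0 < c₃ ∧ 0 < c₄ ∧ 0 < c₅ ∧
      0 < c₆ ∧ 0 < c₇ ∧
      ∀ n N₁ N₂ : ℕ, 1 ≤ n → 1 ≤ N₁ → 1 ≤ N₂ → (n : ℝ) < c₀ * (N₁ : ℝ) * (N₂ : ℝ) →
        ((p ≤ 2 ∨ q ≤ p) →
          ENNReal.ofReal (c₁ * (N₁ : ℝ) ^ (max (recip p - recip q) 0)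
              * ceilDiv n N₁ ^ (-(1 - recip (min p 2)))
              * (min (Real.logb 2 ((N₁ : ℝ) + 1)) (ceilDiv n N₁)) ^ (deltaTop p * deltaTop q / 2))
            ≤ eRan.{u} 𝕜 p q N₁ N₂ n ∧
          eRan.{u} 𝕜 p q N₁ N₂ n ≤ eRanNon.{u} 𝕜 p q N₁ N₂ n ∧
          eRanNon.{u} 𝕜 p q N₁ N₂ n ≤
            ENNReal.ofReal (c₂ * (N₁ : ℝ) ^ (max (recip p - recip q) 0)
              * ceilDiv n N₁ ^ (-(1 - recip (min p 2)))
              * (min (Real.logb 2 ((N₁ : ℝ) + 1)) (ceilDiv n N₁))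
                  ^ (deltaTop p * deltaTop q / 2))) ∧
        (2 < p → p < q →
          (ENNReal.ofReal (c₃ * (N₁ : ℝ) ^ (recip p - recip q)
                * ceilDiv n N₁ ^ (-(1 - recip p))
              + c₃ * ceilDiv n N₁ ^ (-(1 / 2) : ℝ)
                * (Real.logb 2 ((N₁ : ℝ) + 1)) ^ (deltaTop q / 2))
            ≤ eRan.{u} 𝕜 p q N₁ N₂ n ∧
          eRan.{u} 𝕜 p q N₁ N₂ n ≤
            ENNReal.ofReal (c₄ * (N₁ : ℝ) ^ (recip p - recip q)
                * ceilDivLog n N₁ N₂ ^ (-(1 - recip p))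
              + c₄ * ceilDivLog n N₁ N₂ ^ (-(1 / 2) : ℝ))) ∧
          (ENNReal.ofReal (c₅ * (N₁ : ℝ) ^ (recip p - recip q) * ceilDiv n N₁ ^ (-(1 / 2) : ℝ))
            ≤ eRanNon.{u} 𝕜 p q N₁ N₂ n ∧
          eRanNon.{u} 𝕜 p q N₁ N₂ n ≤
            ENNReal.ofReal
              (c₆ * (N₁ : ℝ) ^ (recip p - recip q) * ceilDiv n N₁ ^ (-(1 / 2) : ℝ)))) ∧
        (ENNReal.ofReal (c₇ * (N₁ : ℝ) ^ (max (recip p - recip q) 0))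
            ≤ eDet 𝕜 p q N₁ N₂ n ∧
          eDet 𝕜 p q N₁ N₂ n ≤ eDetNon 𝕜 p q N₁ N₂ n ∧
          eDetNon 𝕜 p q N₁ N₂ n ≤
            ENNReal.ofReal ((N₁ : ℝ) ^ (max (recip p - recip q) 0))) := by
  have hp1 : 1 / (448 * (1 + 4 * p.toReal)) > 0 := by
    have : 0 ≤ p.toReal := ENNReal.toReal_nonneg
    positivity
  obtain ⟨c, hc, hup⟩ := exists_eRanNon_le_rate.{u} 𝕜 p q
  refine ⟨1 / 16, 1 / 384, c, 1 / (448 * (1 + 4 * p.toReal)), 24576, 1 / 30, c, 1 / 2, by norm_num,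
    by norm_num, by norm_num, hc, hp1, by norm_num, by norm_num, hc, by norm_num, ?_⟩
  intro n N M hn hN hM hlt
  have hnM : 16 * n < N * M := by
    have h1 : (16 * n : ℝ) < N * M := by linarith
    exact_mod_cast h1
  obtain ⟨k, hk, hk1, hnk, hnk'⟩ := exists_ceilDiv hn hN
  rw [hk]
  refine ⟨fun hpq => ⟨eRan_ge_rate hpq hN hM hk1 hnk hnk' hnM, eRan_le_eRanNon,
    hup n N M k hN hM hk1 hnk'⟩, fun hp2 hpq => ⟨⟨?_, eRan_le_log_rate hp2 hpq hn hN hM (by omega)⟩,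
    eRanNon_ge_rate hN hM hk1 hnk hnM, ?_⟩, eDet_ge hN hM (by omega), eDet_le_eDetNon,
    eDetNon_le hN hM⟩
  · rw [mul_assoc, mul_assoc (1 / (448 * (1 + 4 * p.toReal)) : ℝ), ← mul_add]
    exact eRan_ge_sum_rate hpq hN hM hk1 hnk hnk' hnM
  · have h := hup n N M k hN hM hk1 hnk'
    rwa [max_eq_left (by linarith [recip_anti hpq.le]), min_eq_right hp2.le, recip_two,
      show -(1 - 1 / 2 : ℝ) = -(1 / 2) by norm_num, deltaTop_of_ne (hpq.trans_le le_top).ne,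
      zero_mul, zero_div, Real.rpow_zero, mul_one] at h
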